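/- **Setting.** Let $0<k_1<k_2$ be constants and let $k_{3,1}=k_{3,1}(n)\ge 0$, $k_{3,2}=k_{3,2}(n)\ge 0$. The chain of length $2n$ consists of masses with displacements $q_1,\dots,q_{2n}$ and $q_0=q_{2n+1}=0$, where $$\ddot q_1=k_1(q_2-q_1)+k_{3,1}(q_0-q_1),\qquad \ddot q_{2n}=k_1(q_{2n-1}-q_{2n})+k_{3,2}(q_{2n+1}-q_{2n}),$$ $$\ddot q_{2m}=k_1(q_{2m-1}-q_{2m})+k_2(q_{2m+1}-q_{2m}),\quad \ddot q_{2m+1}=k_2(q_{2m}-q_{2m+1})+k_1(q_{2m+2}-q_{2m+1})\quad(1\le m\le n-1).$$ An eigenstate with eigenfrequency $\omega$ is a nonzero $u$ such that $q_j=e^{i\omega t}u_j$ is a solution. In the bulk, $(u_{2m+1},u_{2m+2})^T=\mathcal T(\omega)(u_{2m-1},u_{2m})^T$ with $$\mathcal T(\omega)=\frac1{k_1k_2}\begin{pmatrix}-k_1^2&-k_1x\\ k_1x&x^2-k_2^2\end{pmatrix},\qquad x=\omega^2-k_1-k_2,\qquad \det\mathcal T=1 .$$ If $\mathcal T(\omega)$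 has a real eigenvalue (that is, $\omega^2\notin(0,2k_1)\cup(2k_2,2k_1+2k_2)$), $a$ denotes the one with $|a|\le1$. If $|a|<1$ then $(u_{2m+1},u_{2m+2})^T=c_1a^mv_1+c_2a^{-m}v_2$ for $0\le m<n$, with the eigenvectors $v_1=(k_1+k_2/a,\,-x)^T$, $v_2=(-x,\,k_1+k_2/a)^T$ of $\mathcal T(\omega)$ for $a$ and $1/a$, which have equal length. "A state with $a\approx\pm1$" always means one with real $a$. **Asymptotics** ($n\to\infty$). $f\approx g$ means $f-g=o(g)$; $f\not\approx g$ means that for some $c>0$, $|f-g|>c(|f|+|g|)$ for all large $n$; $f\gg1$ means $f\to\infty$. A *left edge state* is an eigenstate (for each large $n$) with $|a|\not\approx1$, $c_1\neq0$ and $\left|\frac{c_2}{c_1}a^{2-2n}\right|=\mathcal O(1)$. A state is *localized at both edges* if $|a|\not\approx1$ and $\left|\frac{c_2}{c_1}a^{-2n}\right|\gg1$ holds for the state and for its mirror image (in which $c_2a^{1-n}$, $c_1a^{n-1}$ take the place of $c_1,c_2$). When $|k_{3,1}-k_2|\ne k_2$, let $\tilde a=\tilde a(k_{3,1})$ be the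 root in $(-1,1)$ of $$(k_{3,1}-k_2)^2k_1\tilde a^2+\left[k_2(k_{3,1}-k_2)^2-k_2^3\right]\tilde a-k_1k_2^2=0 .$$ **Theorem.** 1. Suppose $|k_{3,1}-k_2|\not\approx k_2$. * If $k_{3,2}\approx k_{3,1}$, there exist, for large $n$, two eigenstates with different $\omega^2$ that are localized at both edges. * If $k_{3,2}\not\approx k_{3,1}$, there exists a left edge state with $a\approx\tilde a$ and $|a-\tilde a|=\mathcal O(|\tilde a|^{2n})$. It has the following further properties. If $k_{3,1}=k_2$ for large $n$, then $a\approx-\frac{k_1}{k_2}$ and $\left|a+\frac{k_1}{k_2}\right|=\mathcal O\left(\left(\frac{k_1}{k_2}\right)^{4n}\right)$. If $k_{3,1}\approx k_2$, then $a\approx-\frac{k_1}{k_2}$. If $k_{3,1}\not\approx k_2$, then $\tilde a\not\approx-\frac{k_1}{k_2}$. * If $|k_{3,2}-k_2|\not\approx k_2$, there is no eigenstate with $a\approx\pm1$: for some $\varepsilon>0$ and all large $n$, no eigenstate has real $a$ with $|a|>1-\varepsilon$. * If $|k_{3,2}-k_2|\approx k_2$, there is at most one eigenstate with $a\approx\pm1$: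 for some $\varepsilon>0$ and all large $n$, at most one eigenstate up to scalar multiples has real $a$ with $|a|>1-\varepsilon$. * Let $\sigma,\tau\in\{1,-1\}$. If $k_{3,2}-k_2\approx-\tau\sigma k_2$, then any eigenstate with $a\approx\tau$ satisfies $\omega^2\approx W:=k_1+k_2-\sigma(k_1+\tau k_2)$: for every $\delta>0$ there is $\varepsilon>0$ such that for all large $n$ every eigenstate with real $a$ and $|a-\tau|<\varepsilon$ has $|\omega^2-W|\le\delta|W|$. 2. Suppose $|k_{3,1}-k_2|\approx k_2$ and $|k_{3,2}-k_2|\approx k_2$. * There are at most two eigenstates with $a\approx\pm1$: for some $\varepsilon>0$ and all large $n$, any three eigenstates with real $a$ and $|a|>1-\varepsilon$ are linearly dependent. * If $\sigma,\tau\in\{1,-1\}$ and $k_{3,i}-k_2\approx-\tau\sigma k_2$ for both $i=1,2$, then any eigenstate with $a\approx\tau$ satisfies $\omega^2\approx k_1+k_2-\sigma(k_1+\tau k_2)$, in the same sense as above. -/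

import Mathlib

open Filter Asymptotics Topology

namespace DiatomicChain

/-- Stiffness of the spring joining mass `j` to mass `j + 1` in the chain of masses `1, …, 2 n`
(positions `0` and `2 n + 1` are the fixed ends): `k31` at the left end, `k32` at the right end,
`k1` inside a unit cell `(2 m - 1, 2 m)` and `k2` between neighbouring cells. -/
def stiffness (k1 k2 k31 k32 : ℝ) (n j : ℕ) : ℝ :=
  if j = 0 then k31 else if j = 2 * n then k32 else if Odd j then k1 else k2

/-- `q_j(t) = exp (i ω t) u_j` is a nonzero time-periodic solution of the equations of motion of
the chain of length `2 n` with fixed ends, i.e. `u` is an eigenstate with eigenfrequency `ω`.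
Only the entries `u 1, …, u (2 n)` matter, all the others are set to `0`. -/
def IsEigenstate (k1 k2 k31 k32 : ℝ) (n : ℕ) (ω : ℝ) (u : ℕ → ℝ) : Prop :=
  u ≠ 0 ∧ (∀ j, j = 0 ∨ 2 * n < j → u j = 0) ∧
    ∀ j < 2 * n,
      -(ω ^ 2) * u (j + 1) =
        stiffness k1 k2 k31 k32 n j * (u j - u (j + 1)) +
          stiffness k1 k2 k31 k32 n (j + 1) * (u (j + 2) - u (j + 1))

/-- The matrix that maps the unit cell `(u_{2m-1}, u_{2m})` to the next one `(u_{2m+1}, u_{2m+2})`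
in a bulk oscillation with frequency `ω`. -/
noncomputable def transferMatrix (k1 k2 ω : ℝ) : Matrix (Fin 2) (Fin 2) ℝ :=
  (1 / (k1 * k2)) •
    !![-k1 ^ 2, -k1 * (ω ^ 2 - k1 - k2);
       k1 * (ω ^ 2 - k1 - k2), (ω ^ 2 - k1 - k2) ^ 2 - k2 ^ 2]

/-- `a` is a real eigenvalue of the transfer matrix, namely (the matrix has determinant `1`) the one
with `|a| ≤ 1`. It exists iff `ω` lies outside the interior of the two frequency bands. -/
def IsDecayFactor (k1 k2 ω a : ℝ) : Prop :=
  |a| ≤ 1 ∧ Module.End.HasEigenvalue (Matrix.toLin' (transferMatrix k1 k2 ω)) a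

/-- Eigenvector `v₁` of the transfer matrix for its eigenvalue `a`. -/
noncomputable def v₁ (k1 k2 ω a : ℝ) : Fin 2 → ℝ := ![k1 + k2 / a, -(ω ^ 2 - k1 - k2)]

/-- Eigenvector `v₂` of the transfer matrix for its eigenvalue `1 / a`; `v₁` and `v₂` have the same
length, so that quotients of coefficients do not depend on the normalization. -/
noncomputable def v₂ (k1 k2 ω a : ℝ) : Fin 2 → ℝ := ![-(ω ^ 2 - k1 - k2), k1 + k2 / a]

/-- Spatial profile of the state `u`: the cell number `m` (counted from `0`) is
`c₁ a ^ m v₁ + c₂ a ^ (-m) v₂`. -/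
def HasProfile (k1 k2 : ℝ) (n : ℕ) (ω : ℝ) (u : ℕ → ℝ) (a c₁ c₂ : ℝ) : Prop :=
  ∀ m < n, ![u (2 * m + 1), u (2 * m + 2)] =
    (c₁ * a ^ m) • v₁ k1 k2 ω a + (c₂ * (a ^ m)⁻¹) • v₂ k1 k2 ω a

/-- `u` is an eigenstate with frequency `ω`, decay factor `a` and profile coefficients `c₁, c₂`. -/
def IsState (k1 k2 k31 k32 : ℝ) (n : ℕ) (ω : ℝ) (u : ℕ → ℝ) (a c₁ c₂ : ℝ) : Prop :=
  IsEigenstate k1 k2 k31 k32 n ω u ∧ IsDecayFactor k1 k2 ω a ∧ HasProfile k1 k2 n ω u a c₁ c₂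

/-- The value `ã(k31)`: the root in `(-1, 1)` of the quadratic (linear if `k31 = k2`) equation for
the left edge state of the semi-infinite chain. -/
def IsSemiInfiniteFactor (k1 k2 k31 a : ℝ) : Prop :=
  |a| < 1 ∧
    (k31 - k2) ^ 2 * k1 * a ^ 2 + (k2 * (k31 - k2) ^ 2 - k2 ^ 3) * a - k1 * k2 ^ 2 = 0

/-- `f` stays away from `g`: their relative difference is bounded below for large `n`. -/
def StaysAway (f g : ℕ → ℝ) : Prop :=
  ∃ c > 0, ∀ᶠ n in atTop, c * (|f n| + |g n|) < |f n - g n|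

/-- The asymptotic conditions on a left edge state in long chains. -/
def IsLeftEdge (a c₁ c₂ : ℕ → ℝ) : Prop :=
  StaysAway (fun n => |a n|) (fun _ => 1) ∧ (∀ᶠ n in atTop, c₁ n ≠ 0) ∧
    (fun n => c₂ n / c₁ n * a n ^ (2 - 2 * (n : ℤ))) =O[atTop] (fun _ => (1 : ℝ))

/-- The asymptotic conditions on a state localized at both edges: it decays fast, and
`|c₂ / c₁ * a ^ (-2 n)| ≫ 1` holds both for the state and for its mirror image, which has
`c₂ a ^ (1 - n)` and `c₁ a ^ (n - 1)` in the place of `c₁` and `c₂`. -/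
def IsTwoSidedEdge (a c₁ c₂ : ℕ → ℝ) : Prop :=
  StaysAway (fun n => |a n|) (fun _ => 1) ∧
    Tendsto (fun n => |c₂ n / c₁ n * a n ^ (-2 * (n : ℤ))|) atTop atTop ∧
    Tendsto (fun n => |(c₁ n * a n ^ ((n : ℤ) - 1)) / (c₂ n * a n ^ (1 - (n : ℤ))) *
      a n ^ (-2 * (n : ℤ))|) atTop atTop

/-- Eigenstates with a real decay factor that is `ε`-close to `1` or `-1`. -/
def slowStates (k1 k2 k31 k32 : ℝ) (n : ℕ) (ε : ℝ) : Set (ℕ → ℝ) :=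
  {u | ∃ ω a, IsEigenstate k1 k2 k31 k32 n ω u ∧ IsDecayFactor k1 k2 ω a ∧ 1 - ε < |a|}

/-- In long chains at most `m` eigenstates (up to linear dependence) have `a ≈ ± 1`. -/
def AtMostSlow (m : ℕ) (k1 k2 : ℝ) (k31 k32 : ℕ → ℝ) : Prop :=
  ∃ ε > 0, ∀ᶠ n in atTop, ∀ f : Fin (m + 1) → (ℕ → ℝ),
    (∀ i, f i ∈ slowStates k1 k2 (k31 n) (k32 n) n ε) → ¬ LinearIndependent ℝ f

/-- In long chains every eigenstate with `a ≈ τ` (`τ = 1` or `τ = -1`) has `ω ^ 2 ≈ W`. -/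
def SlowFrequency (τ W k1 k2 : ℝ) (k31 k32 : ℕ → ℝ) : Prop :=
  ∀ δ > 0, ∃ ε > 0, ∀ᶠ n in atTop, ∀ (ω a : ℝ) (u : ℕ → ℝ),
    IsEigenstate k1 k2 (k31 n) (k32 n) n ω u → IsDecayFactor k1 k2 ω a → |a - τ| < ε →
      |ω ^ 2 - W| ≤ δ * |W|

end DiatomicChain

namespace DiatomicChain

/-! In units of `k2` the ends are described by `α` and `β`, and a real `a` with `|a| ≤ 1` is a decay
factor iff `x ^ 2 = 1 + κ ^ 2 + κ (a + 1 / a)`. So `a < 0` belongs to the gap `x ^ 2 ≤ (1 - κ) ^ 2`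
and `a > 0` to the outside of both bands, `x ^ 2 ≥ (1 + κ) ^ 2`. The thresholds are `α = ±1`, that
is `k31 = 2 k2` and `k31 = 0`.

Existence. Parametrize a state with `|a| < 1` by the end stiffness `s = S / T` at which a
semi-infinite chain would carry it; then `x = S (κ a + 1) / T`. The two boundary conditions become
the single equation `(s - α)(s - β) = a ^ (2 n) (1 - α s)(1 - β s)`, whose right side is
exponentially small (`exists_isState`). The parameter is `s` in the gap and `t = 1 / s` above the
bands. If `α` and `β` differ, the intermediate value theorem gives a root exponentially close to
`α`: the left edge state (`exists_root_near`, `exists_left_edge`). If they nearly agree, the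
difference of the two sides is negative at `α` and positive farther out on both sides, which gives
two roots. There `(s - α) / (1 - α s)` and `(s - β) / (1 - β s)` have the tiny product `a ^ (2 n)`
and are almost equal, so both are small, and this is localization at both edges (`exists_two_roots`,
`sq_mobius_le`).

Counting. With `H` the operator of the rescaled chain, `H ^ 2` compares with `(1 + κ) ^ 2` and with
`(1 - κ) ^ 2` up to a sum of squares and one boundary term per end (`IsImage.chainSum_sq`). Each end
costs one linear condition, so at most two frequencies belong to real `a`
(`not_three_outside_bands`). A left edge state, which exists in part 1 when the other end is at a
threshold, leaves room for only one slow state.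

Frequencies. For `a ≈ τ` the characteristic equation, divided by a geometric sum, stays regular up
to `|a| = 1`. In the limit `x → s (κ τ + 1)`, `s = ±1`, it reads `κ (κ + τ)(α - s)(β - s) = 0`
(`CellEquations.characteristic`, `no_state_near_band_edge`). Hence there is no slow state near a
band edge whose threshold both ends avoid. This excludes slow states altogether or selects one of
the two possible values of `x`. -/

/-! ### Rescaled equations, simplicity of the frequencies, decay factors. -/

/-- The equations of motion of a chain of `N + 1` cells in units of `k2`: `κ = k1 / k2`,
`α = k31 / k2 - 1`, `β = k32 / k2 - 1` and `x = ω ^ 2 / k2 - κ - 1`. -/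
structure CellEquations (κ α β : ℝ) (N : ℕ) (x : ℝ) (u : ℕ → ℝ) : Prop where
  left : (x - α) * u 1 + κ * u 2 = 0
  even : ∀ m < N, x * u (2 * m + 2) + κ * u (2 * m + 1) + u (2 * m + 3) = 0
  odd : ∀ m < N, x * u (2 * m + 3) + u (2 * m + 2) + κ * u (2 * m + 4) = 0
  right : (x - β) * u (2 * N + 2) + κ * u (2 * N + 1) = 0

theorem isEigenstate_succ_iff {k1 k2 A B ω : ℝ} {N : ℕ} {u : ℕ → ℝ} (hk2 : 0 < k2) :
    IsEigenstate k1 k2 A B (N + 1) ω u ↔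
      u ≠ 0 ∧ (∀ j, j = 0 ∨ 2 * (N + 1) < j → u j = 0) ∧
        CellEquations (k1 / k2) (A / k2 - 1) (B / k2 - 1) N (ω ^ 2 / k2 - k1 / k2 - 1) u := by
  unfold IsEigenstate
  refine and_congr_right fun _ => and_congr_right fun hs => ?_
  have h0 : u 0 = 0 := hs 0 (Or.inl rfl)
  have hlast : u (2 * N + 3) = 0 := hs _ (Or.inr (by omega))
  have hk2' := hk2.ne'
  have s0 : stiffness k1 k2 A B (N + 1) 0 = A := by simp [stiffness]
  have s1 : stiffness k1 k2 A B (N + 1) (2 * (N + 1)) = B := by simp [stiffness]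
  have so : ∀ m, stiffness k1 k2 A B (N + 1) (2 * m + 1) = k1 := fun m => by
    have h1 : ¬ (2 * m + 1 = 2 * (N + 1)) := by omega
    have h2 : Odd (2 * m + 1) := ⟨m, rfl⟩
    simp only [stiffness, h1, h2, if_true, if_false, Nat.succ_ne_zero]
  have se : ∀ m < N, stiffness k1 k2 A B (N + 1) (2 * m + 2) = k2 := fun m hm => by
    have h1 : ¬ (2 * m + 2 = 2 * (N + 1)) := by omega
    have h2 : ¬ Odd (2 * m + 2) := by rw [Nat.not_odd_iff_even]; exact ⟨m + 1, by ring⟩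
    simp only [stiffness, h1, h2, if_false, Nat.succ_ne_zero]
  constructor
  · intro h
    refine ⟨?_, fun m hm => ?_, fun m hm => ?_, ?_⟩
    · have := h 0 (by omega)
      rw [s0, so 0, h0] at this
      field_simp
      simp only [zero_add] at this
      linarith
    · have := h (2 * m + 1) (by omega)
      rw [so m, se m hm] at this
      field_simp
      simp only [add_assoc] at this ⊢
      norm_num at this ⊢
      linarith
    · have := h (2 * m + 2) (by omega)
      rw [se m hm, show 2 * m + 2 + 1 = 2 * (m + 1) + 1 by ring, so (m + 1)] at this
      field_simp
      ring_nf at this ⊢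
      linarith
    · have := h (2 * N + 1) (by omega)
      rw [so N, show 2 * N + 1 + 1 = 2 * (N + 1) by ring, s1,
        show 2 * N + 1 + 2 = 2 * N + 3 by ring, hlast] at this
      field_simp
      ring_nf at this ⊢
      linarith
  · rintro ⟨h1, h2, h3, h4⟩ j hj
    rcases Nat.even_or_odd' j with ⟨m, rfl | rfl⟩
    · rcases m with _ | m
      · rw [show 2 * 0 = 0 from rfl, s0, so 0, h0]
        field_simp at h1
        simp only [zero_add]
        linarith
      · have := h3 m (by omega)
        rw [show 2 * (m + 1) = 2 * m + 2 by ring, se m (by omega),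
          show 2 * m + 2 + 1 = 2 * (m + 1) + 1 by ring, so (m + 1)]
        field_simp at this
        ring_nf at this ⊢
        linarith
    · rcases Nat.lt_or_ge m N with hm | hm
      · have := h2 m hm
        rw [so m, show 2 * m + 1 + 1 = 2 * m + 2 by ring, se m hm]
        field_simp at this
        ring_nf at this ⊢
        linarith
      · obtain rfl : m = N := by omega
        rw [so m, show 2 * m + 1 + 1 = 2 * (m + 1) by ring, s1,
          show 2 * m + 1 + 2 = 2 * m + 3 by ring, hlast]
        field_simp at h4
        ring_nf at h4 ⊢
        linarith

/-- The left boundary condition and the bulk equations determine a state by its first entry. -/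
theorem CellEquations.eq_zero_of_left {κ α β x : ℝ} {N : ℕ} {u : ℕ → ℝ} (hκ : 0 < κ)
    (h : CellEquations κ α β N x u) (hu : u 1 = 0) :
    ∀ m ≤ N, u (2 * m + 1) = 0 ∧ u (2 * m + 2) = 0 := by
  intro m
  induction m with
  | zero =>
    intro _
    have := h.left
    rw [hu, mul_zero, zero_add] at this
    exact ⟨hu, (mul_eq_zero.mp this).resolve_left hκ.ne'⟩
  | succ m ih =>
    intro hm
    obtain ⟨h1, h2⟩ := ih (by omega)
    have e1 := h.even m (by omega)
    rw [h1, h2] at e1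
    have e3 : u (2 * m + 3) = 0 := by linarith
    have e2 := h.odd m (by omega)
    rw [h2, e3] at e2
    have : κ * u (2 * m + 4) = 0 := by linarith
    exact ⟨e3, (mul_eq_zero.mp this).resolve_left hκ.ne'⟩

theorem eq_zero_of_cells {N : ℕ} {u : ℕ → ℝ}
    (hs : ∀ j, j = 0 ∨ 2 * (N + 1) < j → u j = 0)
    (h : ∀ m ≤ N, u (2 * m + 1) = 0 ∧ u (2 * m + 2) = 0) : u = 0 := by
  funext j
  by_cases hj : j = 0 ∨ 2 * (N + 1) < j
  · exact hs j hj
  · push Not at hj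
    rcases Nat.even_or_odd' j with ⟨m, rfl | rfl⟩
    · obtain ⟨m, rfl⟩ : ∃ l, m = l + 1 := ⟨m - 1, by omega⟩
      exact (h m (by omega)).2
    · exact (h m (by omega)).1

theorem CellEquations.sub_smul {κ α β x c : ℝ} {N : ℕ} {u v : ℕ → ℝ}
    (hu : CellEquations κ α β N x u) (hv : CellEquations κ α β N x v) :
    CellEquations κ α β N x (u - c • v) := by
  refine ⟨?_, fun m hm => ?_, fun m hm => ?_, ?_⟩ <;>
    simp only [Pi.sub_apply, Pi.smul_apply, smul_eq_mul]
  · linear_combination hu.left - c * hv.left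
  · linear_combination hu.even m hm - c * hv.even m hm
  · linear_combination hu.odd m hm - c * hv.odd m hm
  · linear_combination hu.right - c * hv.right

theorem IsEigenstate.apply_one_ne_zero {k1 k2 A B ω : ℝ} {N : ℕ} {u : ℕ → ℝ} (hk1 : 0 < k1)
    (hk2 : 0 < k2) (h : IsEigenstate k1 k2 A B (N + 1) ω u) : u 1 ≠ 0 := by
  obtain ⟨h0, hs, hc⟩ := (isEigenstate_succ_iff hk2).mp h
  exact fun h1 => h0 (eq_zero_of_cells hs (hc.eq_zero_of_left (div_pos hk1 hk2) h1))

/-- Eigenstates with the same squared frequency are proportional. -/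
theorem IsEigenstate.exists_smul_eq {k1 k2 A B ω ω' : ℝ} {N : ℕ} {u v : ℕ → ℝ} (hk1 : 0 < k1)
    (hk2 : 0 < k2) (hu : IsEigenstate k1 k2 A B (N + 1) ω u)
    (hv : IsEigenstate k1 k2 A B (N + 1) ω' v) (hω : ω ^ 2 = ω' ^ 2) : ∃ c : ℝ, u = c • v := by
  have hv1 := hv.apply_one_ne_zero hk1 hk2
  obtain ⟨_, hsu, hcu⟩ := (isEigenstate_succ_iff hk2).mp hu
  obtain ⟨_, hsv, hcv⟩ := (isEigenstate_succ_iff hk2).mp hv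
  rw [hω] at hcu
  refine ⟨u 1 / v 1, sub_eq_zero.mp ?_⟩
  refine eq_zero_of_cells (N := N) (fun j hj => ?_)
    ((hcu.sub_smul hcv).eq_zero_of_left (div_pos hk1 hk2) ?_)
  · simp [hsu j hj, hsv j hj]
  · simp [hv1]

/-- `a` is a decay factor iff `a + 1 / a` is the trace of the transfer matrix. -/
theorem isDecayFactor_iff {k1 k2 ω a : ℝ} (hk1 : 0 < k1) (hk : k1 < k2) :
    IsDecayFactor k1 k2 ω a ↔ |a| ≤ 1 ∧ a ≠ 0 ∧
      a * (ω ^ 2 / k2 - k1 / k2 - 1) ^ 2 = (k1 / k2 + a) * (k1 / k2 * a + 1) := by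
  have hk2 : 0 < k2 := hk1.trans hk
  unfold IsDecayFactor
  refine and_congr_right fun ha => ?_
  set x := ω ^ 2 - k1 - k2 with hx
  have hk1' := hk1.ne'
  have hk2' := hk2.ne'
  have key : a * (ω ^ 2 / k2 - k1 / k2 - 1) ^ 2 = (k1 / k2 + a) * (k1 / k2 * a + 1) ↔
      a * x ^ 2 = (k1 + k2 * a) * (k1 * a + k2) := by
    rw [show ω ^ 2 / k2 - k1 / k2 - 1 = x / k2 by rw [hx]; field_simp]
    field_simp
  rw [key]
  have hT : ∀ v : Fin 2 → ℝ, Matrix.toLin' (transferMatrix k1 k2 ω) v = a • v ↔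
      (-k1 ^ 2 * v 0 - k1 * x * v 1 = k1 * k2 * a * v 0 ∧
        k1 * x * v 0 + (x ^ 2 - k2 ^ 2) * v 1 = k1 * k2 * a * v 1) := by
    intro v
    rw [funext_iff, Fin.forall_fin_two]
    simp only [Matrix.toLin'_apply, transferMatrix, Pi.smul_apply, smul_eq_mul, Matrix.mulVec,
      dotProduct, Fin.sum_univ_two, Matrix.smul_apply, Matrix.of_apply, Matrix.cons_val_zero,
      Matrix.cons_val_one, Matrix.cons_val', Matrix.cons_val_fin_one]
    rw [← hx]
    clear_value x
    constructor
    · rintro ⟨h1, h2⟩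
      field_simp at h1 h2
      exact ⟨by linear_combination k1 * h1, by linear_combination h2⟩
    · rintro ⟨h1, h2⟩
      constructor
      · field_simp
        refine mul_left_cancel₀ hk1' ?_
        linear_combination h1
      · field_simp
        linear_combination h2
  constructor
  · intro h
    obtain ⟨v, hv⟩ := h.exists_hasEigenvector
    obtain ⟨e1, e2⟩ := (hT v).mp hv.apply_eq_smul
    have hv0 := hv.2
    -- Cramer's rule: both components of `v` are annihilated by the determinant.
    have hdet : (-k1 ^ 2 - k1 * k2 * a) * (x ^ 2 - k2 ^ 2 - k1 * k2 * a) +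
        (k1 * x) * (k1 * x) = 0 := by
      by_contra hne
      apply hv0
      funext i
      have h0 : ((-k1 ^ 2 - k1 * k2 * a) * (x ^ 2 - k2 ^ 2 - k1 * k2 * a) +
        (k1 * x) * (k1 * x)) * v 0 = 0 := by
        linear_combination (x ^ 2 - k2 ^ 2 - k1 * k2 * a) * e1 + k1 * x * e2
      have h1 : ((-k1 ^ 2 - k1 * k2 * a) * (x ^ 2 - k2 ^ 2 - k1 * k2 * a) +
        (k1 * x) * (k1 * x)) * v 1 = 0 := by
        linear_combination (-k1 ^ 2 - k1 * k2 * a) * e2 - k1 * x * e1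
      fin_cases i
      · exact (mul_eq_zero.mp h0).resolve_left hne
      · exact (mul_eq_zero.mp h1).resolve_left hne
    have h3 : k1 * k2 * (a * x ^ 2) = k1 * k2 * ((k1 + k2 * a) * (k1 * a + k2)) := by
      linear_combination -hdet
    have h4 := mul_left_cancel₀ (mul_pos hk1 hk2).ne' h3
    refine ⟨?_, h4⟩
    rintro rfl
    have : k1 * k2 = 0 := by linear_combination -h4
    exact (mul_pos hk1 hk2).ne' this
  · rintro ⟨ha0, h⟩
    have hp : k1 * a + k2 ≠ 0 := by
      have := abs_le.mp ha
      nlinarith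
    -- This is `a v₁`. Its first entry is nonzero because `|a| ≤ 1` and `k1 < k2`.
    refine Module.End.hasEigenvalue_of_hasEigenvector (x := ![k1 * a + k2, -x * a]) ⟨?_, ?_⟩
    · rw [Module.End.mem_eigenspace_iff, hT]
      simp only [Matrix.cons_val_zero, Matrix.cons_val_one]
      constructor
      · linear_combination k1 * h
      · linear_combination (-x) * h
    · intro h0
      exact hp (by simpa using congrFun h0 0)

/-! ### Counting the frequencies outside the bands. -/

/-- The sum of `f` over the masses `1, …, 2 (N + 1)` of a chain of `N + 1` cells. -/
def chainSum (N : ℕ) (f : ℕ → ℝ) : ℝ := ∑ j ∈ Finset.range (2 * (N + 1)), f (j + 1)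

theorem chainSum_eq_cells (N : ℕ) (f : ℕ → ℝ) :
    chainSum N f = ∑ m ∈ Finset.range (N + 1), (f (2 * m + 1) + f (2 * m + 2)) := by
  unfold chainSum
  generalize N + 1 = M
  induction M with
  | zero => simp
  | succ M ih =>
    rw [show 2 * (M + 1) = 2 * M + 1 + 1 by ring, Finset.sum_range_succ, Finset.sum_range_succ,
      Finset.sum_range_succ, ih]
    ring_nf

theorem chainSum_eq_outer (N : ℕ) (f : ℕ → ℝ) :
    chainSum N f = f 1 + f (2 * N + 2) +
      ∑ m ∈ Finset.range N, (f (2 * m + 2) + f (2 * m + 3)) := by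
  rw [chainSum_eq_cells, Finset.sum_add_distrib, Finset.sum_range_succ', Finset.sum_range_succ,
    Finset.sum_add_distrib]
  simp only [mul_zero, zero_add, mul_add, mul_one, add_assoc]
  norm_num
  ring

/-- The pairs `2 m + 1`, `2 m + 4` are the neighbours, across springs `k1`, of the two masses `2 m +
2`, `2 m + 3` that are paired in `chainSum_eq_outer`. The squared operator mixes these two
groupings. -/
theorem chainSum_eq_inner (N : ℕ) (f : ℕ → ℝ) :
    chainSum N f = f 2 + f (2 * N + 1) +
      ∑ m ∈ Finset.range N, (f (2 * m + 1) + f (2 * m + 4)) := by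
  rw [chainSum_eq_cells, Finset.sum_add_distrib, Finset.sum_range_succ, Finset.sum_range_succ',
    Finset.sum_add_distrib]
  simp only [mul_zero, zero_add, mul_add, mul_one, add_assoc]
  norm_num
  ring

theorem chainSum_sq_pos {N : ℕ} {u : ℕ → ℝ} (h1 : u 1 ≠ 0) : 0 < chainSum N (fun j => u j ^ 2) := by
  refine Finset.sum_pos' (fun j _ => sq_nonneg _) ⟨0, by simp, ?_⟩
  simpa using pow_pos (abs_pos.mpr h1) 2

/-- Eigenstates with different squared frequencies are orthogonal. -/
theorem IsEigenstate.orthogonal {k1 k2 A B ω ω' : ℝ} {N : ℕ} {u v : ℕ → ℝ}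
    (hu : IsEigenstate k1 k2 A B (N + 1) ω u) (hv : IsEigenstate k1 k2 A B (N + 1) ω' v)
    (hω : ω ^ 2 ≠ ω' ^ 2) : chainSum N (fun j => u j * v j) = 0 := by
  obtain ⟨-, hsu, hu⟩ := hu
  obtain ⟨-, hsv, hv⟩ := hv
  set s := stiffness k1 k2 A B (N + 1)
  -- The discrete Wronskian weighted by the stiffness: its increments are `(ω' ^ 2 - ω ^ 2) u v`,
  -- and it vanishes at both walls.
  set W : ℕ → ℝ := fun j => s j * (u (j + 1) * v j - v (j + 1) * u j)
  have key : (ω' ^ 2 - ω ^ 2) * chainSum N (fun j => u j * v j) = W (2 * (N + 1)) - W 0 := by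
    rw [chainSum, Finset.mul_sum, ← Finset.sum_range_sub]
    refine Finset.sum_congr rfl fun j hj => ?_
    have e1 := hu j (Finset.mem_range.mp hj)
    have e2 := hv j (Finset.mem_range.mp hj)
    simp only [W]
    linear_combination v (j + 1) * e1 - u (j + 1) * e2
  have hW : W (2 * (N + 1)) - W 0 = 0 := by
    simp only [W, hsu 0 (Or.inl rfl), hsv 0 (Or.inl rfl),
      hsu (2 * (N + 1) + 1) (Or.inr (by omega)), hsv (2 * (N + 1) + 1) (Or.inr (by omega))]
    ring
  rw [hW] at key
  exact (mul_eq_zero.mp key).resolve_left (sub_ne_zero.mpr hω.symm)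

/-- `y` is the image of `w` under the operator of which `CellEquations` is the eigenvalue equation. -/
structure IsImage (κ α β : ℝ) (N : ℕ) (w y : ℕ → ℝ) : Prop where
  left : y 1 = α * w 1 - κ * w 2
  even : ∀ m < N, y (2 * m + 2) = -(κ * w (2 * m + 1)) - w (2 * m + 3)
  odd : ∀ m < N, y (2 * m + 3) = -w (2 * m + 2) - κ * w (2 * m + 4)
  right : y (2 * N + 2) = β * w (2 * N + 2) - κ * w (2 * N + 1)

theorem CellEquations.isImage_sum {ι : Type*} (s : Finset ι) {κ α β : ℝ} {N : ℕ} {x : ι → ℝ}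
    {u : ι → ℕ → ℝ} (h : ∀ i, CellEquations κ α β N (x i) (u i)) (c : ι → ℝ) :
    IsImage κ α β N (fun j => ∑ i ∈ s, c i * u i j) (fun j => ∑ i ∈ s, c i * x i * u i j) := by
  refine ⟨?_, fun m hm => ?_, fun m hm => ?_, ?_⟩ <;>
    simp only [Finset.mul_sum, ← Finset.sum_sub_distrib, ← Finset.sum_neg_distrib] <;>
    refine Finset.sum_congr rfl fun i _ => ?_
  · linear_combination c i * (h i).left
  · linear_combination c i * (h i).even m hm
  · linear_combination c i * (h i).odd m hm
  · linear_combination c i * (h i).right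

/-- Completing squares: the cross terms of the squared image are absorbed into squares with sign
`e`, leaving `(1 + e κ) ^ 2` times the squared length of `w`. Only the terms with `α ^ 2 - 1` and `β
^ 2 - 1` remember the ends. For `e = 1` this bounds the operator from above, for `e = -1` from
below. -/
theorem IsImage.chainSum_sq {κ α β : ℝ} {N : ℕ} {w y : ℕ → ℝ} (h : IsImage κ α β N w y) (e : ℝ)
    (he : e ^ 2 = 1) :
    chainSum N (fun j => y j ^ 2) + e * κ * ((α * w 1 + e * w 2) ^ 2 +
        (β * w (2 * N + 2) + e * w (2 * N + 1)) ^ 2 + ∑ m ∈ Finset.range N,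
          ((w (2 * m + 3) - e * w (2 * m + 1)) ^ 2 + (w (2 * m + 2) - e * w (2 * m + 4)) ^ 2)) =
      (1 + e * κ) * (chainSum N (fun j => w j ^ 2) + (α ^ 2 - 1) * w 1 ^ 2 +
        (β ^ 2 - 1) * w (2 * N + 2) ^ 2) + (1 + e * κ) * e * κ * chainSum N (fun j => w j ^ 2) := by
  have h1 : chainSum N (fun j => y j ^ 2) = (α * w 1 - κ * w 2) ^ 2 +
      (β * w (2 * N + 2) - κ * w (2 * N + 1)) ^ 2 + ∑ m ∈ Finset.range N,
        ((-(κ * w (2 * m + 1)) - w (2 * m + 3)) ^ 2 + (-w (2 * m + 2) - κ * w (2 * m + 4)) ^ 2) := by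
    rw [chainSum_eq_outer, h.left, h.right]
    congr 1
    refine Finset.sum_congr rfl fun m hm => ?_
    rw [h.even m (Finset.mem_range.mp hm), h.odd m (Finset.mem_range.mp hm)]
  have h2 : ∑ m ∈ Finset.range N,
        ((-(κ * w (2 * m + 1)) - w (2 * m + 3)) ^ 2 + (-w (2 * m + 2) - κ * w (2 * m + 4)) ^ 2) +
      e * κ * ∑ m ∈ Finset.range N,
          ((w (2 * m + 3) - e * w (2 * m + 1)) ^ 2 + (w (2 * m + 2) - e * w (2 * m + 4)) ^ 2) =
      (1 + e * κ) * ∑ m ∈ Finset.range N, (w (2 * m + 2) ^ 2 + w (2 * m + 3) ^ 2) +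
      (1 + e * κ) * e * κ * ∑ m ∈ Finset.range N, (w (2 * m + 1) ^ 2 + w (2 * m + 4) ^ 2) := by
    simp only [Finset.mul_sum, ← Finset.sum_add_distrib]
    refine Finset.sum_congr rfl fun m _ => ?_
    linear_combination (w (2 * m + 1) ^ 2 + w (2 * m + 4) ^ 2) * ((e * κ) - κ ^ 2) * he -
      2 * κ * (w (2 * m + 1) * w (2 * m + 3) + w (2 * m + 2) * w (2 * m + 4)) * he
  have h3 := chainSum_eq_outer N (fun j => w j ^ 2)
  have h4 := chainSum_eq_inner N (fun j => w j ^ 2)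
  rw [h1]
  linear_combination h2 - (1 + e * κ) * h3 - (1 + e * κ) * e * κ * h4 +
    (w 2 ^ 2 + w (2 * N + 1) ^ 2) * ((e * κ) - κ ^ 2) * he +
      2 * κ * (α * w 1 * w 2 + β * w (2 * N + 2) * w (2 * N + 1)) * he

/-- If the boundary terms have the favourable sign, a vector that violates the bound of
`IsImage.chainSum_sq`, or only attains it, makes all the squares vanish. It is then `e`-periodic
from cell to cell, and a zero at either end propagates through the chain. The hypothesis `hw`
supplies this zero. -/
theorem IsImage.eq_zero_of_chainSum_le {κ α β : ℝ} {N : ℕ} {w y : ℕ → ℝ} (h : IsImage κ α β N w y)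
    {e : ℝ} (he : e ^ 2 = 1) (hκ : 0 < κ) (heκ : 0 < 1 + e * κ)
    (hle : e * ((1 + e * κ) ^ 2 * chainSum N (fun j => w j ^ 2)) ≤
      e * chainSum N (fun j => y j ^ 2))
    (hα : e * ((α ^ 2 - 1) * w 1 ^ 2) ≤ 0) (hβ : e * ((β ^ 2 - 1) * w (2 * N + 2) ^ 2) ≤ 0)
    (hw : (α ^ 2 - 1) * w 1 ^ 2 = 0 → (β ^ 2 - 1) * w (2 * N + 2) ^ 2 = 0 →
      w 1 = 0 ∨ w (2 * N + 2) = 0) : ∀ m ≤ N, w (2 * m + 1) = 0 ∧ w (2 * m + 2) = 0 := by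
  have key := h.chainSum_sq e he
  set S := ∑ m ∈ Finset.range N,
    ((w (2 * m + 3) - e * w (2 * m + 1)) ^ 2 + (w (2 * m + 2) - e * w (2 * m + 4)) ^ 2) with hS
  have hS0 : 0 ≤ S := Finset.sum_nonneg fun m _ => add_nonneg (sq_nonneg _) (sq_nonneg _)
  have he0 : e ≠ 0 := by rintro rfl; norm_num at he
  have hle1 : κ * ((α * w 1 + e * w 2) ^ 2 + (β * w (2 * N + 2) + e * w (2 * N + 1)) ^ 2 + S) ≤
      (1 + e * κ) * (e * ((α ^ 2 - 1) * w 1 ^ 2) + e * ((β ^ 2 - 1) * w (2 * N + 2) ^ 2)) := by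
    have : e * chainSum N (fun j => y j ^ 2) + κ * ((α * w 1 + e * w 2) ^ 2 +
        (β * w (2 * N + 2) + e * w (2 * N + 1)) ^ 2 + S) = e * (1 + e * κ) *
        ((1 + e * κ) * chainSum N (fun j => w j ^ 2) +
        (α ^ 2 - 1) * w 1 ^ 2 + (β ^ 2 - 1) * w (2 * N + 2) ^ 2) := by
      linear_combination e * key - κ * ((α * w 1 + e * w 2) ^ 2 +
        (β * w (2 * N + 2) + e * w (2 * N + 1)) ^ 2 + S) * he
    linarith
  have hsq0 : 0 ≤ κ * ((α * w 1 + e * w 2) ^ 2 + (β * w (2 * N + 2) + e * w (2 * N + 1)) ^ 2 + S) := by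
    positivity
  have hsum := nonneg_of_mul_nonneg_right (hsq0.trans hle1) heκ
  replace hw := hw
    ((mul_eq_zero.mp (show e * ((α ^ 2 - 1) * w 1 ^ 2) = 0 by linarith)).resolve_left he0)
    ((mul_eq_zero.mp (show e * ((β ^ 2 - 1) * w (2 * N + 2) ^ 2) = 0 by linarith)).resolve_left he0)
  have hle2 : κ * ((α * w 1 + e * w 2) ^ 2 + (β * w (2 * N + 2) + e * w (2 * N + 1)) ^ 2 + S) ≤ 0 := by
    exact hle1.trans (mul_nonpos_of_nonneg_of_nonpos heκ.le (by linarith))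
  have hle3 : (α * w 1 + e * w 2) ^ 2 + (β * w (2 * N + 2) + e * w (2 * N + 1)) ^ 2 + S ≤ 0 :=
    nonpos_of_mul_nonpos_right hle2 hκ
  have z1 : α * w 1 + e * w 2 = 0 := by
    have := sq_nonneg (β * w (2 * N + 2) + e * w (2 * N + 1))
    exact pow_eq_zero_iff two_ne_zero |>.mp (le_antisymm (by linarith) (sq_nonneg _))
  have z2 : β * w (2 * N + 2) + e * w (2 * N + 1) = 0 := by
    have := sq_nonneg (α * w 1 + e * w 2)
    exact pow_eq_zero_iff two_ne_zero |>.mp (le_antisymm (by linarith) (sq_nonneg _))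
  have z3 : S = 0 := by
    have := sq_nonneg (α * w 1 + e * w 2)
    have := sq_nonneg (β * w (2 * N + 2) + e * w (2 * N + 1))
    linarith
  rw [hS, Finset.sum_eq_zero_iff_of_nonneg
    (fun m _ => add_nonneg (sq_nonneg _) (sq_nonneg _))] at z3
  have z4 : ∀ m < N, w (2 * m + 3) = e * w (2 * m + 1) ∧ w (2 * m + 4) = e * w (2 * m + 2) := by
    intro m hm
    have := z3 m (Finset.mem_range.mpr hm)
    rw [add_eq_zero_iff_of_nonneg (sq_nonneg _) (sq_nonneg _)] at this
    have a1 := pow_eq_zero_iff two_ne_zero |>.mp this.1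
    have a2 := pow_eq_zero_iff two_ne_zero |>.mp this.2
    exact ⟨by linarith, by linear_combination -e * a2 - w (2 * m + 4) * he⟩
  have z5 : ∀ m ≤ N, w (2 * m + 1) = e ^ m * w 1 ∧ w (2 * m + 2) = e ^ m * w 2 := by
    intro m
    induction m with
    | zero => simp
    | succ m ih =>
      intro hm
      obtain ⟨i1, i2⟩ := ih (by omega)
      obtain ⟨j1, j2⟩ := z4 m (by omega)
      refine ⟨?_, ?_⟩
      · rw [show 2 * (m + 1) + 1 = 2 * m + 3 by ring, j1, i1]; ring
      · rw [show 2 * (m + 1) + 2 = 2 * m + 4 by ring, j2, i2]; ring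
  obtain ⟨l1, l2⟩ := z5 N le_rfl
  have heN : e ^ N ≠ 0 := pow_ne_zero _ he0
  have hw1 : w 1 = 0 := by
    rcases hw with hw | hw
    · exact hw
    · rw [hw, mul_zero, zero_add, l1] at z2
      simpa [he0] using z2
  have hw2 : w 2 = 0 := by
    rw [hw1, mul_zero, zero_add] at z1
    exact (mul_eq_zero.mp z1).resolve_left he0
  intro m hm
  obtain ⟨i1, i2⟩ := z5 m hm
  rw [i1, i2, hw1, hw2]
  simp

theorem chainSum_sq_sum {ι : Type*} [DecidableEq ι] (s : Finset ι) {N : ℕ} {u : ι → ℕ → ℝ}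
    (h : ∀ i j, i ≠ j → chainSum N (fun k => u i k * u j k) = 0) (c : ι → ℝ) :
    chainSum N (fun k => (∑ i ∈ s, c i * u i k) ^ 2) =
      ∑ i ∈ s, c i ^ 2 * chainSum N (fun k => u i k ^ 2) := by
  have : chainSum N (fun k => (∑ i ∈ s, c i * u i k) ^ 2) =
      ∑ i ∈ s, ∑ j ∈ s, c i * c j * chainSum N (fun k => u i k * u j k) := by
    simp only [chainSum, Finset.mul_sum]
    have : ∀ i ∈ s, ∑ j ∈ s, ∑ k ∈ Finset.range (2 * (N + 1)),
        c i * c j * (u i (k + 1) * u j (k + 1)) = ∑ k ∈ Finset.range (2 * (N + 1)), ∑ j ∈ s,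
        c i * c j * (u i (k + 1) * u j (k + 1)) := fun i _ => Finset.sum_comm
    rw [Finset.sum_congr rfl this, Finset.sum_comm]
    refine Finset.sum_congr rfl fun k _ => ?_
    rw [sq, Finset.sum_mul_sum]
    refine Finset.sum_congr rfl fun i _ => Finset.sum_congr rfl fun j _ => ?_
    ring
  rw [this]
  refine Finset.sum_congr rfl fun i hi => ?_
  rw [Finset.sum_eq_single_of_mem i hi]
  · simp only [← sq]
  · intro j _ hj
    rw [h i j hj.symm, mul_zero]

theorem one_sub_mul_sq_nonneg {α w : ℝ} (h : |α| ≤ 1 ∨ w = 0) : (α ^ 2 - 1) * w ^ 2 ≤ 0 := by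
  rcases h with h | rfl
  · have := (sq_le_one_iff_abs_le_one α).mpr h
    exact mul_nonpos_of_nonpos_of_nonneg (by linarith) (sq_nonneg _)
  · simp

theorem mul_sq_nonneg_of_one_le {α w : ℝ} (h : 1 ≤ |α| ∨ w = 0) : 0 ≤ (α ^ 2 - 1) * w ^ 2 := by
  rcases h with h | rfl
  · have := (one_le_sq_iff_one_le_abs α).mpr h
    exact mul_nonneg (by linarith) (sq_nonneg _)
  · simp

/-- At most two eigenfrequencies of a chain lie outside of the interior of the bands. -/
theorem not_three_outside_bands {κ α β : ℝ} (hκ : 0 < κ) (hκ1 : κ < 1) {N : ℕ} {x : Fin 3 → ℝ}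
    {u : Fin 3 → ℕ → ℝ} (hu : ∀ i, CellEquations κ α β N (x i) (u i)) (h1 : ∀ i, u i 1 ≠ 0)
    (hort : ∀ i j, i ≠ j → chainSum N (fun k => u i k * u j k) = 0)
    (hx : ∀ i, x i ^ 2 ≤ (1 - κ) ^ 2 ∨ (1 + κ) ^ 2 ≤ x i ^ 2) : False := by
  classical
  set O : Finset (Fin 3) := {i | (1 + κ) ^ 2 ≤ x i ^ 2} with hO
  -- Each end imposes one condition, on the combination for which its boundary term has the wrong
  -- sign: on the outer one if `|α| ≥ 1`, on the gap one otherwise. The comparison is strict for `β`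
  -- but not for `α`. So the outer combination always vanishes at the left end when its boundary
  -- term does, and the gap combination likewise at the right end.
  set M : Matrix (Fin 2) (Fin 3) ℝ := ![
    fun i => if (i ∈ O ↔ 1 ≤ |α|) then u i 1 else 0,
    fun i => if (i ∈ O ↔ 1 < |β|) then u i (2 * N + 2) else 0] with hM
  obtain ⟨c, hc, hc0⟩ : ∃ c ∈ LinearMap.ker M.mulVecLin, c ≠ 0 :=
    (Submodule.ne_bot_iff _).mp (LinearMap.ker_ne_bot_of_finrank_lt (by simp))
  rw [LinearMap.mem_ker, Matrix.mulVecLin_apply] at hc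
  have hc1 : ∑ i, (if (i ∈ O ↔ 1 ≤ |α|) then c i * u i 1 else 0) = 0 := by
    have := congrFun hc 0
    simp only [hM, Matrix.mulVec, dotProduct, Matrix.cons_val_zero, Pi.zero_apply, ite_mul,
      zero_mul] at this
    simpa only [mul_comm] using this
  have hc2 : ∑ i, (if (i ∈ O ↔ 1 < |β|) then c i * u i (2 * N + 2) else 0) = 0 := by
    have := congrFun hc 1
    simp only [hM, Matrix.mulVec, dotProduct, Matrix.cons_val_one, Matrix.cons_val_zero,
      Pi.zero_apply, ite_mul, zero_mul] at this
    simpa only [mul_comm] using this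
  have himg := fun s : Finset (Fin 3) => CellEquations.isImage_sum s hu c
  -- Orthogonality makes the squared length of a combination a positive diagonal form in the
  -- coefficients.
  have hsum0 : ∀ s : Finset (Fin 3), (∀ m ≤ N, (∑ i ∈ s, c i * u i (2 * m + 1)) = 0 ∧
      (∑ i ∈ s, c i * u i (2 * m + 2)) = 0) → ∀ i ∈ s, c i = 0 := by
    intro s hs
    have e := chainSum_sq_sum s hort c
    rw [chainSum_eq_cells, Finset.sum_eq_zero, eq_comm, Finset.sum_eq_zero_iff_of_nonneg] at e
    · intro i hi
      have := (mul_eq_zero.mp (e i hi)).resolve_right (chainSum_sq_pos (h1 i)).ne'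
      exact pow_eq_zero_iff two_ne_zero |>.mp this
    · exact fun i _ => mul_nonneg (sq_nonneg _) (chainSum_sq_pos (h1 i)).le
    · intro m hm
      obtain ⟨a1, a2⟩ := hs m (by have := Finset.mem_range.mp hm; omega)
      simp only [a1, a2]
      norm_num
  have hyO : (1 + κ) ^ 2 * chainSum N (fun k => (∑ i ∈ O, c i * u i k) ^ 2) ≤
      chainSum N (fun k => (∑ i ∈ O, c i * x i * u i k) ^ 2) := by
    rw [chainSum_sq_sum O hort c, chainSum_sq_sum O hort (fun i => c i * x i), Finset.mul_sum]
    refine Finset.sum_le_sum fun i hi => ?_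
    have a1 : (1 + κ) ^ 2 ≤ x i ^ 2 := by simpa [hO] using hi
    have a2 := (chainSum_sq_pos (N := N) (h1 i)).le
    calc (1 + κ) ^ 2 * (c i ^ 2 * chainSum N fun k => u i k ^ 2)
        ≤ x i ^ 2 * (c i ^ 2 * chainSum N fun k => u i k ^ 2) := by gcongr
      _ = _ := by ring
  have hyG : chainSum N (fun k => (∑ i ∈ Oᶜ, c i * x i * u i k) ^ 2) ≤
      (1 - κ) ^ 2 * chainSum N (fun k => (∑ i ∈ Oᶜ, c i * u i k) ^ 2) := by
    rw [chainSum_sq_sum Oᶜ hort c, chainSum_sq_sum Oᶜ hort (fun i => c i * x i), Finset.mul_sum]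
    refine Finset.sum_le_sum fun i hi => ?_
    have a1 : x i ^ 2 ≤ (1 - κ) ^ 2 := (hx i).resolve_right (by simpa [hO] using hi)
    have a2 := (chainSum_sq_pos (N := N) (h1 i)).le
    calc (c i * x i) ^ 2 * (chainSum N fun k => u i k ^ 2)
        = x i ^ 2 * (c i ^ 2 * chainSum N fun k => u i k ^ 2) := by ring
      _ ≤ _ := by gcongr
  have hcO : ∀ i ∈ O, c i = 0 := by
    have hl : |α| < 1 ∨ ∑ i ∈ O, c i * u i 1 = 0 := by
      rcases lt_or_ge |α| 1 with h | h
      · exact Or.inl h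
      · right
        simpa [h, ← Finset.sum_filter] using hc1
    have hr : |β| ≤ 1 ∨ ∑ i ∈ O, c i * u i (2 * N + 2) = 0 := by
      rcases le_or_gt |β| 1 with h | h
      · exact Or.inl h
      · right
        simpa [h, ← Finset.sum_filter] using hc2
    have i1 := one_sub_mul_sq_nonneg (hl.imp_left le_of_lt)
    have i2 := one_sub_mul_sq_nonneg hr
    refine hsum0 O ((himg O).eq_zero_of_chainSum_le (e := 1) (by norm_num) hκ (by linarith)
      (by simpa using hyO) (by simpa using i1) (by simpa using i2) fun z1 _ => Or.inl ?_)
    rcases hl with h | h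
    · have := (sq_lt_one_iff_abs_lt_one α).mpr h
      exact pow_eq_zero_iff two_ne_zero |>.mp ((mul_eq_zero.mp z1).resolve_left (by linarith))
    · exact h
  have hcG : ∀ i ∈ Oᶜ, c i = 0 := by
    have hl : 1 ≤ |α| ∨ ∑ i ∈ Oᶜ, c i * u i 1 = 0 := by
      rcases le_or_gt 1 |α| with h | h
      · exact Or.inl h
      · right
        simpa [not_le.mpr h, ← Finset.sum_filter, Finset.compl_filter, hO] using hc1
    have hr : 1 < |β| ∨ ∑ i ∈ Oᶜ, c i * u i (2 * N + 2) = 0 := by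
      rcases lt_or_ge 1 |β| with h | h
      · exact Or.inl h
      · right
        simpa [not_lt.mpr h, ← Finset.sum_filter, Finset.compl_filter, hO] using hc2
    have i1 := mul_sq_nonneg_of_one_le hl
    have i2 := mul_sq_nonneg_of_one_le (hr.imp_left le_of_lt)
    refine hsum0 Oᶜ ((himg Oᶜ).eq_zero_of_chainSum_le (e := -1) (by norm_num) hκ (by linarith)
      (by rw [show 1 + -1 * κ = 1 - κ by ring]; linarith) (by linarith) (by linarith)
      fun _ z2 => Or.inr ?_)
    rcases hr with h | h
    · have := (one_lt_sq_iff_one_lt_abs β).mpr h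
      exact pow_eq_zero_iff two_ne_zero |>.mp ((mul_eq_zero.mp z2).resolve_left (by linarith))
    · exact h
  refine hc0 (funext fun i => ?_)
  by_cases hi : i ∈ O
  · exact hcO i hi
  · exact hcG i (Finset.mem_compl.mpr hi)

/-- At most two eigenfrequencies belong to states with a real decay factor. -/
theorem not_three_decayFactors {k1 k2 A B : ℝ} (hk1 : 0 < k1) (hk : k1 < k2) {N : ℕ}
    {ω a : Fin 3 → ℝ} {u : Fin 3 → ℕ → ℝ}
    (hu : ∀ i, IsEigenstate k1 k2 A B (N + 1) (ω i) (u i))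
    (ha : ∀ i, IsDecayFactor k1 k2 (ω i) (a i))
    (hω : ∀ i j, i ≠ j → ω i ^ 2 ≠ ω j ^ 2) : False := by
  have hk2 := hk1.trans hk
  have hκ : 0 < k1 / k2 := div_pos hk1 hk2
  refine not_three_outside_bands hκ ((div_lt_one hk2).mpr hk)
    (fun i => ((isEigenstate_succ_iff hk2).mp (hu i)).2.2)
    (fun i => (hu i).apply_one_ne_zero hk1 hk2)
    (fun i j hij => (hu i).orthogonal (hu j) (hω i j hij)) fun i => ?_
  obtain ⟨h1, h0, h⟩ := (isDecayFactor_iff hk1 hk).mp (ha i)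
  set κ := k1 / k2
  generalize (ω i ^ 2 / k2 - κ - 1) = x at h ⊢
  rcases lt_or_gt_of_ne h0 with h0 | h0
  · left
    refine (mul_le_mul_left_of_neg h0).mp ?_
    nlinarith [mul_nonneg hκ.le (sq_nonneg (a i + 1))]
  · right
    refine le_of_mul_le_mul_left (a := a i) ?_ h0
    nlinarith [mul_nonneg hκ.le (sq_nonneg (a i - 1))]

/-- The decay factor is determined by the frequency. -/
theorem IsDecayFactor.eq_of_sq_eq {k1 k2 ω ω' a a' : ℝ} (hk1 : 0 < k1) (hk : k1 < k2)
    (h : IsDecayFactor k1 k2 ω a) (h' : IsDecayFactor k1 k2 ω' a') (hω : ω ^ 2 = ω' ^ 2) :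
    a = a' := by
  obtain ⟨h1, h0, h⟩ := (isDecayFactor_iff hk1 hk).mp h
  obtain ⟨h1', h0', h'⟩ := (isDecayFactor_iff hk1 hk).mp h'
  have hκ : k1 / k2 ≠ 0 := (div_pos hk1 (hk1.trans hk)).ne'
  rw [← hω] at h'
  -- Equal traces give `a' = a` or `a' = 1 / a`; the latter is reconciled with the former by `|a|,
  -- |a'| ≤ 1`.
  have key : k1 / k2 * ((a - a') * (a * a' - 1)) = 0 := by
    linear_combination a * h' - a' * h
  rcases mul_eq_zero.mp ((mul_eq_zero.mp key).resolve_left hκ) with h | h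
  · linarith
  · obtain ⟨l1, l2⟩ := abs_le.mp h1
    obtain ⟨l1', l2'⟩ := abs_le.mp h1'
    rcases lt_or_gt_of_ne h0 with h0 | h0
    · have h0' : a' < 0 := by nlinarith
      nlinarith
    · have h0' : 0 < a' := by nlinarith
      nlinarith

/-! ### Energy, and states built from their profile. -/

/-- Summation by parts turns the eigenvalue equation tested with `u` into the potential energy of
the springs. As `x + κ + 1 = ω ^ 2 / k2`, its positivity makes `ω` real for every algebraic
solution. -/
theorem CellEquations.energy {κ α β x : ℝ} {N : ℕ} {u : ℕ → ℝ} (h : CellEquations κ α β N x u) :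
    (x + κ + 1) * chainSum N (fun j => u j ^ 2) =
      (1 + α) * u 1 ^ 2 + (1 + β) * u (2 * N + 2) ^ 2 +
        ∑ m ∈ Finset.range N, (u (2 * m + 2) - u (2 * m + 3)) ^ 2 +
        κ * ∑ m ∈ Finset.range (N + 1), (u (2 * m + 1) - u (2 * m + 2)) ^ 2 := by
  have h1 : x * chainSum N (fun j => u j ^ 2) = α * u 1 ^ 2 + β * u (2 * N + 2) ^ 2 -
      2 * ∑ m ∈ Finset.range N, u (2 * m + 2) * u (2 * m + 3) -
      2 * κ * ∑ m ∈ Finset.range (N + 1), u (2 * m + 1) * u (2 * m + 2) := by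
    have e1 := Finset.sum_range_succ (fun m => u (2 * m + 1) * u (2 * m + 2)) N
    have e2 := Finset.sum_range_succ' (fun m => u (2 * m + 1) * u (2 * m + 2)) N
    have e3 : ∑ m ∈ Finset.range N, x * (u (2 * m + 2) ^ 2 + u (2 * m + 3) ^ 2) =
        -(2 * ∑ m ∈ Finset.range N, u (2 * m + 2) * u (2 * m + 3)) -
        κ * ∑ m ∈ Finset.range N, u (2 * m + 1) * u (2 * m + 2) -
        κ * ∑ m ∈ Finset.range N, u (2 * (m + 1) + 1) * u (2 * (m + 1) + 2) := by
      simp only [Finset.mul_sum, ← Finset.sum_sub_distrib, ← Finset.sum_neg_distrib]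
      refine Finset.sum_congr rfl fun m hm => ?_
      have hm := Finset.mem_range.mp hm
      rw [show 2 * (m + 1) + 1 = 2 * m + 3 by ring, show 2 * (m + 1) + 2 = 2 * m + 4 by ring]
      linear_combination u (2 * m + 2) * h.even m hm + u (2 * m + 3) * h.odd m hm
    rw [chainSum_eq_outer, mul_add, Finset.mul_sum, e3]
    linear_combination u 1 * h.left + u (2 * N + 2) * h.right + κ * e1 + κ * e2
  have h2 := chainSum_eq_outer N (fun j => u j ^ 2)
  have h3 := chainSum_eq_cells N (fun j => u j ^ 2)
  have h4 : ∑ m ∈ Finset.range N, (u (2 * m + 2) - u (2 * m + 3)) ^ 2 =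
      ∑ m ∈ Finset.range N, (u (2 * m + 2) ^ 2 + u (2 * m + 3) ^ 2) -
        2 * ∑ m ∈ Finset.range N, u (2 * m + 2) * u (2 * m + 3) := by
    rw [Finset.mul_sum, ← Finset.sum_sub_distrib]
    exact Finset.sum_congr rfl fun m _ => by ring
  have h5 : ∑ m ∈ Finset.range (N + 1), (u (2 * m + 1) - u (2 * m + 2)) ^ 2 =
      ∑ m ∈ Finset.range (N + 1), (u (2 * m + 1) ^ 2 + u (2 * m + 2) ^ 2) -
        2 * ∑ m ∈ Finset.range (N + 1), u (2 * m + 1) * u (2 * m + 2) := by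
    rw [Finset.mul_sum, ← Finset.sum_sub_distrib]
    exact Finset.sum_congr rfl fun m _ => by ring
  rw [h4, h5]
  linear_combination h1 + κ * h3 + h2

theorem CellEquations.energy_nonneg {κ α β x : ℝ} {N : ℕ} {u : ℕ → ℝ}
    (h : CellEquations κ α β N x u) (hκ : 0 ≤ κ) (hα : -1 ≤ α) (hβ : -1 ≤ β) (hu : u 1 ≠ 0) :
    0 ≤ x + κ + 1 := by
  refine nonneg_of_mul_nonneg_left (b := chainSum N (fun j => u j ^ 2)) ?_ (chainSum_sq_pos hu)
  rw [h.energy]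
  have h1 : 0 ≤ (1 + α) * u 1 ^ 2 := mul_nonneg (by linarith) (sq_nonneg _)
  have h2 : 0 ≤ (1 + β) * u (2 * N + 2) ^ 2 := mul_nonneg (by linarith) (sq_nonneg _)
  have h3 : 0 ≤ ∑ m ∈ Finset.range N, (u (2 * m + 2) - u (2 * m + 3)) ^ 2 :=
    Finset.sum_nonneg fun _ _ => sq_nonneg _
  have h4 : 0 ≤ ∑ m ∈ Finset.range (N + 1), (u (2 * m + 1) - u (2 * m + 2)) ^ 2 :=
    Finset.sum_nonneg fun _ _ => sq_nonneg _
  positivity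

/-- The chain state with the cells `c₁ a ^ m (p, -x) + c₂ a ^ (-m) (-x, p)`. -/
noncomputable def profileState (N : ℕ) (p x a c₁ c₂ : ℝ) (j : ℕ) : ℝ :=
  if j = 0 ∨ 2 * (N + 1) < j then 0
  else if Odd j then c₁ * a ^ ((j - 1) / 2) * p - c₂ * (a ^ ((j - 1) / 2))⁻¹ * x
  else -(c₁ * a ^ ((j - 1) / 2) * x) + c₂ * (a ^ ((j - 1) / 2))⁻¹ * p

theorem profileState_odd {N m : ℕ} (hm : m ≤ N) (p x a c₁ c₂ : ℝ) :
    profileState N p x a c₁ c₂ (2 * m + 1) = c₁ * a ^ m * p - c₂ * (a ^ m)⁻¹ * x := by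
  have h1 : ¬ (2 * m + 1 = 0 ∨ 2 * (N + 1) < 2 * m + 1) := by omega
  have h2 : Odd (2 * m + 1) := ⟨m, rfl⟩
  have h3 : (2 * m + 1 - 1) / 2 = m := by omega
  simp only [profileState, if_neg h1, if_pos h2, h3]

theorem profileState_even {N m : ℕ} (hm : m ≤ N) (p x a c₁ c₂ : ℝ) :
    profileState N p x a c₁ c₂ (2 * m + 2) = -(c₁ * a ^ m * x) + c₂ * (a ^ m)⁻¹ * p := by
  have h1 : ¬ (2 * m + 2 = 0 ∨ 2 * (N + 1) < 2 * m + 2) := by omega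
  have h2 : ¬ Odd (2 * m + 2) := by rw [Nat.not_odd_iff_even]; exact ⟨m + 1, by ring⟩
  have h3 : (2 * m + 2 - 1) / 2 = m := by omega
  simp only [profileState, if_neg h1, if_neg h2, h3]

/-- The relation `hx` between `a` and `x` takes care of the bulk; `hl` and `hr` are the left and the
right boundary condition on the profile. -/
theorem cellEquations_profileState {κ α β x a c₁ c₂ : ℝ} {N : ℕ} (ha : a ≠ 0)
    (hx : a * x ^ 2 = (κ + a) * (κ * a + 1))
    (hl : c₁ * (x / a - α * (κ + 1 / a)) + c₂ * (α * x - a * (κ + 1 / a)) = 0)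
    (hr : c₁ * a ^ N * (a * (κ + 1 / a) - β * x) +
      c₂ * (a ^ N)⁻¹ * (β * (κ + 1 / a) - x / a) = 0) :
    CellEquations κ α β N x (profileState N (κ + 1 / a) x a c₁ c₂) := by
  have hx' : x ^ 2 = (κ + 1 / a) * (κ + a) := by
    field_simp
    linear_combination hx
  refine ⟨?_, fun m hm => ?_, fun m hm => ?_, ?_⟩
  · have e1 := profileState_odd (Nat.zero_le N) (κ + 1 / a) x a c₁ c₂
    have e2 := profileState_even (Nat.zero_le N) (κ + 1 / a) x a c₁ c₂
    simp only [mul_zero, zero_add, pow_zero, inv_one, mul_one] at e1 e2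
    rw [e1, e2]
    linear_combination hl - c₂ * hx'
  · have e1 := profileState_odd hm.le (κ + 1 / a) x a c₁ c₂
    have e2 := profileState_even hm.le (κ + 1 / a) x a c₁ c₂
    have e3 := profileState_odd (Nat.succ_le_of_lt hm) (κ + 1 / a) x a c₁ c₂
    rw [show 2 * m.succ + 1 = 2 * m + 3 by simp; ring] at e3
    rw [e1, e2, e3, pow_succ, mul_inv]
    have := mul_inv_cancel₀ ha
    rw [one_div] at *
    linear_combination (-(c₁ * a ^ m)) * hx'
  · have e2 := profileState_even hm.le (κ + 1 / a) x a c₁ c₂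
    have e3 := profileState_odd (Nat.succ_le_of_lt hm) (κ + 1 / a) x a c₁ c₂
    have e4 := profileState_even (Nat.succ_le_of_lt hm) (κ + 1 / a) x a c₁ c₂
    rw [show 2 * m.succ + 1 = 2 * m + 3 by simp; ring] at e3
    rw [show 2 * m.succ + 2 = 2 * m + 4 by simp; ring] at e4
    rw [e2, e3, e4, pow_succ, mul_inv]
    have := mul_inv_cancel₀ ha
    rw [one_div] at *
    linear_combination (-(c₂ * (a ^ m)⁻¹ * a⁻¹)) * hx' + c₁ * a ^ m * x * this
      - c₂ * (a ^ m)⁻¹ * (κ + a⁻¹) * this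
  · have e1 := profileState_odd (le_refl N) (κ + 1 / a) x a c₁ c₂
    have e2 := profileState_even (le_refl N) (κ + 1 / a) x a c₁ c₂
    rw [e1, e2]
    linear_combination -hr - c₁ * a ^ N * hx'

/-- A point `(S : T)` of the projective line and a factor `a` that solve the characteristic equation
yield an eigenstate with the frequency `ω ^ 2 / k2 = S (κ a + 1) / T + κ + 1`. -/
theorem exists_isState {k1 k2 A B : ℝ} (hk1 : 0 < k1) (hk : k1 < k2) (hA : 0 ≤ A) (hB : 0 ≤ B)
    {N : ℕ} {S T a : ℝ} (hT : T ≠ 0) (ha0 : a ≠ 0) (ha1 : |a| < 1)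
    (hST : k1 / k2 * S ^ 2 * a ^ 2 + (S ^ 2 - T ^ 2) * a - k1 / k2 * T ^ 2 = 0)
    (heq : (S - (A / k2 - 1) * T) * (S - (B / k2 - 1) * T) =
      a ^ (2 * (N + 1)) * ((T - (A / k2 - 1) * S) * (T - (B / k2 - 1) * S))) :
    ∃ ω u, IsState k1 k2 A B (N + 1) ω u a (a * (T - (A / k2 - 1) * S)) (S - (A / k2 - 1) * T) ∧
      ω ^ 2 / k2 - k1 / k2 - 1 = S * (k1 / k2 * a + 1) / T := by
  have hk2 := hk1.trans hk
  have hκ : 0 < k1 / k2 := div_pos hk1 hk2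
  have hκ1 : k1 / k2 < 1 := (div_lt_one hk2).mpr hk
  have hα : -1 ≤ A / k2 - 1 := by have := div_nonneg hA hk2.le; linarith
  have hβ : -1 ≤ B / k2 - 1 := by have := div_nonneg hB hk2.le; linarith
  have hk1e : k1 = k2 * (k1 / k2) := by field_simp
  set κ := k1 / k2
  set α := A / k2 - 1
  set β := B / k2 - 1
  set X := S * (κ * a + 1) / T with hXdef
  have hκa : 0 < κ * a + 1 := by
    have := (abs_lt.mp ha1).1
    nlinarith
  have hX : a * X ^ 2 = (κ + a) * (κ * a + 1) := by
    rw [hXdef]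
    field_simp
    linear_combination (κ * a + 1) * hST
  have hP : κ + 1 / a = (κ * a + 1) / a := by field_simp
  set c₁ := a * (T - α * S)
  set c₂ := S - α * T
  have hl : c₁ * (X / a - α * (κ + 1 / a)) + c₂ * (α * X - a * (κ + 1 / a)) = 0 := by
    simp only [c₁, c₂]
    rw [hP, hXdef]
    field_simp
    ring
  have hr : c₁ * a ^ N * (a * (κ + 1 / a) - β * X) +
      c₂ * (a ^ N)⁻¹ * (β * (κ + 1 / a) - X / a) = 0 := by
    have h1 : a * (κ + 1 / a) - β * X = (κ * a + 1) / T * (T - β * S) := by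
      rw [hP, hXdef]; field_simp
    have h2 : β * (κ + 1 / a) - X / a = -((κ * a + 1) / (a * T) * (S - β * T)) := by
      rw [hP, hXdef]; field_simp; ring
    have h3 : a ^ N ≠ 0 := pow_ne_zero _ ha0
    rw [h1, h2]
    simp only [c₁, c₂]
    field_simp
    linear_combination (-(κ * a + 1)) * heq
  -- Both coefficients vanish only if `S ^ 2 = T ^ 2`, and then `hST` forces `a ^ 2 = 1`.
  have hc : ¬ (c₁ = 0 ∧ c₂ = 0) := by
    rintro ⟨h1, h2⟩
    have h1' : T = α * S := by
      have := (mul_eq_zero.mp h1).resolve_left ha0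
      linarith
    have h2' : S = α * T := sub_eq_zero.mp h2
    have h3 : T ^ 2 = S ^ 2 := by linear_combination T * h1' - S * h2'
    have h4 : κ * T ^ 2 * (a ^ 2 - 1) = 0 := by
      rw [← h3] at hST
      linear_combination hST
    have h5 : a ^ 2 < 1 := (sq_lt_one_iff_abs_lt_one a).mpr ha1
    exact (mul_ne_zero (mul_ne_zero hκ.ne' (pow_ne_zero 2 hT)) (by linarith)) h4
  -- The vectors `v₁`, `v₂` are `k2` times the rescaled ones, whence the factor `k2`.
  set u := profileState N (κ + 1 / a) X a (k2 * c₁) (k2 * c₂) with hu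
  have hcell : CellEquations κ α β N X u := cellEquations_profileState ha0 hX
    (by linear_combination k2 * hl) (by linear_combination k2 * hr)
  have hu1 : u 1 ≠ 0 := by
    intro h0
    obtain ⟨e1, e2⟩ := hcell.eq_zero_of_left hκ h0 0 (Nat.zero_le N)
    rw [hu, profileState_odd (Nat.zero_le N)] at e1
    rw [hu, profileState_even (Nat.zero_le N)] at e2
    simp only [pow_zero, inv_one, mul_one] at e1 e2
    -- For `|a| < 1` the rescaled `v₁` and `v₂` are linearly independent, so a vanishing first cell
    -- would give `c₁ = c₂ = 0`.
    have hdet : k2 * ((κ + 1 / a) ^ 2 - X ^ 2) ≠ 0 := by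
      have hX' : X ^ 2 = (κ + 1 / a) * (κ + a) := by
        field_simp
        linear_combination hX
      have : (κ + 1 / a) ^ 2 - X ^ 2 = (κ * a + 1) / a ^ 2 * (1 - a ^ 2) := by
        rw [hX']; field_simp; ring
      rw [this]
      have h5 : a ^ 2 < 1 := (sq_lt_one_iff_abs_lt_one a).mpr ha1
      exact mul_ne_zero hk2.ne' (mul_ne_zero (div_ne_zero hκa.ne' (pow_ne_zero 2 ha0)) (by linarith))
    refine hc ⟨?_, ?_⟩
    · refine (mul_eq_zero.mp (?_ : k2 * ((κ + 1 / a) ^ 2 - X ^ 2) * c₁ = 0)).resolve_left hdet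
      linear_combination (κ + 1 / a) * e1 + X * e2
    · refine (mul_eq_zero.mp (?_ : k2 * ((κ + 1 / a) ^ 2 - X ^ 2) * c₂ = 0)).resolve_left hdet
      linear_combination X * e1 + (κ + 1 / a) * e2
  have hE := hcell.energy_nonneg hκ.le hα hβ hu1
  have hω : √(k2 * (X + κ + 1)) ^ 2 = k2 * (X + κ + 1) := Real.sq_sqrt (mul_nonneg hk2.le hE)
  have hω' : √(k2 * (X + κ + 1)) ^ 2 / k2 - κ - 1 = X := by
    rw [hω]; field_simp; ring
  refine ⟨√(k2 * (X + κ + 1)), u, ⟨?_, ?_, ?_⟩, hω'⟩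
  · refine (isEigenstate_succ_iff hk2).mpr ⟨fun h => hu1 (by rw [h]; rfl), fun j hj => ?_, ?_⟩
    · rw [hu, profileState, if_pos hj]
    · rw [hω']; exact hcell
  · refine (isDecayFactor_iff hk1 hk).mpr ⟨ha1.le, ha0, ?_⟩
    rw [hω']; exact hX
  · intro m hm
    have e1 := profileState_odd (Nat.lt_succ_iff.mp hm) (κ + 1 / a) X a (k2 * c₁) (k2 * c₂)
    have e2 := profileState_even (Nat.lt_succ_iff.mp hm) (κ + 1 / a) X a (k2 * c₁) (k2 * c₂)
    have hx : √(k2 * (X + κ + 1)) ^ 2 - k1 - k2 = k2 * X := by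
      rw [hω]; linear_combination (-1) * hk1e
    have hp : k1 + k2 / a = k2 * (κ + 1 / a) := by
      linear_combination hk1e
    rw [hu, e1, e2, v₁, v₂, hx, hp]
    funext i
    fin_cases i
    · simp; ring
    · simp; ring

/-! ### A quantitative intermediate value argument. -/

/-- The power is at most `exp (2 M n ρ ^ n)`. It is needed because `a` varies with the root: an
exponentially small relative change of `a` at most doubles `a ^ (2 n)`. -/
theorem eventually_one_add_pow_le_two {ρ M : ℝ} (hρ : 0 ≤ ρ) (hρ1 : ρ < 1) (hM : 0 ≤ M) :
    ∀ᶠ n : ℕ in atTop, (1 + M * ρ ^ (2 * n - 1)) ^ (2 * n) ≤ 2 := by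
  have h := (tendsto_self_mul_const_pow_of_lt_one hρ hρ1).const_mul (2 * M)
  rw [mul_zero] at h
  filter_upwards [h.eventually_le_const (Real.log_pos one_lt_two), eventually_ge_atTop 1]
    with n hn hn1
  have h1 : ρ ^ (2 * n - 1) ≤ ρ ^ n := pow_le_pow_of_le_one hρ hρ1.le (by omega)
  have h2 : 1 + M * ρ ^ (2 * n - 1) ≤ Real.exp (M * ρ ^ n) :=
    (add_le_add_right (mul_le_mul_of_nonneg_left h1 hM) 1).trans
      ((add_comm _ _).trans_le (Real.add_one_le_exp _))
  calc (1 + M * ρ ^ (2 * n - 1)) ^ (2 * n) ≤ Real.exp (M * ρ ^ n) ^ (2 * n) := by gcongr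
    _ = Real.exp (2 * M * (n * ρ ^ n)) := by rw [← Real.exp_nat_mul]; push_cast; ring_nf
    _ ≤ Real.exp (Real.log 2) := Real.exp_le_exp.mpr hn
    _ = 2 := Real.exp_log two_pos

/-- The equation `(s - z) P(s) = f(s) ^ (2 n) (1 - z s) Q(s)` has a root close to `z`, at the distance
`O(f(z) ^ (2 n) / d)` where `d` is the length scale. -/
theorem exists_root_near {η c L ρ : ℝ} (hη : 0 < η) (hc : 0 < c) (hL : 0 ≤ L) (hρ : 0 ≤ ρ)
    (hρ1 : ρ < 1) : ∃ K > 0, ∀ᶠ n : ℕ in atTop, ∀ (z d : ℝ) (f P Q : ℝ → ℝ), 0 < d →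
      |z| + η * d ≤ 1 → ContinuousOn f (Set.Icc (z - η * d) (z + η * d)) → Continuous P →
      Continuous Q → f z ≠ 0 → |f z| ≤ ρ → |f z| ≤ d ^ 2 →
      (∀ s, |s - z| ≤ η * d → |f s - f z| ≤ L * d * |s - z|) → c ≤ |P z| →
      (∀ s, |P s - P z| ≤ |s - z| / d) → (∀ s, |s| ≤ 1 → |Q s| ≤ 2 / d) →
      ∃ s, |s - z| ≤ η * d ∧ |s - z| ≤ K * |f z| ^ (2 * n) / d ∧
        (s - z) * P s = f s ^ (2 * n) * ((1 - z * s) * Q s) := by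
  -- With this `K` the left side is at least `16 e ^ (2 n) / d` in modulus at distance `ε` from `z`,
  -- where the right side is at most `8 e ^ (2 n) / d`.
  set K := 32 / c with hK
  have hK0 : 0 < K := by positivity
  refine ⟨K, hK0, ?_⟩
  have hlim : Tendsto (fun n : ℕ => K * ρ ^ n) atTop (𝓝 0) := by
    simpa using (tendsto_pow_atTop_nhds_zero_of_lt_one hρ hρ1).const_mul K
  filter_upwards [eventually_one_add_pow_le_two hρ hρ1 (mul_nonneg hL hK0.le),
    hlim.eventually_le_const hη, hlim.eventually_le_const (half_pos hc), eventually_ge_atTop 1]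
    with n h2 h3 h4 hn
  intro z d f P Q hd hz hf hP hQ hfz0 hfz hfd hlip hcP hPlip hQb
  set e := |f z| with he
  have he0 : 0 < e := abs_pos.mpr hfz0
  set ε := K * e ^ (2 * n) / d with hε
  have hε0 : 0 < ε := by positivity
  have hen : e ^ (2 * n) = e * e ^ (2 * n - 1) := by
    rw [← pow_succ']; congr 1; omega
  have hen1 : e ^ (2 * n - 1) ≤ ρ ^ (2 * n - 1) := by gcongr
  have hen2 : e ^ (2 * n - 1) ≤ ρ ^ n :=
    hen1.trans (pow_le_pow_of_le_one hρ hρ1.le (by omega))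
  -- One factor of `e ^ (2 n)` is spent on `e ≤ d ^ 2`; thus `ε` is small compared with `d`, however
  -- small `d` is.
  have hεd : ε / d ≤ K * ρ ^ n := by
    rw [hε, div_div, div_le_iff₀ (by positivity), hen]
    calc K * (e * e ^ (2 * n - 1)) ≤ K * (d ^ 2 * ρ ^ n) := by gcongr
      _ = _ := by ring
  have hεη : ε ≤ η * d := (div_le_iff₀ hd).mp (hεd.trans h3)
  have hs1 : ∀ s, |s - z| ≤ ε → |s| ≤ 1 := fun s hs => by
    have := abs_sub_abs_le_abs_sub s z
    linarith
  have hRHS : ∀ s, |s - z| ≤ ε → |f s ^ (2 * n) * ((1 - z * s) * Q s)| ≤ 8 * e ^ (2 * n) / d := by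
    intro s hs
    have b1 : |f s| ≤ e * (1 + L * K * ρ ^ (2 * n - 1)) := by
      have := abs_sub_abs_le_abs_sub (f s) (f z)
      have h5 := hlip s (hs.trans hεη)
      have h6 : L * d * |s - z| ≤ L * d * ε := by gcongr
      have h7 : L * d * ε = L * K * (e * e ^ (2 * n - 1)) := by
        rw [hε, ← hen]; field_simp
      have h8 : L * K * (e * e ^ (2 * n - 1)) ≤ L * K * (e * ρ ^ (2 * n - 1)) := by gcongr
      linarith
    have b2 : |f s| ^ (2 * n) ≤ e ^ (2 * n) * 2 := by
      calc |f s| ^ (2 * n) ≤ (e * (1 + L * K * ρ ^ (2 * n - 1))) ^ (2 * n) := by gcongr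
        _ = e ^ (2 * n) * (1 + L * K * ρ ^ (2 * n - 1)) ^ (2 * n) := mul_pow _ _ _
        _ ≤ e ^ (2 * n) * 2 := by gcongr
    have b3 : |1 - z * s| ≤ 2 := by
      have hz1 : |z| ≤ 1 := by have : 0 < η * d := by positivity
                               linarith
      have : |z * s| ≤ 1 := by
        rw [abs_mul]; exact mul_le_one₀ hz1 (abs_nonneg _) (hs1 s hs)
      have := abs_le.mp this
      exact abs_le.mpr ⟨by linarith, by linarith⟩
    have b4 := hQb s (hs1 s hs)
    rw [abs_mul, abs_mul, abs_pow]
    calc |f s| ^ (2 * n) * (|1 - z * s| * |Q s|) ≤ (e ^ (2 * n) * 2) * (2 * (2 / d)) := by gcongr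
      _ = _ := by ring
  have hmain : c / 2 * ε = 16 * e ^ (2 * n) / d := by
    rw [hε, hK]; field_simp; norm_num
  have hlt : 8 * e ^ (2 * n) / d < 16 * e ^ (2 * n) / d := by
    gcongr
    norm_num
  set g : ℝ → ℝ := fun s => (s - z) * P s - f s ^ (2 * n) * ((1 - z * s) * Q s) with hg
  have hcont : ContinuousOn g (Set.uIcc (z - ε) (z + ε)) := by
    rw [Set.uIcc_of_le (by linarith)]
    have hf' : ContinuousOn f (Set.Icc (z - ε) (z + ε)) :=
      hf.mono (Set.Icc_subset_Icc (by linarith) (by linarith))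
    fun_prop
  have habs1 : |z + ε - z| ≤ ε := by rw [add_sub_cancel_left, abs_of_pos hε0]
  have habs2 : |z - ε - z| ≤ ε := by rw [sub_sub_cancel_left, abs_neg, abs_of_pos hε0]
  have hPd : ∀ s, |s - z| ≤ ε → |P s - P z| ≤ c / 2 := fun s hs =>
    (hPlip s).trans ((div_le_div_of_nonneg_right hs hd.le).trans (hεd.trans h4))
  have r1 := abs_le.mp (hRHS _ habs1)
  have r2 := abs_le.mp (hRHS _ habs2)
  have p1 := abs_le.mp (hPd _ habs1)
  have p2 := abs_le.mp (hPd _ habs2)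
  have hmem : (0 : ℝ) ∈ Set.uIcc (g (z - ε)) (g (z + ε)) := by
    rw [Set.mem_uIcc]
    rcases le_abs'.mp hcP with h | h
    · right
      have q1 : ε * P (z + ε) ≤ ε * (-(c / 2)) := mul_le_mul_of_nonneg_left (by linarith) hε0.le
      have q2 : ε * P (z - ε) ≤ ε * (-(c / 2)) := mul_le_mul_of_nonneg_left (by linarith) hε0.le
      simp only [hg, add_sub_cancel_left, sub_sub_cancel_left]
      constructor <;> linarith
    · left
      have q1 : ε * (c / 2) ≤ ε * P (z + ε) := mul_le_mul_of_nonneg_left (by linarith) hε0.le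
      have q2 : ε * (c / 2) ≤ ε * P (z - ε) := mul_le_mul_of_nonneg_left (by linarith) hε0.le
      simp only [hg, add_sub_cancel_left, sub_sub_cancel_left]
      constructor <;> linarith
  obtain ⟨s, hs, hs0⟩ := intermediate_value_uIcc hcont hmem
  rw [Set.uIcc_of_le (by linarith)] at hs
  have hsε : |s - z| ≤ ε := abs_le.mpr ⟨by linarith [hs.1], by linarith [hs.2]⟩
  exact ⟨s, hsε.trans hεη, hsε, sub_eq_zero.mp hs0⟩

/-! ### The decay factor as a function of the end stiffness. -/

/-- The modulus of the decay factor as a function of the stiffness parameter `s` of an end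
that supports an edge state with this decay factor. -/
noncomputable def decayModulus (κ s : ℝ) : ℝ :=
  -- The root in rationalized form: no division by `s ^ 2`, so `s = 0` (value `κ`) needs no separate
  -- treatment.
  2 * κ / ((1 - s ^ 2) + √((1 - s ^ 2) ^ 2 + 4 * κ ^ 2 * s ^ 2))

section decayModulus

variable {κ s t r : ℝ}

theorem decayModulus_denom_pos (hs : s ^ 2 < 1) :
    0 < (1 - s ^ 2) + √((1 - s ^ 2) ^ 2 + 4 * κ ^ 2 * s ^ 2) :=
  add_pos_of_pos_of_nonneg (by linarith) (Real.sqrt_nonneg _)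

theorem decayModulus_eq (hs : s ^ 2 < 1) :
    κ * s ^ 2 * decayModulus κ s ^ 2 + (1 - s ^ 2) * decayModulus κ s - κ = 0 := by
  have h1 := decayModulus_denom_pos (κ := κ) hs
  have h2 : √((1 - s ^ 2) ^ 2 + 4 * κ ^ 2 * s ^ 2) ^ 2 = (1 - s ^ 2) ^ 2 + 4 * κ ^ 2 * s ^ 2 :=
    Real.sq_sqrt (by positivity)
  unfold decayModulus
  set R := √((1 - s ^ 2) ^ 2 + 4 * κ ^ 2 * s ^ 2)
  field_simp
  linear_combination (-κ) * h2

theorem decayModulus_pos (hκ : 0 < κ) (hs : s ^ 2 < 1) : 0 < decayModulus κ s :=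
  div_pos (by linarith) (decayModulus_denom_pos hs)

theorem decayModulus_lt_one (hκ : 0 < κ) (hκ1 : κ < 1) (hs : s ^ 2 < 1) :
    decayModulus κ s < 1 := by
  have h := decayModulus_eq (κ := κ) hs
  have h0 := decayModulus_pos hκ hs
  by_contra! h1
  nlinarith [mul_nonneg hκ.le (sq_nonneg s), mul_nonneg (mul_nonneg hκ.le (sq_nonneg s))
    (by nlinarith : (0:ℝ) ≤ decayModulus κ s ^ 2 - 1),
    mul_pos (sub_pos.mpr hκ1) (sub_pos.mpr hs)]

/-- At `b = 1` the quadratic of `decayModulus_eq` takes the value `(1 - κ)(1 - s ^ 2)`. Hence `b`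
reaches `1` only at the thresholds, and is bounded away from it uniformly in `s` away from them. -/
theorem decayModulus_le (hκ : 0 < κ) (hκ1 : κ < 1) (hs : s ^ 2 < 1) :
    decayModulus κ s ≤ 1 - (1 - κ) * (1 - s ^ 2) / 3 := by
  have h := decayModulus_eq (κ := κ) hs
  have h0 := decayModulus_pos hκ hs
  have h1 := decayModulus_lt_one hκ hκ1 hs
  have e : (1 - κ) * (1 - s ^ 2) =
      (1 - decayModulus κ s) * (κ * s ^ 2 * (1 + decayModulus κ s) + (1 - s ^ 2)) := by
    linear_combination h
  have b : κ * s ^ 2 * (1 + decayModulus κ s) + (1 - s ^ 2) ≤ 3 := by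
    have : κ * s ^ 2 ≤ 1 := mul_le_one₀ hκ1.le (sq_nonneg s) hs.le
    nlinarith [sq_nonneg s]
  have := mul_le_mul_of_nonneg_left b (sub_nonneg.mpr h1.le)
  linarith

theorem abs_decayModulus_sub_le (hκ : 0 < κ) (hκ1 : κ < 1) (hs : s ^ 2 < 1) (ht : t ^ 2 < 1) :
    |decayModulus κ s - decayModulus κ t| ≤ |s ^ 2 - t ^ 2| / (1 - s ^ 2) := by
  have e1 := decayModulus_eq (κ := κ) hs
  have e2 := decayModulus_eq (κ := κ) ht
  have p1 := decayModulus_pos hκ hs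
  have p2 := decayModulus_pos hκ ht
  have l2 := decayModulus_lt_one hκ hκ1 ht
  set b := decayModulus κ s
  set b' := decayModulus κ t
  rw [le_div_iff₀ (by linarith)]
  have e : (b - b') * (κ * s ^ 2 * (b + b') + (1 - s ^ 2)) =
      (s ^ 2 - t ^ 2) * (b' * (1 - κ * b')) := by linear_combination e1 - e2
  have hb : 0 ≤ b' * (1 - κ * b') ∧ b' * (1 - κ * b') ≤ 1 := by
    constructor
    · exact mul_nonneg p2.le (by nlinarith)
    · nlinarith [mul_pos hκ p2]
  have hq : 0 ≤ κ * s ^ 2 * (b + b') := by positivity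
  calc |b - b'| * (1 - s ^ 2) ≤ |b - b'| * (κ * s ^ 2 * (b + b') + (1 - s ^ 2)) := by
        gcongr; linarith
    _ = |s ^ 2 - t ^ 2| * (b' * (1 - κ * b')) := by
        rw [← abs_of_nonneg (show 0 ≤ κ * s ^ 2 * (b + b') + (1 - s ^ 2) by linarith), ← abs_mul, e,
          abs_mul, abs_of_nonneg hb.1]
    _ ≤ |s ^ 2 - t ^ 2| := mul_le_of_le_one_right (abs_nonneg _) hb.2

theorem continuousOn_decayModulus : ContinuousOn (decayModulus κ) {s | s ^ 2 < 1} := by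
  unfold decayModulus
  exact ContinuousOn.div (by fun_prop) (by fun_prop) fun s hs => (decayModulus_denom_pos hs).ne'

end decayModulus

theorem sq_lt_one_of_abs_le {s r : ℝ} (hs : |s| ≤ r) (hr : r < 1) : s ^ 2 < 1 :=
  (sq_lt_one_iff_abs_lt_one s).mpr (hs.trans_lt hr)

theorem decayModulus_le_of_abs_le {κ s r : ℝ} (hκ : 0 < κ) (hκ1 : κ < 1) (hs : |s| ≤ r)
    (hr : r < 1) : decayModulus κ s ≤ 1 - (1 - κ) * (1 - r ^ 2) / 3 := by
  refine (decayModulus_le hκ hκ1 (sq_lt_one_of_abs_le hs hr)).trans ?_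
  have : s ^ 2 ≤ r ^ 2 := by rw [← sq_abs]; gcongr
  have : (1 - κ) * (1 - r ^ 2) ≤ (1 - κ) * (1 - s ^ 2) :=
    mul_le_mul_of_nonneg_left (by linarith) (by linarith)
  linarith

theorem abs_decayModulus_sub_le_of_abs_le {κ s t r : ℝ} (hκ : 0 < κ) (hκ1 : κ < 1) (hs : |s| ≤ r)
    (ht : |t| ≤ r) (hr : r < 1) :
    |decayModulus κ s - decayModulus κ t| ≤ (|s| + |t|) / (1 - r ^ 2) * |s - t| := by
  have hs2 := sq_lt_one_of_abs_le hs hr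
  have hr0 : 0 ≤ r := (abs_nonneg s).trans hs
  have hr2 : 0 < 1 - r ^ 2 := by nlinarith
  refine (abs_decayModulus_sub_le hκ hκ1 hs2 (sq_lt_one_of_abs_le ht hr)).trans ?_
  have h1 : |s ^ 2 - t ^ 2| ≤ (|s| + |t|) * |s - t| := by
    rw [show s ^ 2 - t ^ 2 = (s + t) * (s - t) by ring, abs_mul]
    gcongr
    exact abs_add_le s t
  have h2 : s ^ 2 ≤ r ^ 2 := by rw [← sq_abs]; gcongr
  rw [div_mul_eq_mul_div]
  exact div_le_div₀ (by positivity) h1 hr2 (by linarith)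

theorem one_sub_sq_mul_pos {κ r : ℝ} (hκ1 : κ < 1) (hr0 : 0 ≤ r) (hr : r < 1) :
    0 < (1 - κ) * (1 - r ^ 2) := by
  have : r ^ 2 < 1 := by nlinarith
  exact mul_pos (by linarith) (by linarith)

/-! ### Roots of the characteristic equation near the semi-infinite value. -/

/-- An edge state in the gap between the bands, close to the one of the semi-infinite chain. -/
theorem exists_gap_root {κ c : ℝ} (hκ : 0 < κ) (hκ1 : κ < 1) (hc : 0 < c) (hc1 : c < 1) :
    ∃ C > 0, ∀ᶠ n : ℕ in atTop, ∀ α β : ℝ, |α| ≤ 1 - c → c * (|α| + |β| + 1) ≤ |β - α| →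
      ∃ s, |s| ≤ 1 - c / 2 ∧ |s - α| ≤ C * decayModulus κ α ^ (2 * n) ∧
        (s - α) * (s - β) = decayModulus κ s ^ (2 * n) * ((1 - α * s) * (1 - β * s)) ∧
        |1 - β * s| ≤ C * |s - β| ∧ s - β ≠ 0 ∧
        |decayModulus κ s - decayModulus κ α| ≤ C * decayModulus κ α ^ (2 * n) := by
  set r := 1 - c / 2 with hr
  have hr0 : 0 ≤ r := by linarith
  have hr1 : r < 1 := by linarith
  have hr2 : 0 < 1 - r ^ 2 := by nlinarith
  have hpos := one_sub_sq_mul_pos hκ1 hr0 hr1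
  set ρ := max 0 (1 - (1 - κ) * (1 - r ^ 2) / 3)
  set L := 2 / (1 - r ^ 2) with hL
  have hL0 : 0 < L := by positivity
  obtain ⟨K, hK, hroot⟩ := exists_root_near (η := c / 2) (c := c) (L := L) (ρ := ρ) (by linarith) hc
    hL0.le (le_max_left _ _) (max_lt one_pos (by linarith))
  refine ⟨K + L * K + 2 / c, by positivity, ?_⟩
  filter_upwards [hroot] with n hn α β hα hβ
  have hαr : |α| ≤ r := by linarith
  have hα1 := sq_lt_one_of_abs_le hαr hr1
  have hβ0 : 0 < 1 + |β| := by positivity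
  have hbα := decayModulus_pos hκ hα1
  have hsr : ∀ s, |s - α| ≤ c / 2 → |s| ≤ r := fun s hs => by
    have := abs_sub_abs_le_abs_sub s α
    linarith
  have hlip : ∀ s, |s - α| ≤ c / 2 →
      |decayModulus κ s - decayModulus κ α| ≤ L * |s - α| := fun s hs => by
    refine (abs_decayModulus_sub_le_of_abs_le hκ hκ1 (hsr s hs) hαr hr1).trans ?_
    have := hsr s hs
    rw [hL]
    gcongr
    linarith
  -- Division by `1 + |β|` makes all bounds uniform in `β`, which may be unbounded.
  have hPα : c ≤ |(α - β) / (1 + |β|)| := by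
    rw [abs_div, abs_of_pos hβ0, le_div_iff₀ hβ0, abs_sub_comm]
    have := mul_nonneg hc.le (abs_nonneg α)
    linarith
  have hPlip : ∀ s, |(s - β) / (1 + |β|) - (α - β) / (1 + |β|)| ≤ |s - α| := fun s => by
    rw [← sub_div, sub_sub_sub_cancel_right, abs_div, abs_of_pos hβ0]
    exact div_le_self (abs_nonneg _) (by linarith [abs_nonneg β])
  have hQ : ∀ s, |s| ≤ 1 → |(1 - β * s) / (1 + |β|)| ≤ 1 := fun s hs => by
    rw [abs_div, abs_of_pos hβ0, div_le_one hβ0]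
    refine (abs_sub _ _).trans ?_
    rw [abs_one, abs_mul]
    have := mul_le_of_le_one_right (abs_nonneg β) hs
    linarith
  obtain ⟨s, hs1, hs2, hs3⟩ := hn α 1 (decayModulus κ) (fun s => (s - β) / (1 + |β|))
    (fun s => (1 - β * s) / (1 + |β|)) one_pos (by linarith)
    (continuousOn_decayModulus.mono fun s hs => sq_lt_one_of_abs_le
      (hsr s (abs_le.mpr ⟨by linarith [hs.1], by linarith [hs.2]⟩)) hr1)
    (by fun_prop) (by fun_prop) hbα.ne'
    (by rw [abs_of_pos hbα]; exact (decayModulus_le_of_abs_le hκ hκ1 hαr hr1).trans (le_max_right _ _))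
    (by rw [abs_of_pos hbα]; simpa using (decayModulus_lt_one hκ hκ1 hα1).le)
    (fun s hs => by rw [mul_one]; exact hlip s (by linarith)) hPα
    (fun s => by rw [div_one]; exact hPlip s) (fun s hs => (hQ s hs).trans (by norm_num))
  rw [mul_one] at hs1
  rw [div_one, abs_of_pos hbα] at hs2
  have hsr' := hsr s hs1
  have hb2 : 0 ≤ decayModulus κ α ^ (2 * n) := by positivity
  have hPs : c / 2 * (1 + |β|) ≤ |s - β| := by
    have h1 := abs_sub_abs_le_abs_sub ((α - β) / (1 + |β|)) ((s - β) / (1 + |β|))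
    rw [abs_sub_comm] at h1
    have h2 := hPlip s
    have h3 : c / 2 ≤ |(s - β) / (1 + |β|)| := by linarith
    rwa [abs_div, abs_of_pos hβ0, le_div_iff₀ hβ0] at h3
  have hPs0 : 0 < |s - β| := lt_of_lt_of_le (by positivity) hPs
  refine ⟨s, hsr', hs2.trans ?_, ?_, ?_, abs_pos.mp hPs0, (hlip s hs1).trans ?_⟩
  · gcongr
    have : 0 < L * K + 2 / c := by positivity
    linarith
  · field_simp at hs3
    linear_combination hs3
  · have h1 := hQ s (hsr'.trans hr1.le)
    rw [abs_div, abs_of_pos hβ0, div_le_one hβ0] at h1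
    calc |1 - β * s| ≤ 1 + |β| := h1
      _ = 2 / c * (c / 2 * (1 + |β|)) := by field_simp
      _ ≤ 2 / c * |s - β| := by gcongr
      _ ≤ _ := by
        gcongr
        have : 0 < K + L * K := by positivity
        linarith
  · calc L * |s - α| ≤ L * (K * decayModulus κ α ^ (2 * n)) := by gcongr
      _ = L * K * decayModulus κ α ^ (2 * n) := by ring
      _ ≤ _ := by
        gcongr
        have : 0 < K + 2 / c := by positivity
        linarith

/-- An edge state above the bands, close to the one of the semi-infinite chain. -/
theorem exists_outer_root {κ c : ℝ} (hκ : 0 < κ) (hκ1 : κ < 1) (hc : 0 < c) (hc1 : c < 1) :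
    ∃ C > 0, ∀ᶠ n : ℕ in atTop, ∀ α β : ℝ, 0 < α → α⁻¹ ≤ 1 - c →
      c * (|α| + |β| + 1) ≤ |β - α| →
      ∃ t, 0 < t ∧ t ≤ 1 - c / 2 ∧
        (1 - α * t) * (1 - β * t) =
          (t ^ 2 * decayModulus κ t) ^ (2 * n) * ((t - α) * (t - β)) ∧
        t ^ 2 * decayModulus κ t * |t - β| ≤ C * |1 - β * t| ∧ 1 - β * t ≠ 0 ∧
        |t ^ 2 * decayModulus κ t - α⁻¹ ^ 2 * decayModulus κ α⁻¹| ≤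
          C * (α⁻¹ ^ 2 * decayModulus κ α⁻¹) ^ (2 * n) := by
  set r := 1 - c / 2 with hr
  have hr0 : 0 ≤ r := by linarith
  have hr1 : r < 1 := by linarith
  have hr2 : 0 < 1 - r ^ 2 := by nlinarith
  have hpos := one_sub_sq_mul_pos hκ1 hr0 hr1
  set ρ := max 0 (1 - (1 - κ) * (1 - r ^ 2) / 3)
  set L := 2 / (1 - r ^ 2) + 3 with hL
  have hL0 : 0 < L := by positivity
  obtain ⟨K, hK, hroot⟩ := exists_root_near (η := c / 2) (c := c) (L := 4 * L) (ρ := ρ)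
    (by linarith) hc (by positivity) (le_max_left _ _) (max_lt one_pos (by linarith))
  refine ⟨4 * L * K + 16 / c, by positivity, ?_⟩
  filter_upwards [hroot] with n hn α β hα0 hα hβ
  set z := α⁻¹ with hz
  have hz0 : 0 < z := inv_pos.mpr hα0
  have hzα : z * α = 1 := inv_mul_cancel₀ hα0.ne'
  have hαz : α = z⁻¹ := by rw [hz, inv_inv]
  have hzr : |z| ≤ r := by rw [abs_of_pos hz0]; linarith
  have hz1 : z ^ 2 < 1 := sq_lt_one_of_abs_le hzr hr1
  have hzle : z ≤ 1 := by linarith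
  have hβ0 : 0 < 1 + |β| * z := by positivity
  have hbz := decayModulus_pos hκ hz1
  have hbz1 := decayModulus_lt_one hκ hκ1 hz1
  have hfz : 0 < z ^ 2 * decayModulus κ z := by positivity
  have hfzle : z ^ 2 * decayModulus κ z ≤ z ^ 2 := mul_le_of_le_one_right (sq_nonneg z) hbz1.le
  have hsr : ∀ s, |s - z| ≤ c / 2 * z → 0 < s ∧ s ≤ 2 * z ∧ |s| ≤ r := fun s hs => by
    obtain ⟨l1, l2⟩ := abs_le.mp hs
    have l3 : c / 2 * z ≤ 1 / 2 * z := by gcongr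
    have l4 : c / 2 * z ≤ c / 2 * 1 := by gcongr
    have l5 : 0 < s := by linarith
    exact ⟨l5, by linarith, by rw [abs_of_pos l5]; linarith⟩
  have hlip : ∀ s, |s - z| ≤ c / 2 * z →
      |s ^ 2 * decayModulus κ s - z ^ 2 * decayModulus κ z| ≤ 4 * L * z * |s - z| := fun s hs => by
    obtain ⟨l0, l1, l2⟩ := hsr s hs
    have h1 := abs_decayModulus_sub_le_of_abs_le hκ hκ1 l2 hzr hr1
    have h2 : (|s| + |z|) / (1 - r ^ 2) ≤ 2 / (1 - r ^ 2) := by gcongr; linarith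
    have h3 : |decayModulus κ s - decayModulus κ z| ≤ 2 / (1 - r ^ 2) * |s - z| :=
      h1.trans (by gcongr)
    have h4 : s ^ 2 ≤ 4 * z := by
      have : s ≤ 1 := (le_abs_self s).trans (l2.trans hr1.le)
      nlinarith
    have h5 : |s + z| ≤ 3 * z := by rw [abs_of_pos (by linarith)]; linarith
    calc |s ^ 2 * decayModulus κ s - z ^ 2 * decayModulus κ z|
        = |s ^ 2 * (decayModulus κ s - decayModulus κ z) +
            (s + z) * (s - z) * decayModulus κ z| := by congr 1; ring
      _ ≤ s ^ 2 * |decayModulus κ s - decayModulus κ z| + |s + z| * |s - z| * decayModulus κ z := by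
          refine (abs_add_le _ _).trans (le_of_eq ?_)
          rw [abs_mul, abs_mul, abs_mul, abs_of_nonneg (sq_nonneg s), abs_of_pos hbz]
      _ ≤ 4 * z * (2 / (1 - r ^ 2) * |s - z|) + 3 * z * |s - z| * 1 := by gcongr
      _ ≤ 4 * L * z * |s - z| := by
          rw [hL]
          have : 0 ≤ z * |s - z| := by positivity
          linarith
  have hPz : c ≤ |(1 - β * z) / (1 + |β| * z)| := by
    rw [abs_div, abs_of_pos hβ0, le_div_iff₀ hβ0]
    have h1 : |1 - β * z| = |β - α| * z := by
      rw [← abs_of_pos hz0, ← abs_mul, abs_sub_comm, abs_of_pos hz0]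
      congr 1
      linear_combination hzα
    rw [h1]
    have h2 := mul_le_mul_of_nonneg_right hβ hz0.le
    have h3 : |α| * z = 1 := by rw [abs_of_pos hα0, mul_comm, hzα]
    have h4 : 0 ≤ c * z := by positivity
    linear_combination h2 - c * h3 + h4
  have hPlip : ∀ s, |(1 - β * s) / (1 + |β| * z) - (1 - β * z) / (1 + |β| * z)| ≤
      |s - z| / z := fun s => by
    rw [← sub_div, sub_sub_sub_cancel_left, ← mul_sub, abs_div, abs_of_pos hβ0, abs_mul,
      abs_sub_comm, div_le_div_iff₀ hβ0 hz0]
    nlinarith [abs_nonneg (s - z)]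
  have hQ : ∀ s, |s| ≤ 1 → |(s - β) / (1 + |β| * z)| ≤ 1 / z := fun s hs => by
    rw [abs_div, abs_of_pos hβ0, div_le_div_iff₀ hβ0 hz0]
    have h1 : |s - β| ≤ 1 + |β| := (abs_sub _ _).trans (by linarith)
    nlinarith [abs_nonneg β]
  -- The length scale is `z = 1 / α` itself, since `α` may tend to infinity. The factor `z ^ 2` in
  -- the decay factor provides the required bound by the squared scale.
  obtain ⟨s, hs1, hs2, hs3⟩ := hn z z (fun s => s ^ 2 * decayModulus κ s)
    (fun s => (1 - β * s) / (1 + |β| * z)) (fun s => (s - β) / (1 + |β| * z)) hz0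
    (by have : c / 2 * z ≤ c / 2 * 1 := by gcongr
        rw [abs_of_pos hz0]; linarith)
    (ContinuousOn.mul (by fun_prop) (continuousOn_decayModulus.mono fun s hs =>
      sq_lt_one_of_abs_le
        (hsr s (abs_le.mpr ⟨by linarith [hs.1], by linarith [hs.2]⟩)).2.2 hr1))
    (by fun_prop) (by fun_prop) hfz.ne'
    (by rw [abs_of_pos hfz]
        refine le_trans ?_ (le_max_right _ _)
        exact (mul_le_of_le_one_left hbz.le hz1.le).trans
          (decayModulus_le_of_abs_le hκ hκ1 hzr hr1))
    (by rw [abs_of_pos hfz]; exact hfzle)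
    hlip hPz hPlip (fun s hs => (hQ s hs).trans (by gcongr; norm_num))
  rw [abs_of_pos hfz] at hs2
  obtain ⟨l0, l1, l2⟩ := hsr s hs1
  have hsle := (le_abs_self s).trans l2
  have hs12 := sq_lt_one_of_abs_le l2 hr1
  have hPs : c / 2 * (1 + |β| * z) ≤ |1 - β * s| := by
    have h1 := abs_sub_abs_le_abs_sub ((1 - β * z) / (1 + |β| * z)) ((1 - β * s) / (1 + |β| * z))
    rw [abs_sub_comm] at h1
    have h2 := (hPlip s).trans ((div_le_iff₀ hz0).mpr hs1)
    have h3 : c / 2 ≤ |(1 - β * s) / (1 + |β| * z)| := by linarith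
    rwa [abs_div, abs_of_pos hβ0, le_div_iff₀ hβ0] at h3
  have hPs0 : 0 < |1 - β * s| := lt_of_lt_of_le (by positivity) hPs
  refine ⟨s, l0, hsle, ?_, ?_, abs_pos.mp hPs0, (hlip s hs1).trans ?_⟩
  · field_simp at hs3
    linear_combination (-α) * hs3 + (-(1 - β * s) + (s ^ 2 * decayModulus κ s) ^ (2 * n) *
      (s * (s - β))) * hzα
  · have h1 := hQ s (l2.trans hr1.le)
    rw [abs_div, abs_of_pos hβ0, div_le_div_iff₀ hβ0 hz0, one_mul] at h1
    have h2 : s ^ 2 * decayModulus κ s ≤ 4 * z ^ 2 := by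
      have h3 : s ^ 2 ≤ (2 * z) ^ 2 := by gcongr
      have h4 := mul_le_of_le_one_right (sq_nonneg s) (decayModulus_lt_one hκ hκ1 hs12).le
      linarith
    calc s ^ 2 * decayModulus κ s * |s - β| ≤ 4 * z ^ 2 * |s - β| := by gcongr
      _ = 4 * z * (|s - β| * z) := by ring
      _ ≤ 4 * 1 * (1 + |β| * z) := by gcongr
      _ = 8 / c * (c / 2 * (1 + |β| * z)) := by field_simp; norm_num
      _ ≤ 8 / c * |1 - β * s| := by gcongr
      _ ≤ _ := by
        gcongr
        have h5 : 8 / c ≤ 16 / c := by gcongr; norm_num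
        have : 0 < 4 * L * K := by positivity
        linarith
  · calc 4 * L * z * |s - z| ≤ 4 * L * z * (K * (z ^ 2 * decayModulus κ z) ^ (2 * n) / z) := by
          gcongr
      _ = 4 * L * K * (z ^ 2 * decayModulus κ z) ^ (2 * n) := by field_simp
      _ ≤ _ := by
        gcongr
        have : 0 < 16 / c := by positivity
        linarith

/-! ### Left edge states of long chains. -/

theorem isSemiInfiniteFactor_iff {k1 k2 A a : ℝ} (hk2 : 0 < k2) :
    IsSemiInfiniteFactor k1 k2 A a ↔ |a| < 1 ∧
      k1 / k2 * (A / k2 - 1) ^ 2 * a ^ 2 + ((A / k2 - 1) ^ 2 - 1) * a - k1 / k2 = 0 := by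
  unfold IsSemiInfiniteFactor
  refine and_congr_right fun _ => ?_
  have h : (A - k2) ^ 2 * k1 * a ^ 2 + (k2 * (A - k2) ^ 2 - k2 ^ 3) * a - k1 * k2 ^ 2 = k2 ^ 3 *
      (k1 / k2 * (A / k2 - 1) ^ 2 * a ^ 2 + ((A / k2 - 1) ^ 2 - 1) * a - k1 / k2) := by
    field_simp
  rw [h, mul_eq_zero, or_iff_right (pow_ne_zero 3 hk2.ne')]

/-- The chart `T = 1` of the projective parameter; here `a < 0`. -/
theorem exists_isState_gap {k1 k2 A B : ℝ} (hk1 : 0 < k1) (hk : k1 < k2) (hA : 0 ≤ A) (hB : 0 ≤ B)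
    {N : ℕ} {s : ℝ} (hs : s ^ 2 < 1)
    (heq : (s - (A / k2 - 1)) * (s - (B / k2 - 1)) = decayModulus (k1 / k2) s ^ (2 * (N + 1)) *
      ((1 - (A / k2 - 1) * s) * (1 - (B / k2 - 1) * s))) :
    ∃ ω u, IsState k1 k2 A B (N + 1) ω u (-decayModulus (k1 / k2) s)
        (-decayModulus (k1 / k2) s * (1 - (A / k2 - 1) * s)) (s - (A / k2 - 1)) ∧
      ω ^ 2 / k2 - k1 / k2 - 1 = s * (k1 / k2 * -decayModulus (k1 / k2) s + 1) := by
  have hk2 := hk1.trans hk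
  have hκ := div_pos hk1 hk2
  have hκ1 := (div_lt_one hk2).mpr hk
  have hb := decayModulus_pos hκ hs
  have h := exists_isState hk1 hk hA hB (N := N) (S := s) (T := 1)
    (a := -decayModulus (k1 / k2) s) one_ne_zero (neg_ne_zero.mpr hb.ne')
    (by rw [abs_neg, abs_of_pos hb]; exact decayModulus_lt_one hκ hκ1 hs)
    (by linear_combination decayModulus_eq (κ := k1 / k2) hs)
    (by rw [Even.neg_pow ⟨N + 1, by ring⟩]; linear_combination heq)
  simpa only [mul_one, div_one] using h

/-- The chart `S = 1`; here `a > 0`. Replacing `s` by `1 / t` in the quadratic for the decay factor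
gives `a = t ^ 2` times the decay modulus of `t`. -/
theorem exists_isState_outer {k1 k2 A B : ℝ} (hk1 : 0 < k1) (hk : k1 < k2) (hA : 0 ≤ A)
    (hB : 0 ≤ B) {N : ℕ} {t : ℝ} (ht0 : 0 < t) (ht : t ^ 2 < 1)
    (heq : (1 - (A / k2 - 1) * t) * (1 - (B / k2 - 1) * t) =
      (t ^ 2 * decayModulus (k1 / k2) t) ^ (2 * (N + 1)) *
        ((t - (A / k2 - 1)) * (t - (B / k2 - 1)))) :
    ∃ ω u, IsState k1 k2 A B (N + 1) ω u (t ^ 2 * decayModulus (k1 / k2) t)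
        (t ^ 2 * decayModulus (k1 / k2) t * (t - (A / k2 - 1))) (1 - (A / k2 - 1) * t) ∧
      ω ^ 2 / k2 - k1 / k2 - 1 = (k1 / k2 * (t ^ 2 * decayModulus (k1 / k2) t) + 1) / t := by
  have hk2 := hk1.trans hk
  have hκ := div_pos hk1 hk2
  have hκ1 := (div_lt_one hk2).mpr hk
  have hb := decayModulus_pos hκ ht
  have hf : 0 < t ^ 2 * decayModulus (k1 / k2) t := by positivity
  have h := exists_isState hk1 hk hA hB (N := N) (S := 1) (T := t)
    (a := t ^ 2 * decayModulus (k1 / k2) t) ht0.ne' hf.ne'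
    (by rw [abs_of_pos hf]
        exact (mul_lt_of_lt_one_left hb ht).trans (decayModulus_lt_one hκ hκ1 ht))
    (by linear_combination t ^ 2 * decayModulus_eq (κ := k1 / k2) ht)
    (by linear_combination heq)
  simpa only [mul_one, one_mul] using h

/-- The characteristic equation trades the large power of `1 / a` for a quotient at the right end,
which is bounded as long as `S / T` stays away from `β`. -/
theorem coefficient_quotient {S T α β a : ℝ} {n : ℕ} (ha : a ≠ 0) (hT : T - α * S ≠ 0)
    (hS : S - β * T ≠ 0)
    (heq : (S - α * T) * (S - β * T) = a ^ (2 * n) * ((T - α * S) * (T - β * S))) :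
    (S - α * T) / (a * (T - α * S)) * a ^ (2 - 2 * (n : ℤ)) = a * ((T - β * S) / (S - β * T)) := by
  have h1 : a ^ (2 - 2 * (n : ℤ)) = a ^ 2 / a ^ (2 * n) := by
    rw [zpow_sub₀ ha]
    norm_cast
  have h2 : a ^ (2 * n) ≠ 0 := pow_ne_zero _ ha
  rw [h1, div_mul_div_comm, ← mul_div_assoc, div_eq_div_iff (by positivity) hS]
  linear_combination a ^ 2 * heq

/-- Existence of a state that decays like the edge state of the semi-infinite chain at the
left end, with the constants `ρ` and `C` in the estimates. -/
def HasLeftEdgeState (k1 k2 ρ C : ℝ) (N : ℕ) (A B : ℝ) : Prop :=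
  ∃ (ã ω a c₁ c₂ : ℝ) (u : ℕ → ℝ), IsSemiInfiniteFactor k1 k2 A ã ∧
    IsState k1 k2 A B (N + 1) ω u a c₁ c₂ ∧ |a| ≤ ρ ∧ |ã| ≤ ρ ∧ ã ≠ 0 ∧ c₁ ≠ 0 ∧
    |c₂ / c₁ * a ^ (2 - 2 * ((N + 1 : ℕ) : ℤ))| ≤ C ∧ |a - ã| ≤ C * |ã| ^ (2 * (N + 1)) ∧
    (A = k2 → |a + k1 / k2| ≤ C * (k1 / k2) ^ (4 * (N + 1)))

theorem HasLeftEdgeState.mono {k1 k2 ρ C C' A B : ℝ} {N : ℕ} (hκ : 0 < k1 / k2) (hC : C ≤ C')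
    (h : HasLeftEdgeState k1 k2 ρ C N A B) : HasLeftEdgeState k1 k2 ρ C' N A B := by
  obtain ⟨ã, ω, a, c₁, c₂, u, h1, h2, h3, h4, h5, h6, h7, h8, h9⟩ := h
  refine ⟨ã, ω, a, c₁, c₂, u, h1, h2, h3, h4, h5, h6, h7.trans hC, h8.trans ?_,
    fun hA => (h9 hA).trans ?_⟩ <;> gcongr

theorem hasLeftEdgeState_gap {k1 k2 c : ℝ} (hk1 : 0 < k1) (hk : k1 < k2) (hc : 0 < c)
    (hc1 : c < 1) :
    ∃ C > 0, ∀ᶠ N : ℕ in atTop, ∀ A B : ℝ, 0 ≤ A → 0 ≤ B → |A / k2 - 1| ≤ 1 - c →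
      c * (|A / k2 - 1| + |B / k2 - 1| + 1) ≤ |(B / k2 - 1) - (A / k2 - 1)| →
      HasLeftEdgeState k1 k2 (1 - (1 - k1 / k2) * (1 - (1 - c / 2) ^ 2) / 3) C N A B := by
  have hk2 := hk1.trans hk
  have hκ := div_pos hk1 hk2
  have hκ1 := (div_lt_one hk2).mpr hk
  obtain ⟨C, hC, hroot⟩ := exists_gap_root hκ hκ1 hc hc1
  have hr0 : 0 ≤ 1 - c / 2 := by linarith
  have hr1 : 1 - c / 2 < 1 := by linarith
  have hpos := one_sub_sq_mul_pos hκ1 hr0 hr1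
  refine ⟨C ^ 2 + C, by positivity, ?_⟩
  filter_upwards [(tendsto_add_atTop_nat 1).eventually hroot] with N hroot A B hA hB hα hβ
  have hAα : A = k2 → A / k2 - 1 = 0 := by rintro rfl; field_simp; simp
  have hstate := @exists_isState_gap k1 k2 A B hk1 hk hA hB N
  have hsemi := fun x => @isSemiInfiniteFactor_iff k1 k2 A x hk2
  unfold HasLeftEdgeState
  generalize A / k2 - 1 = α at *
  generalize B / k2 - 1 = β at *
  generalize k1 / k2 = κ at *
  have hr : (1 : ℝ) - c ≤ 1 - c / 2 := by linarith
  generalize 1 - c / 2 = r at *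
  have hα0 := hα
  have hlt : |α| < 1 := by linarith
  obtain ⟨s, hsr, hsα, heq, hq, hne, hdiff⟩ := hroot α β hα0 hβ
  have hs1 := sq_lt_one_of_abs_le hsr hr1
  have hα2 : α ^ 2 < 1 := (sq_lt_one_iff_abs_lt_one α).mpr hlt
  obtain ⟨ω, u, hst, -⟩ := hstate hs1 heq
  have hb := decayModulus_pos hκ hs1
  have hb' := decayModulus_pos hκ hα2
  have hb1 := decayModulus_lt_one hκ hκ1 hs1
  have hαs : 1 - α * s ≠ 0 := by
    have : |α * s| < 1 := by
      rw [abs_mul]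
      exact mul_lt_one_of_nonneg_of_lt_one_left (abs_nonneg _) hlt (hsr.trans hr1.le)
    have := (abs_lt.mp this).2
    linarith
  refine ⟨-decayModulus κ α, ω, -decayModulus κ s, _, _, u, (hsemi _).mpr ⟨?_, ?_⟩, hst, ?_, ?_,
    neg_ne_zero.mpr hb'.ne', mul_ne_zero (neg_ne_zero.mpr hb.ne') hαs, ?_, ?_, fun hA2 => ?_⟩
  · rw [abs_neg, abs_of_pos hb']
    exact decayModulus_lt_one hκ hκ1 hα2
  · linear_combination decayModulus_eq (κ := κ) hα2
  · rw [abs_neg, abs_of_pos hb]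
    exact decayModulus_le_of_abs_le hκ hκ1 hsr hr1
  · rw [abs_neg, abs_of_pos hb']
    exact decayModulus_le_of_abs_le hκ hκ1 (hα0.trans (by linarith)) hr1
  · have h3 := coefficient_quotient (S := s) (T := 1) (α := α) (β := β) (n := N + 1)
      (neg_ne_zero.mpr hb.ne') hαs (by rwa [mul_one])
      (by rw [Even.neg_pow ⟨N + 1, by ring⟩]; linear_combination heq)
    rw [mul_one, mul_one] at h3
    rw [h3, abs_mul, abs_neg, abs_of_pos hb, abs_div]
    have h4 : |1 - β * s| / |s - β| ≤ C := (div_le_iff₀ (abs_pos.mpr hne)).mpr hq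
    calc decayModulus κ s * (|1 - β * s| / |s - β|) ≤ 1 * C := by gcongr
      _ ≤ _ := by nlinarith
  · rw [neg_sub_neg, abs_sub_comm, abs_neg, abs_of_pos hb']
    refine hdiff.trans ?_
    gcongr
    nlinarith
  · have hα00 := hAα hA2
    have hbκ : decayModulus κ α = κ := by
      have := decayModulus_eq (κ := κ) hα2
      rw [hα00] at this ⊢
      linear_combination this
    rw [hbκ, hα00, sub_zero] at hsα
    have e := decayModulus_eq (κ := κ) hs1
    -- For `α = 0` the decay modulus is stationary: its deviation from `κ` is quadratic in `s`, and
    -- `s = O(κ ^ (2 n))`. This doubles the exponent.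
    have e2 : -decayModulus κ s + κ = -(s ^ 2 * (decayModulus κ s * (1 - κ * decayModulus κ s))) := by
      linear_combination -e
    have e3 : 0 ≤ 1 - κ * decayModulus κ s := by nlinarith
    have e4 : decayModulus κ s * (1 - κ * decayModulus κ s) ≤ 1 := by
      have := mul_pos hκ hb
      exact mul_le_one₀ hb1.le e3 (by linarith)
    rw [e2, abs_neg, abs_of_nonneg (by positivity)]
    calc s ^ 2 * (decayModulus κ s * (1 - κ * decayModulus κ s)) ≤ s ^ 2 :=
          mul_le_of_le_one_right (sq_nonneg s) e4
      _ = |s| ^ 2 := (sq_abs s).symm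
      _ ≤ (C * κ ^ (2 * (N + 1))) ^ 2 := by gcongr
      _ = C ^ 2 * κ ^ (4 * (N + 1)) := by ring
      _ ≤ _ := by
        gcongr
        nlinarith

theorem hasLeftEdgeState_outer {k1 k2 c : ℝ} (hk1 : 0 < k1) (hk : k1 < k2) (hc : 0 < c)
    (hc1 : c < 1) :
    ∃ C > 0, ∀ᶠ N : ℕ in atTop, ∀ A B : ℝ, 0 ≤ A → 0 ≤ B →
      0 < A / k2 - 1 ∧ (A / k2 - 1)⁻¹ ≤ 1 - c →
      c * (|A / k2 - 1| + |B / k2 - 1| + 1) ≤ |(B / k2 - 1) - (A / k2 - 1)| →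
      HasLeftEdgeState k1 k2 (1 - (1 - k1 / k2) * (1 - (1 - c / 2) ^ 2) / 3) C N A B := by
  have hk2 := hk1.trans hk
  have hκ := div_pos hk1 hk2
  have hκ1 := (div_lt_one hk2).mpr hk
  obtain ⟨C, hC, hroot⟩ := exists_outer_root hκ hκ1 hc hc1
  have hr0 : 0 ≤ 1 - c / 2 := by linarith
  have hr1 : 1 - c / 2 < 1 := by linarith
  have hpos := one_sub_sq_mul_pos hκ1 hr0 hr1
  refine ⟨C ^ 2 + C, by positivity, ?_⟩
  filter_upwards [(tendsto_add_atTop_nat 1).eventually hroot] with N hroot A B hA hB hα hβ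
  have hAα : A = k2 → A / k2 - 1 = 0 := by rintro rfl; field_simp; simp
  have hstate' := @exists_isState_outer k1 k2 A B hk1 hk hA hB N
  have hsemi := fun x => @isSemiInfiniteFactor_iff k1 k2 A x hk2
  unfold HasLeftEdgeState
  generalize A / k2 - 1 = α at *
  generalize B / k2 - 1 = β at *
  generalize k1 / k2 = κ at *
  have hr : (1 : ℝ) - c ≤ 1 - c / 2 := by linarith
  generalize 1 - c / 2 = r at *
  obtain ⟨hα0, hαinv⟩ := hα
  have hge : 1 ≤ α := by
    by_contra! h
    have := (one_lt_inv₀ hα0).mpr h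
    linarith
  obtain ⟨t, ht0, htr, heq, hq, hne, hdiff⟩ := hroot α β hα0 hαinv hβ
  have htr' : |t| ≤ r := by rwa [abs_of_pos ht0]
  have ht1 := sq_lt_one_of_abs_le htr' hr1
  have hz : |α⁻¹| ≤ r := by rw [abs_of_pos (inv_pos.mpr hα0)]; linarith
  have hz1 := sq_lt_one_of_abs_le hz hr1
  obtain ⟨ω, u, hst, -⟩ := hstate' ht0 ht1 heq
  have hb := decayModulus_pos hκ ht1
  have hb' := decayModulus_pos hκ hz1
  have hf : 0 < t ^ 2 * decayModulus κ t := by positivity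
  have hf' : 0 < α⁻¹ ^ 2 * decayModulus κ α⁻¹ := by positivity
  have hfle' : α⁻¹ ^ 2 * decayModulus κ α⁻¹ ≤ 1 - (1 - κ) * (1 - r ^ 2) / 3 :=
    (mul_le_of_le_one_left hb'.le hz1.le).trans (decayModulus_le_of_abs_le hκ hκ1 hz hr1)
  have htα : t - α ≠ 0 := by linarith
  refine ⟨α⁻¹ ^ 2 * decayModulus κ α⁻¹, ω, t ^ 2 * decayModulus κ t, _, _, u,
    (hsemi _).mpr ⟨?_, ?_⟩, hst, ?_, ?_,
    hf'.ne', mul_ne_zero hf.ne' htα, ?_, ?_, fun hA2 => ?_⟩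
  · rw [abs_of_pos hf']
    linarith
  · have e := decayModulus_eq (κ := κ) hz1
    have h4 : α * α⁻¹ = 1 := mul_inv_cancel₀ hα0.ne'
    field_simp at e ⊢
    linear_combination e
  · rw [abs_of_pos hf]
    exact (mul_le_of_le_one_left hb.le ht1.le).trans
      (decayModulus_le_of_abs_le hκ hκ1 htr' hr1)
  · rwa [abs_of_pos hf']
  · have h3 := coefficient_quotient (S := 1) (T := t) (α := α) (β := β) (n := N + 1)
      hf.ne' (by rwa [mul_one]) hne (by linear_combination heq)
    rw [mul_one, mul_one] at h3
    rw [h3, abs_mul, abs_of_pos hf, abs_div, ← mul_div_assoc, div_le_iff₀ (abs_pos.mpr hne)]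
    refine hq.trans ?_
    gcongr
    nlinarith
  · rw [abs_of_pos hf']
    refine hdiff.trans ?_
    gcongr
    nlinarith
  · exact absurd (hAα hA2) hα0.ne'

/-- Nonnegative stiffness excludes `α < -1`, so an end away from the thresholds supports a state
either in the gap or above the bands. -/
theorem away_cases {c α : ℝ} (hc : 0 < c) (hα1 : -1 ≤ α) (hα : c * (|α| + 1) ≤ |(|α| - 1)|) :
    |α| ≤ 1 - c ∨ (0 < α ∧ α⁻¹ ≤ 1 - c) := by
  rcases lt_or_ge |α| 1 with hlt | hge
  · left
    rw [abs_of_nonpos (show |α| - 1 ≤ 0 by linarith)] at hα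
    have := mul_nonneg hc.le (abs_nonneg α)
    linarith
  · right
    rw [abs_of_nonneg (show 0 ≤ |α| - 1 by linarith)] at hα
    have hα0 : 0 < α := by
      by_contra! h
      rw [abs_of_nonpos h] at hα
      have : 0 < c * (-α + 1) := by apply mul_pos hc; linarith
      linarith
    rw [abs_of_pos hα0] at hα
    refine ⟨hα0, ?_⟩
    rw [inv_le_iff_one_le_mul₀ hα0]
    linarith

theorem neg_one_le_div_sub_one {A k2 : ℝ} (hA : 0 ≤ A) (hk2 : 0 < k2) : -1 ≤ A / k2 - 1 := by
  have := div_nonneg hA hk2.le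
  linarith

/-- In long chains an end that is away from the thresholds carries a state that decays like the
one of the semi-infinite chain, provided that the two ends differ. -/
theorem exists_left_edge {k1 k2 c : ℝ} (hk1 : 0 < k1) (hk : k1 < k2) (hc : 0 < c) (hc1 : c < 1) :
    ∃ ρ < 1, ∃ C > 0, ∀ᶠ N : ℕ in atTop, ∀ A B : ℝ, 0 ≤ A → 0 ≤ B →
      c * (|A / k2 - 1| + 1) ≤ |(|A / k2 - 1| - 1)| →
      c * (|A / k2 - 1| + |B / k2 - 1| + 1) ≤ |(B / k2 - 1) - (A / k2 - 1)| →
      HasLeftEdgeState k1 k2 ρ C N A B := by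
  have hk2 := hk1.trans hk
  have hκ := div_pos hk1 hk2
  have hκ1 := (div_lt_one hk2).mpr hk
  obtain ⟨C₁, hC₁, h₁⟩ := hasLeftEdgeState_gap hk1 hk hc hc1
  obtain ⟨C₂, hC₂, h₂⟩ := hasLeftEdgeState_outer hk1 hk hc hc1
  have hpos := one_sub_sq_mul_pos (κ := k1 / k2) (r := 1 - c / 2) hκ1 (by linarith) (by linarith)
  refine ⟨1 - (1 - k1 / k2) * (1 - (1 - c / 2) ^ 2) / 3, by linarith, C₁ + C₂, by positivity, ?_⟩
  filter_upwards [h₁, h₂] with N h₁ h₂ A B hA hB hα hβ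
  rcases away_cases hc (neg_one_le_div_sub_one hA hk2) hα with h | h
  · exact (h₁ A B hA hB h hβ).mono hκ (by linarith)
  · exact (h₂ A B hA hB h hβ).mono hκ (by linarith)

/-! ### The characteristic equation near the band edges. -/

/-- Powers of `a` and `1 / a` cease to be independent at `a = ±1`. Geometric sums, which are
Chebyshev polynomials up to powers of `a`, solve the recursion there as well. -/
theorem three_term_solution {a : ℝ} {N : ℕ} {y : ℕ → ℝ}
    (h : ∀ m, m + 2 ≤ N → a * y (m + 2) = (1 + a ^ 2) * y (m + 1) - a * y m) :
    ∀ m, m + 1 ≤ N → a ^ m * y (m + 1) = (∑ i ∈ Finset.range (m + 1), (a ^ 2) ^ i) * y 1 -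
      a * (∑ i ∈ Finset.range m, (a ^ 2) ^ i) * y 0 := by
  intro m
  induction m using Nat.twoStepInduction with
  | zero => intro _; simp
  | one =>
    intro h1
    have := h 0 h1
    simp only [Finset.sum_range_succ, Finset.sum_range_zero]
    linear_combination this
  | more m ih1 ih2 =>
    intro h1
    have e := h (m + 1) h1
    have e1 := ih1 (by omega)
    have e2 := ih2 (by omega)
    simp only [Finset.sum_range_succ] at e1 e2 ⊢
    linear_combination a ^ (m + 1) * e + (1 + a ^ 2) * e2 - a ^ 2 * e1

/-- This is Cayley–Hamilton for the transfer matrix, with determinant `1` and trace `a + 1 / a`. -/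
theorem CellEquations.three_term {κ α β x a : ℝ} {N : ℕ} {u : ℕ → ℝ} (hκ : κ ≠ 0)
    (h : CellEquations κ α β N x u) (hx : a * x ^ 2 = (κ + a) * (κ * a + 1)) {m : ℕ}
    (hm : m + 2 ≤ N) :
    a * u (2 * (m + 2) + 1) = (1 + a ^ 2) * u (2 * (m + 1) + 1) - a * u (2 * m + 1) ∧
      a * u (2 * (m + 2) + 2) = (1 + a ^ 2) * u (2 * (m + 1) + 2) - a * u (2 * m + 2) := by
  have e1 := h.even m (by omega)
  have o1 := h.odd m (by omega)
  have e2 := h.even (m + 1) (by omega)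
  have o2 := h.odd (m + 1) (by omega)
  simp only [show 2 * (m + 2) + 1 = 2 * m + 5 by ring, show 2 * (m + 1) + 1 = 2 * m + 3 by ring,
    show 2 * (m + 2) + 2 = 2 * m + 6 by ring, show 2 * (m + 1) + 2 = 2 * m + 4 by ring,
    show 2 * (m + 1) + 3 = 2 * m + 5 by ring, show 2 * (m + 1) + 4 = 2 * m + 6 by ring] at *
  constructor
  · refine mul_left_cancel₀ hκ ?_
    linear_combination a * κ * e2 - a * x * o1 + a * e1 + u (2 * m + 3) * hx
  · refine mul_left_cancel₀ hκ ?_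
    linear_combination a * o2 - a * x * e2 + κ * a * o1 + u (2 * m + 4) * hx

/-- The characteristic equation of the chain in terms of quotients of Chebyshev polynomials. -/
theorem CellEquations.characteristic {κ α β x a : ℝ} {M : ℕ} {u : ℕ → ℝ} (hκ : κ ≠ 0)
    (h : CellEquations κ α β (M + 1) x u) (hu : u 1 ≠ 0) (ha0 : a ≠ 0) (ha : |a| ≤ 1)
    (hx : a * x ^ 2 = (κ + a) * (κ * a + 1)) :
    ∃ l, |l - a| ≤ 1 / (M + 1) ∧
      (1 - x ^ 2 + l * κ) * (α * β) + (x * (x ^ 2 - κ ^ 2 - 1) - l * κ * x) * (α + β) +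
        (κ ^ 2 * (x ^ 2 - κ ^ 2) - x ^ 2 * (x ^ 2 - κ ^ 2 - 1) - l * κ * (κ ^ 2 - x ^ 2)) = 0 := by
  have hp := three_term_solution (N := M + 1) (y := fun m => u (2 * m + 1))
    (fun m hm => (h.three_term hκ hx hm).1) M le_rfl
  have hq := three_term_solution (N := M + 1) (y := fun m => u (2 * m + 2))
    (fun m hm => (h.three_term hκ hx hm).2) M le_rfl
  have hr := h.right
  have hl := h.left
  have h1 := h.even 0 (by omega)
  have h2 := h.odd 0 (by omega)
  simp only [mul_zero, zero_add, mul_one] at hp hq h1 h2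
  set g := ∑ i ∈ Finset.range (M + 1), (a ^ 2) ^ i with hg
  set g' := ∑ i ∈ Finset.range M, (a ^ 2) ^ i with hg'
  have ha2 : a ^ 2 ≤ 1 := (sq_le_one_iff_abs_le_one a).mpr ha
  have ha2' : 0 < a ^ 2 := by positivity
  have hgg : g = g' + (a ^ 2) ^ M := Finset.sum_range_succ _ _
  have hgM : (M + 1) * (a ^ 2) ^ M ≤ g := by
    have : ∑ i ∈ Finset.range (M + 1), (a ^ 2) ^ M ≤ g := by
      refine Finset.sum_le_sum fun i hi => pow_le_pow_of_le_one ha2'.le ha2 ?_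
      have := Finset.mem_range.mp hi
      omega
    simpa using this
  have hg0 : 0 < g := lt_of_lt_of_le (by positivity) hgM
  -- Since `g = g' + a ^ (2 M)` and each of the `M + 1` terms of `g` is at least `a ^ (2 M)`, this
  -- quotient is within `1 / (M + 1)` of `a`, uniformly up to `|a| = 1`.
  refine ⟨a * g' / g, ?_, ?_⟩
  · have e : a * g' / g - a = -(a * ((a ^ 2) ^ M / g)) := by
      rw [hgg]; rw [hgg] at hg0; field_simp; ring
    rw [e, abs_neg, abs_mul, abs_of_nonneg (show 0 ≤ (a ^ 2) ^ M / g by positivity)]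
    have : (a ^ 2) ^ M / g ≤ 1 / (M + 1) := by
      rw [div_le_div_iff₀ hg0 (by positivity)]
      linarith
    calc |a| * ((a ^ 2) ^ M / g) ≤ 1 * (1 / (M + 1)) := by gcongr
      _ = _ := one_mul _
  · have hR : g * (κ * u 3 + (x - β) * u 4) = a * g' * (κ * u 1 + (x - β) * u 2) := by
      linear_combination a ^ M * hr - κ * hp - (x - β) * hq
    have hR' : κ * u 3 + (x - β) * u 4 = a * g' / g * (κ * u 1 + (x - β) * u 2) := by
      field_simp
      linear_combination hR
    set l := a * g' / g
    refine (mul_eq_zero.mp (?_ : u 1 * _ = 0)).resolve_left hu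
    linear_combination κ ^ 2 * hR' - κ * (x - β) * h2 - (κ ^ 3 - κ * (x - β) * x) * h1 +
      ((x - β) + x * (κ ^ 2 - (x - β) * x) + l * κ * (x - β)) * hl

/-- Here `a (x - (κ τ + 1)) (x + (κ τ + 1)) = κ (a - τ) ^ 2`, so the two factors cannot both exceed
`2 |a - τ|`. -/
theorem near_band_edge {κ x a τ : ℝ} (hκ : 0 < κ) (hκ1 : κ < 1) (hτ : τ ^ 2 = 1)
    (hx : a * x ^ 2 = (κ + a) * (κ * a + 1)) (ha : |a - τ| ≤ 1 / 2) :
    |x - (κ * τ + 1)| ≤ 2 * |a - τ| ∨ |x + (κ * τ + 1)| ≤ 2 * |a - τ| := by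
  have hτ1 : |τ| = 1 := by rw [← sq_abs] at hτ; exact (pow_eq_one_iff_of_nonneg (abs_nonneg τ) two_ne_zero).mp hτ
  have ha' : 1 / 2 ≤ |a| := by
    have := abs_sub_abs_le_abs_sub τ a
    rw [abs_sub_comm] at this
    linarith
  have e : a * ((x - (κ * τ + 1)) * (x + (κ * τ + 1))) = κ * (a - τ) ^ 2 := by
    linear_combination hx - (a * κ ^ 2 + κ) * hτ
  have e2 : |a| * (|x - (κ * τ + 1)| * |x + (κ * τ + 1)|) = κ * |a - τ| ^ 2 := by
    rw [← abs_mul, ← abs_mul, e, abs_mul, abs_of_pos hκ, abs_pow]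
  by_contra! h
  have h1 : (2 * |a - τ|) * (2 * |a - τ|) ≤ |x - (κ * τ + 1)| * |x + (κ * τ + 1)| :=
    mul_le_mul h.1.le h.2.le (by positivity) (abs_nonneg _)
  have h2 : 0 < |x - (κ * τ + 1)| * |x + (κ * τ + 1)| :=
    mul_pos (lt_of_le_of_lt (by positivity) h.1) (lt_of_le_of_lt (by positivity) h.2)
  nlinarith [sq_nonneg (a - τ), sq_abs (a - τ)]

/-- In long chains no state has its decay factor and frequency close to a band edge if both ends are
away from the corresponding threshold. -/
theorem no_state_near_band_edge {κ c s τ : ℝ} (hκ : 0 < κ) (hκ1 : κ < 1) (hc : 0 < c)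
    (hs : s ^ 2 = 1) (hτ : τ ^ 2 = 1) :
    ∃ ε > 0, ∀ᶠ N : ℕ in atTop, ∀ (α β x a : ℝ) (u : ℕ → ℝ), CellEquations κ α β N x u → u 1 ≠ 0 →
      a ≠ 0 → |a| ≤ 1 → a * x ^ 2 = (κ + a) * (κ * a + 1) → c * (1 + |α|) ≤ |α - s| →
      c * (1 + |β|) ≤ |β - s| → |a - τ| < ε → |x - s * (κ * τ + 1)| < ε → False := by
  set x₀ := s * (κ * τ + 1) with hx₀
  -- The `Qᵢ` are the coefficients of `κ (κ + τ)(α - s)(β - s)` plus those of the characteristic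
  -- equation. They vanish at the band edge `(x₀, τ)` and hence are small nearby, while the product
  -- is bounded below relative to `(1 + |α|)(1 + |β|)`.
  set Q₁ : ℝ × ℝ → ℝ := fun v => 1 - v.1 ^ 2 + v.2 * κ + κ * (κ + τ)
  set Q₂ : ℝ × ℝ → ℝ := fun v => v.1 * (v.1 ^ 2 - κ ^ 2 - 1) - v.2 * κ * v.1 - κ * (κ + τ) * s
  set Q₃ : ℝ × ℝ → ℝ := fun v => κ ^ 2 * (v.1 ^ 2 - κ ^ 2) - v.1 ^ 2 * (v.1 ^ 2 - κ ^ 2 - 1) -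
    v.2 * κ * (κ ^ 2 - v.1 ^ 2) + κ * (κ + τ)
  have hx2 : x₀ ^ 2 = κ ^ 2 + 1 + 2 * κ * τ := by
    rw [hx₀]; linear_combination (κ * τ + 1) ^ 2 * hs + κ ^ 2 * hτ
  have hκτ : 1 - κ ≤ |κ + τ| := by
    have hτ1 : |τ| = 1 := by
      rw [← sq_abs] at hτ; exact (pow_eq_one_iff_of_nonneg (abs_nonneg τ) two_ne_zero).mp hτ
    have := abs_sub_abs_le_abs_sub τ (-κ)
    rw [abs_neg, abs_of_pos hκ, hτ1, sub_neg_eq_add, add_comm τ] at this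
    exact this
  have z1 : Q₁ (x₀, τ) = 0 := by
    simp only [Q₁]; linear_combination -hx2
  have z2 : Q₂ (x₀, τ) = 0 := by
    simp only [Q₂]; linear_combination x₀ * hx2 + κ * τ * hx₀ + κ ^ 2 * s * hτ
  have z3 : Q₃ (x₀, τ) = 0 := by
    simp only [Q₃, hx2]; linear_combination (-2 * κ ^ 2) * hτ
  set η := κ * (1 - κ) * c ^ 2 with hη
  have hη0 : 0 < η := by
    have : 0 < 1 - κ := by linarith
    positivity
  have hcont : Continuous fun v => |Q₁ v| + |Q₂ v| + |Q₃ v| := by fun_prop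
  have hev : ∀ᶠ v in 𝓝 (x₀, τ), |Q₁ v| + |Q₂ v| + |Q₃ v| < η := by
    refine hcont.continuousAt.eventually_lt continuousAt_const ?_
    simpa [z1, z2, z3] using hη0
  obtain ⟨δ, hδ, hball⟩ := Metric.eventually_nhds_iff.mp hev
  refine ⟨δ / 2, half_pos hδ, ?_⟩
  have hlim : Tendsto (fun n : ℕ => 1 / ((n : ℝ) + 1)) atTop (𝓝 0) :=
    tendsto_one_div_add_atTop_nhds_zero_nat
  have hlim' := (tendsto_sub_atTop_nat 1).eventually (hlim.eventually_lt_const (half_pos hδ))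
  filter_upwards [hlim', eventually_ge_atTop 1] with N hN hN1
  intro α β x a u hcell hu ha0 ha hx hα hβ haτ hxs
  obtain ⟨M, rfl⟩ : ∃ M, N = M + 1 := ⟨N - 1, by omega⟩
  obtain ⟨l, hla, hl⟩ := hcell.characteristic hκ.ne' hu ha0 ha hx
  rw [Nat.add_sub_cancel] at hN
  have hlτ : |l - τ| < δ := by
    have := abs_sub_le l a τ
    linarith
  have hQ := hball (y := (x, l)) (by
    rw [Prod.dist_eq, max_lt_iff, Real.dist_eq, Real.dist_eq]
    exact ⟨by linarith, hlτ⟩)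
  have e : κ * (κ + τ) * ((α - s) * (β - s)) =
      Q₁ (x, l) * (α * β) + Q₂ (x, l) * (α + β) + Q₃ (x, l) := by
    simp only [Q₁, Q₂, Q₃]
    linear_combination κ * (κ + τ) * hs - hl
  have hlow : η * ((1 + |α|) * (1 + |β|)) ≤ |κ * (κ + τ) * ((α - s) * (β - s))| := by
    rw [abs_mul, abs_mul, abs_mul, abs_of_pos hκ, hη]
    calc κ * (1 - κ) * c ^ 2 * ((1 + |α|) * (1 + |β|))
        = κ * (1 - κ) * ((c * (1 + |α|)) * (c * (1 + |β|))) := by ring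
      _ ≤ κ * |κ + τ| * (|α - s| * |β - s|) := by gcongr
  have hup : |Q₁ (x, l) * (α * β) + Q₂ (x, l) * (α + β) + Q₃ (x, l)| ≤
      (|Q₁ (x, l)| + |Q₂ (x, l)| + |Q₃ (x, l)|) * ((1 + |α|) * (1 + |β|)) := by
    refine (abs_add_three _ _ _).trans ?_
    rw [abs_mul, abs_mul, abs_mul]
    have h1 := abs_nonneg α
    have h2 := abs_nonneg β
    have h3 := mul_nonneg h1 h2
    have h4 := abs_add_le α β
    rw [add_mul, add_mul]
    have i1 : |α| * |β| ≤ (1 + |α|) * (1 + |β|) := by linarith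
    have i2 : |α + β| ≤ (1 + |α|) * (1 + |β|) := by linarith
    have i3 : 1 ≤ (1 + |α|) * (1 + |β|) := by linarith
    gcongr
    exact le_mul_of_one_le_right (abs_nonneg _) i3
  rw [e] at hlow
  have hpos : 0 < (1 + |α|) * (1 + |β|) := by positivity
  have := mul_lt_mul_of_pos_right hQ hpos
  linarith

/-! ### States localized at both edges. -/

theorem exists_two_zeros {g : ℝ → ℝ} {l z r : ℝ} (hlz : l ≤ z) (hzr : z ≤ r)
    (hg : ContinuousOn g (Set.Icc l r)) (hl : 0 < g l) (hz : g z < 0) (hr : 0 < g r) :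
    ∃ s t, s < t ∧ s ∈ Set.Ioc l r ∧ t ∈ Set.Ioc l r ∧ g s = 0 ∧ g t = 0 := by
  obtain ⟨s, hs, hs0⟩ := intermediate_value_Icc' hlz (hg.mono (Set.Icc_subset_Icc_right hzr))
    ⟨hz.le, hl.le⟩
  obtain ⟨t, ht, ht0⟩ := intermediate_value_Icc hzr (hg.mono (Set.Icc_subset_Icc_left hlz))
    ⟨hz.le, hr.le⟩
  have hsz : s ≠ z := by rintro rfl; linarith
  have hsl : s ≠ l := by rintro rfl; linarith
  have htz : t ≠ z := by rintro rfl; linarith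
  have h1 := lt_of_le_of_ne hs.2 hsz
  have h2 := lt_of_le_of_ne ht.1 htz.symm
  have h3 := lt_of_le_of_ne hs.1 hsl.symm
  exact ⟨s, t, h1.trans h2, ⟨h3, by linarith⟩, ⟨by linarith, ht.2⟩, hs0, ht0⟩

theorem one_sub_mul_ge {x y r : ℝ} (hx : |x| ≤ r) (hy : |y| ≤ r) : 1 - r ^ 2 ≤ 1 - x * y := by
  have h1 : |x * y| ≤ r ^ 2 := by
    rw [abs_mul, sq]
    exact mul_le_mul hx hy (abs_nonneg _) ((abs_nonneg _).trans hx)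
  linarith [(abs_le.mp h1).2]

theorem one_sub_mul_le {x y : ℝ} (hx : |x| ≤ 1) (hy : |y| ≤ 1) : 1 - x * y ≤ 2 := by
  have h1 : |x * y| ≤ 1 := by
    rw [abs_mul]
    exact mul_le_one₀ hx (abs_nonneg _) hy
  linarith [(abs_le.mp h1).1]

/-- At `z` the left side vanishes and the right side is positive; at the ends of the interval the
left side dominates. The alternative `l = 0` is for states above the bands, where the parameter is
positive and `f` vanishes at `0`. -/
theorem exists_two_roots {c ρ : ℝ} (hc : 0 < c) (hc1 : c < 1) (hρ : 0 ≤ ρ) (hρ1 : ρ < 1) :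
    ∀ᶠ n : ℕ in atTop, ∀ (z w l : ℝ) (f : ℝ → ℝ), |z| ≤ 1 - c / 2 → |w| ≤ 1 - c / 2 →
      (l = -(1 - c / 4) ∨ (l = 0 ∧ 0 < z ∧ 0 < w ∧ f 0 = 0)) →
      ContinuousOn f (Set.Icc l (1 - c / 4)) → (∀ s, |s| ≤ 1 - c / 4 → |f s| ≤ ρ) → f z ≠ 0 →
      ∃ s t, s < t ∧ s ∈ Set.Ioc l (1 - c / 4) ∧ t ∈ Set.Ioc l (1 - c / 4) ∧
        (s - z) * (s - w) = f s ^ (2 * n) * ((1 - z * s) * (1 - w * s)) ∧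
        (t - z) * (t - w) = f t ^ (2 * n) * ((1 - z * t) * (1 - w * t)) := by
  have hlim := (tendsto_pow_atTop_nhds_zero_of_lt_one hρ hρ1).eventually_lt_const
    (show 0 < c ^ 2 / 64 by positivity)
  filter_upwards [hlim, eventually_ge_atTop 1] with n hn hn1
  intro z w l f hz hw hl hf hfρ hfz
  have hz' := abs_le.mp hz
  have hw' := abs_le.mp hw
  have hsmall : ∀ s, |s| ≤ 1 - c / 4 → f s ^ (2 * n) * ((1 - z * s) * (1 - w * s)) < c ^ 2 / 16 := by
    intro s hs
    have h1 : f s ^ (2 * n) ≤ ρ ^ n := by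
      rw [← Even.pow_abs ⟨n, by ring⟩]
      calc |f s| ^ (2 * n) ≤ ρ ^ (2 * n) := by gcongr; exact hfρ s hs
        _ ≤ ρ ^ n := pow_le_pow_of_le_one hρ hρ1.le (by omega)
    have h2 := one_sub_mul_le (hz.trans (by linarith)) (hs.trans (by linarith))
    have h3 := one_sub_mul_le (hw.trans (by linarith)) (hs.trans (by linarith))
    have h2' : 0 ≤ 1 - w * s := by
      have := one_sub_mul_ge (hw.trans (show _ ≤ (1:ℝ) by linarith)) (hs.trans (show _ ≤ (1:ℝ) by linarith))
      linarith
    have h3' : 0 ≤ 1 - z * s := by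
      have := one_sub_mul_ge (hz.trans (show _ ≤ (1:ℝ) by linarith)) (hs.trans (show _ ≤ (1:ℝ) by linarith))
      linarith
    have h4 : 0 ≤ f s ^ (2 * n) := Even.pow_nonneg ⟨n, by ring⟩ _
    calc f s ^ (2 * n) * ((1 - z * s) * (1 - w * s)) ≤ ρ ^ n * (2 * 2) := by gcongr
      _ < c ^ 2 / 16 := by linarith
  set g : ℝ → ℝ := fun s => (s - z) * (s - w) - f s ^ (2 * n) * ((1 - z * s) * (1 - w * s)) with hg
  have hlz : l ≤ z := by rcases hl with rfl | ⟨rfl, h, -⟩ <;> linarith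
  have hgl : 0 < g l := by
    rcases hl with rfl | ⟨rfl, h1, h2, h3⟩
    · have h1 := hsmall (-(1 - c / 4)) (by rw [abs_neg, abs_of_pos (by linarith)])
      have h2 : c / 4 * (c / 4) ≤ (z - -(1 - c / 4)) * (w - -(1 - c / 4)) :=
        mul_le_mul (by linarith) (by linarith) (by linarith) (by linarith)
      simp only [hg]
      linarith
    · simp only [hg, h3]
      rw [zero_pow (by omega)]
      have := mul_pos h1 h2
      linarith
  have hgr : 0 < g (1 - c / 4) := by
    have h1 := hsmall (1 - c / 4) (by rw [abs_of_pos (by linarith)])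
    have h2 : c / 4 * (c / 4) ≤ (1 - c / 4 - z) * (1 - c / 4 - w) :=
      mul_le_mul (by linarith) (by linarith) (by linarith) (by linarith)
    simp only [hg]
    linarith
  have hr2 : 0 < 1 - (1 - c / 2) ^ 2 := by nlinarith
  have hgz : g z < 0 := by
    simp only [hg, sub_self, zero_mul, zero_sub, neg_lt_zero]
    have h1 := one_sub_mul_ge hz hz
    have h2 := one_sub_mul_ge hw hz
    have h3 : 0 < f z ^ (2 * n) := Even.pow_pos ⟨n, by ring⟩ hfz
    exact mul_pos h3 (mul_pos (by linarith) (by linarith))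
  obtain ⟨s, t, hst, hs, ht, hs0, ht0⟩ := exists_two_zeros hlz (by linarith)
    (show ContinuousOn g (Set.Icc l (1 - c / 4)) by fun_prop) hgl hgz hgr
  exact ⟨s, t, hst, hs, ht, sub_eq_zero.mp hs0, sub_eq_zero.mp ht0⟩

/-- The hypothesis says that the Möbius quotients of `s` at `z` and at `w` have product `F`. For `w`
close to `z` they nearly coincide, so the square of one is `F` up to `O(|w - z|)`. -/
theorem sq_mobius_le {s z w r F : ℝ} (hs : |s| ≤ r) (hz : |z| ≤ r) (hw : |w| ≤ r) (hr : r < 1)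
    (h : (s - z) * (s - w) = F * ((1 - z * s) * (1 - w * s))) :
    ((s - z) / (1 - z * s)) ^ 2 ≤ F + 2 / (1 - r ^ 2) ^ 3 * |w - z| := by
  have hr0 : 0 ≤ r := (abs_nonneg s).trans hs
  have hr2 : 0 < 1 - r ^ 2 := by nlinarith
  have hz1 := one_sub_mul_ge hz hs
  have hw1 := one_sub_mul_ge hw hs
  have hz2 : 0 < 1 - z * s := by linarith
  have hw2 : 0 < 1 - w * s := by linarith
  have e : ((s - z) / (1 - z * s)) ^ 2 =
      F + (s - z) * ((w - z) * (1 - s ^ 2)) / ((1 - z * s) ^ 2 * (1 - w * s)) := by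
    obtain ⟨D, hD⟩ : ∃ D, D = 1 - z * s := ⟨_, rfl⟩
    obtain ⟨E, hE⟩ : ∃ E, E = 1 - w * s := ⟨_, rfl⟩
    rw [← hD, ← hE] at h ⊢
    have hD0 : D ≠ 0 := by rw [hD]; exact hz2.ne'
    have hE0 : E ≠ 0 := by rw [hE]; exact hw2.ne'
    field_simp
    rw [hE, hD] at h ⊢
    linear_combination (1 - z * s) * h
  have b : |(s - z) * ((w - z) * (1 - s ^ 2)) / ((1 - z * s) ^ 2 * (1 - w * s))| ≤
      2 / (1 - r ^ 2) ^ 3 * |w - z| := by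
    rw [abs_div, abs_of_pos (show 0 < (1 - z * s) ^ 2 * (1 - w * s) by positivity), abs_mul, abs_mul,
      div_mul_eq_mul_div]
    have h1 : |s - z| ≤ 2 := (abs_sub _ _).trans (by linarith)
    have h2 : |1 - s ^ 2| ≤ 1 := by
      rw [abs_le]
      have := sq_lt_one_of_abs_le hs hr
      constructor <;> linarith [sq_nonneg s]
    have h3 : (1 - r ^ 2) ^ 3 ≤ (1 - z * s) ^ 2 * (1 - w * s) := by
      rw [pow_succ]
      gcongr
    refine div_le_div₀ (by positivity) ?_ (by positivity) h3
    calc |s - z| * (|w - z| * |1 - s ^ 2|) ≤ 2 * (|w - z| * 1) := by gcongr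
      _ = _ := by ring
  rw [e]
  linarith [le_abs_self ((s - z) * ((w - z) * (1 - s ^ 2)) / ((1 - z * s) ^ 2 * (1 - w * s)))]

/-- A state with `|a| ≤ ρ` both ends of which are localized up to the error `e`. -/
def IsTwoSidedState (k1 k2 A B ρ e : ℝ) (N : ℕ) (ω : ℝ) (u : ℕ → ℝ) (a c₁ c₂ : ℝ) : Prop :=
  IsState k1 k2 A B (N + 1) ω u a c₁ c₂ ∧ |a| ≤ ρ ∧ a ≠ 0 ∧ c₁ ≠ 0 ∧ c₂ ≠ 0 ∧
    (a * (c₂ / c₁)) ^ 2 ≤ e ∧ (a ^ (2 * (N + 1)) * (c₁ / (a * c₂))) ^ 2 ≤ e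

/-- The Möbius quotient at `z` is `a c₂ / c₁`, and the one at `w` is its counterpart for the mirror
image. -/
theorem isTwoSidedState_of_mobius {k1 k2 A B ρ e ω a c₁ c₂ s z w r C : ℝ} {N : ℕ} {u : ℕ → ℝ}
    (hst : IsState k1 k2 A B (N + 1) ω u a c₁ c₂) (haρ : |a| ≤ ρ) (ha0 : a ≠ 0)
    (hs : |s| ≤ r) (hz : |z| ≤ r) (hw : |w| ≤ r) (hr : r < 1)
    (hc1 : c₁ ≠ 0) (hc : a * c₂ * (1 - z * s) = c₁ * (s - z))
    (h : (s - z) * (s - w) = a ^ (2 * (N + 1)) * ((1 - z * s) * (1 - w * s)))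
    (hC : 2 / (1 - r ^ 2) ^ 3 * |w - z| ≤ C) (he : ρ ^ (2 * (N + 1)) + C ≤ e) :
    IsTwoSidedState k1 k2 A B ρ e N ω u a c₁ c₂ := by
  have hr0 : 0 ≤ r := (abs_nonneg s).trans hs
  have hr2 : 0 < 1 - r ^ 2 := by nlinarith
  have hz2 : 0 < 1 - z * s := by linarith [one_sub_mul_ge hz hs]
  have hw2 : 0 < 1 - w * s := by linarith [one_sub_mul_ge hw hs]
  have hF : 0 < a ^ (2 * (N + 1)) := Even.pow_pos ⟨N + 1, by ring⟩ ha0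
  have hFρ : a ^ (2 * (N + 1)) ≤ ρ ^ (2 * (N + 1)) := by
    rw [← Even.pow_abs ⟨N + 1, by ring⟩]
    gcongr
  have hne : (s - z) * (s - w) ≠ 0 := by rw [h]; positivity
  have hsz : s - z ≠ 0 := left_ne_zero_of_mul hne
  have hc2 : c₂ ≠ 0 := by
    rintro rfl
    rw [mul_zero, zero_mul] at hc
    exact mul_ne_zero hc1 hsz hc.symm
  have m1 := sq_mobius_le hs hz hw hr h
  have m2 := sq_mobius_le (w := z) hs hw hz hr (F := a ^ (2 * (N + 1))) (by linear_combination h)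
  rw [abs_sub_comm] at m2
  refine ⟨hst, haρ, ha0, hc1, hc2, ?_, ?_⟩
  · rw [show a * (c₂ / c₁) = (s - z) / (1 - z * s) by
      rw [← mul_div_assoc, div_eq_div_iff hc1 hz2.ne']; linear_combination hc]
    linarith
  · have : a ^ (2 * (N + 1)) * (c₁ / (a * c₂)) = (s - w) / (1 - w * s) := by
      rw [← mul_div_assoc, div_eq_div_iff (mul_ne_zero ha0 hc2) hw2.ne']
      refine mul_left_cancel₀ (mul_ne_zero hsz hz2.ne') ?_
      linear_combination (-(c₁ * (s - z))) * h - (s - z) * (s - w) * hc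
    rw [this]
    linarith

/-- Existence of two states localized at both ends, with the constants `ρ` and `C` in the
estimates. -/
def HasTwoSidedStates (k1 k2 ρ C : ℝ) (N : ℕ) (A B : ℝ) : Prop :=
  ∃ (ω a c₁ c₂ : Fin 2 → ℝ) (u : Fin 2 → ℕ → ℝ), (∀ i, IsTwoSidedState k1 k2 A B ρ
    (ρ ^ (2 * (N + 1)) + C * (|(B / k2 - 1) - (A / k2 - 1)| / (1 + |A / k2 - 1|))) N
      (ω i) (u i) (a i) (c₁ i) (c₂ i)) ∧ ω 0 ^ 2 ≠ ω 1 ^ 2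

/-- Equal frequencies would give equal `a` and equal `x`, and these two determine the parameter. -/
theorem hasTwoSidedStates_of_pair {k1 k2 ρ C A B : ℝ} {N : ℕ} (hk1 : 0 < k1) (hk : k1 < k2)
    {s : Fin 2 → ℝ} {f X : ℝ → ℝ} {c₁ c₂ : Fin 2 → ℝ} (hs : s 0 ≠ s 1)
    (hX : ∀ i j, f (s i) = f (s j) → X (s i) = X (s j) → s i = s j)
    (h : ∀ i, ∃ ω u, IsTwoSidedState k1 k2 A B ρ
      (ρ ^ (2 * (N + 1)) + C * (|(B / k2 - 1) - (A / k2 - 1)| / (1 + |A / k2 - 1|))) N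
        ω u (f (s i)) (c₁ i) (c₂ i) ∧ ω ^ 2 / k2 - k1 / k2 - 1 = X (s i)) :
    HasTwoSidedStates k1 k2 ρ C N A B := by
  choose ω u h hω using h
  refine ⟨ω, fun i => f (s i), c₁, c₂, u, h, fun he => hs (hX 0 1 ?_ ?_)⟩
  · exact (h 0).1.2.1.eq_of_sq_eq hk1 hk (h 1).1.2.1 he
  · rw [← hω, ← hω, he]

theorem hasTwoSidedStates_gap {k1 k2 c : ℝ} (hk1 : 0 < k1) (hk : k1 < k2) (hc : 0 < c)
    (hc1 : c < 1) :
    ∀ᶠ N : ℕ in atTop, ∀ A B : ℝ, 0 ≤ A → 0 ≤ B → |A / k2 - 1| ≤ 1 - c →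
      |(B / k2 - 1) - (A / k2 - 1)| ≤ c / 4 * (1 + |A / k2 - 1|) →
      HasTwoSidedStates k1 k2 (1 - (1 - k1 / k2) * (1 - (1 - c / 4) ^ 2) / 3)
        (4 / (1 - (1 - c / 4) ^ 2) ^ 3) N A B := by
  have hk2 := hk1.trans hk
  have hκ := div_pos hk1 hk2
  have hκ1 := (div_lt_one hk2).mpr hk
  have hr1 : 1 - c / 4 < 1 := by linarith
  have hr2 : 0 < 1 - (1 - c / 4) ^ 2 := by nlinarith
  have hpos := one_sub_sq_mul_pos (κ := k1 / k2) (r := 1 - c / 4) hκ1 (by linarith) hr1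
  have hle : (1 - k1 / k2) * (1 - (1 - c / 4) ^ 2) ≤ 1 :=
    mul_le_one₀ (by linarith) hr2.le (by nlinarith)
  filter_upwards [(tendsto_add_atTop_nat 1).eventually (exists_two_roots hc hc1
    (ρ := 1 - (1 - k1 / k2) * (1 - (1 - c / 4) ^ 2) / 3) (by linarith) (by linarith))]
    with N hroot A B hA hB hα hβα
  have hα1 := sq_lt_one_of_abs_le (s := A / k2 - 1) hα (by linarith)
  have hβ : |B / k2 - 1| ≤ 1 - c / 2 := by
    have h1 := abs_sub_abs_le_abs_sub (B / k2 - 1) (A / k2 - 1)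
    have h2 : c / 4 * (1 + |A / k2 - 1|) ≤ c / 4 * 2 := by gcongr; linarith
    linarith
  have habs : ∀ s ∈ Set.Icc (-(1 - c / 4)) (1 - c / 4), |s| ≤ 1 - c / 4 :=
    fun s hs => abs_le.mpr hs
  obtain ⟨s, t, hst, hs, ht, hs0, ht0⟩ := hroot (A / k2 - 1) (B / k2 - 1) (-(1 - c / 4))
    (decayModulus (k1 / k2)) (by linarith) hβ (Or.inl rfl)
    (continuousOn_decayModulus.mono fun s hs => sq_lt_one_of_abs_le (habs s hs) hr1)
    (fun s hs => by
      rw [abs_of_pos (decayModulus_pos hκ (sq_lt_one_of_abs_le hs hr1))]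
      exact decayModulus_le_of_abs_le hκ hκ1 hs hr1) (decayModulus_pos hκ hα1).ne'
  refine hasTwoSidedStates_of_pair hk1 hk (s := ![s, t]) (f := fun s => -decayModulus (k1 / k2) s)
    (X := fun s => s * (k1 / k2 * -decayModulus (k1 / k2) s + 1))
    (c₁ := fun i => -decayModulus (k1 / k2) (![s, t] i) * (1 - (A / k2 - 1) * ![s, t] i))
    (c₂ := fun i => ![s, t] i - (A / k2 - 1)) (by simpa using hst.ne) ?_ ?_
  · have hmem : ∀ i, |![s, t] i| ≤ 1 - c / 4 := by
      rw [Fin.forall_fin_two]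
      exact ⟨habs s ⟨hs.1.le, hs.2⟩, habs t ⟨ht.1.le, ht.2⟩⟩
    intro i j hf hX
    have hsq := sq_lt_one_of_abs_le (hmem j) hr1
    have hb := decayModulus_lt_one hκ hκ1 hsq
    have hb0 := decayModulus_pos hκ hsq
    rw [hf] at hX
    refine mul_right_cancel₀ (ne_of_gt ?_) hX
    nlinarith
  · have main : ∀ x, x ∈ Set.Ioc (-(1 - c / 4)) (1 - c / 4) →
        (x - (A / k2 - 1)) * (x - (B / k2 - 1)) = decayModulus (k1 / k2) x ^ (2 * (N + 1)) *
          ((1 - (A / k2 - 1) * x) * (1 - (B / k2 - 1) * x)) →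
        ∃ ω u, IsTwoSidedState k1 k2 A B (1 - (1 - k1 / k2) * (1 - (1 - c / 4) ^ 2) / 3)
          ((1 - (1 - k1 / k2) * (1 - (1 - c / 4) ^ 2) / 3) ^ (2 * (N + 1)) +
            4 / (1 - (1 - c / 4) ^ 2) ^ 3 *
            (|(B / k2 - 1) - (A / k2 - 1)| / (1 + |A / k2 - 1|))) N
          ω u (-decayModulus (k1 / k2) x)
          (-decayModulus (k1 / k2) x * (1 - (A / k2 - 1) * x)) (x - (A / k2 - 1)) ∧
        ω ^ 2 / k2 - k1 / k2 - 1 = x * (k1 / k2 * -decayModulus (k1 / k2) x + 1) := by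
      intro x hx hx0
      have hxr := habs x ⟨hx.1.le, hx.2⟩
      have hx1 := sq_lt_one_of_abs_le hxr hr1
      have hb := decayModulus_pos hκ hx1
      have hαr : |A / k2 - 1| ≤ 1 - c / 4 := by linarith
      have hαx : 0 < 1 - (A / k2 - 1) * x := by linarith [one_sub_mul_ge hαr hxr]
      obtain ⟨ω, u, h, hω⟩ := exists_isState_gap hk1 hk hA hB hx1 hx0
      refine ⟨ω, u, isTwoSidedState_of_mobius (s := x) (z := A / k2 - 1) (w := B / k2 - 1)
        (r := 1 - c / 4) h ?_ (neg_ne_zero.mpr hb.ne') hxr hαr (by linarith) hr1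
        (mul_ne_zero (neg_ne_zero.mpr hb.ne') hαx.ne') (by ring) ?_ ?_ le_rfl, hω⟩
      · rw [abs_neg, abs_of_pos hb]
        exact decayModulus_le_of_abs_le hκ hκ1 hxr hr1
      · rw [Even.neg_pow ⟨N + 1, by ring⟩]
        exact hx0
      · rw [div_mul_div_comm, div_mul_eq_mul_div]
        rw [div_le_div_iff₀ (by positivity) (by positivity)]
        have h1 : 1 + |A / k2 - 1| ≤ 2 := by linarith
        have h2 : 0 ≤ |B / k2 - 1 - (A / k2 - 1)| * (1 - (1 - c / 4) ^ 2) ^ 3 := by positivity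
        nlinarith [mul_le_mul_of_nonneg_left h1 h2]
    rw [Fin.forall_fin_two]
    exact ⟨main s hs hs0, main t ht ht0⟩

theorem hasTwoSidedStates_outer {k1 k2 c : ℝ} (hk1 : 0 < k1) (hk : k1 < k2) (hc : 0 < c)
    (hc1 : c < 1) :
    ∀ᶠ N : ℕ in atTop, ∀ A B : ℝ, 0 ≤ A → 0 ≤ B → 0 < A / k2 - 1 ∧ (A / k2 - 1)⁻¹ ≤ 1 - c →
      |(B / k2 - 1) - (A / k2 - 1)| ≤ c / 4 * (1 + |A / k2 - 1|) →
      HasTwoSidedStates k1 k2 (1 - (1 - k1 / k2) * (1 - (1 - c / 4) ^ 2) / 3)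
        (4 / (1 - (1 - c / 4) ^ 2) ^ 3) N A B := by
  have hk2 := hk1.trans hk
  have hκ := div_pos hk1 hk2
  have hκ1 := (div_lt_one hk2).mpr hk
  have hr1 : 1 - c / 4 < 1 := by linarith
  have hr2 : 0 < 1 - (1 - c / 4) ^ 2 := by nlinarith
  have hpos := one_sub_sq_mul_pos (κ := k1 / k2) (r := 1 - c / 4) hκ1 (by linarith) hr1
  have hle : (1 - k1 / k2) * (1 - (1 - c / 4) ^ 2) ≤ 1 :=
    mul_le_one₀ (by linarith) hr2.le (by nlinarith)
  filter_upwards [(tendsto_add_atTop_nat 1).eventually (exists_two_roots hc hc1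
    (ρ := 1 - (1 - k1 / k2) * (1 - (1 - c / 4) ^ 2) / 3) (by linarith) (by linarith))]
    with N hroot A B hA hB hα hβα
  have hstate := fun t => @exists_isState_outer k1 k2 A B hk1 hk hA hB N t
  have hpair := fun s f X c₁ c₂ => @hasTwoSidedStates_of_pair k1 k2
    (1 - (1 - k1 / k2) * (1 - (1 - c / 4) ^ 2) / 3) (4 / (1 - (1 - c / 4) ^ 2) ^ 3) A B N hk1 hk
    s f X c₁ c₂
  generalize A / k2 - 1 = α at *
  generalize B / k2 - 1 = β at *
  generalize k1 / k2 = κ at *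
  obtain ⟨hα0, hαc⟩ := hα
  have hα1 : 1 ≤ α := by
    by_contra! h
    have := (one_lt_inv₀ hα0).mpr h
    linarith
  rw [abs_of_pos hα0] at hβα hpair
  have hβ' := abs_le.mp hβα
  have hβ : (1 - c / 2) * α ≤ β := by nlinarith
  have hβ0 : 0 < β := lt_of_lt_of_le (by apply mul_pos <;> linarith) hβ
  have hαc' : 1 ≤ (1 - c) * α := by rwa [inv_le_iff_one_le_mul₀ hα0] at hαc
  have hβc : 1 ≤ (1 - c / 2) * β := by nlinarith [mul_le_mul_of_nonneg_left hβ (by linarith : 0 ≤ 1 - c / 2)]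
  have hβinv : β⁻¹ ≤ 1 - c / 2 := by rwa [inv_le_iff_one_le_mul₀ hβ0]
  have hα0' := inv_pos.mpr hα0
  have hβ0' := inv_pos.mpr hβ0
  have hz1 := sq_lt_one_of_abs_le (s := α⁻¹) (abs_of_pos hα0').le (by linarith)
  have habs : ∀ s ∈ Set.Icc 0 (1 - c / 4), |s| ≤ 1 - c / 4 := fun s hs => by
    rw [abs_of_nonneg hs.1]
    exact hs.2
  have hf0 : ∀ s, s ^ 2 < 1 → 0 ≤ s ^ 2 * decayModulus κ s := fun s hs => by
    have := decayModulus_pos hκ hs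
    positivity
  have hfρ : ∀ s, |s| ≤ 1 - c / 4 →
      s ^ 2 * decayModulus κ s ≤ 1 - (1 - κ) * (1 - (1 - c / 4) ^ 2) / 3 := fun s hs => by
    have hs1 := sq_lt_one_of_abs_le hs hr1
    exact (mul_le_of_le_one_left (decayModulus_pos hκ hs1).le hs1.le).trans
      (decayModulus_le_of_abs_le hκ hκ1 hs hr1)
  -- In the chart `S = 1` the inverses of `α` and `β` play the part of the end parameters.
  obtain ⟨s, t, hst, hs, ht, hs0, ht0⟩ := hroot α⁻¹ β⁻¹ 0 (fun s => s ^ 2 * decayModulus κ s)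
    (by rw [abs_of_pos hα0']; linarith) (by rwa [abs_of_pos hβ0'])
    (Or.inr ⟨rfl, hα0', hβ0', by simp⟩)
    (ContinuousOn.mul (by fun_prop)
      (continuousOn_decayModulus.mono fun s hs => sq_lt_one_of_abs_le (habs s hs) hr1))
    (fun s hs => by
      rw [abs_of_nonneg (hf0 s (sq_lt_one_of_abs_le hs hr1))]
      exact hfρ s hs) (mul_pos (by positivity) (decayModulus_pos hκ hz1)).ne'
  refine hpair ![s, t] (fun s => s ^ 2 * decayModulus κ s)
    (fun t => (κ * (t ^ 2 * decayModulus κ t) + 1) / t)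
    (fun i => ![s, t] i ^ 2 * decayModulus κ (![s, t] i) * (![s, t] i - α))
    (fun i => 1 - α * ![s, t] i) (by simpa using hst.ne) ?_ ?_
  · have hmem : ∀ i, ![s, t] i ∈ Set.Ioc 0 (1 - c / 4) := by
      rw [Fin.forall_fin_two]
      exact ⟨hs, ht⟩
    intro i j hf hX
    have h1 := sq_lt_one_of_abs_le (habs _ ⟨(hmem j).1.le, (hmem j).2⟩) hr1
    have h2 := hf0 _ h1
    have h3 : 0 < κ * (![s, t] j ^ 2 * decayModulus κ (![s, t] j)) + 1 := by positivity
    rw [hf, div_eq_div_iff (hmem i).1.ne' (hmem j).1.ne'] at hX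
    exact (mul_left_cancel₀ h3.ne' hX).symm
  · have main : ∀ x, x ∈ Set.Ioc 0 (1 - c / 4) →
        (x - α⁻¹) * (x - β⁻¹) = (x ^ 2 * decayModulus κ x) ^ (2 * (N + 1)) *
          ((1 - α⁻¹ * x) * (1 - β⁻¹ * x)) →
        ∃ ω u, IsTwoSidedState k1 k2 A B (1 - (1 - κ) * (1 - (1 - c / 4) ^ 2) / 3)
          ((1 - (1 - κ) * (1 - (1 - c / 4) ^ 2) / 3) ^ (2 * (N + 1)) +
            4 / (1 - (1 - c / 4) ^ 2) ^ 3 * (|β - α| / (1 + α))) N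
          ω u (x ^ 2 * decayModulus κ x)
          (x ^ 2 * decayModulus κ x * (x - α)) (1 - α * x) ∧
        ω ^ 2 / k2 - κ - 1 = (κ * (x ^ 2 * decayModulus κ x) + 1) / x := by
      intro x hx hx0
      have hxr := habs x ⟨hx.1.le, hx.2⟩
      have hx1 := sq_lt_one_of_abs_le hxr hr1
      have hb := decayModulus_pos hκ hx1
      have hF : 0 < x ^ 2 * decayModulus κ x := mul_pos (pow_pos hx.1 2) hb
      have hαα := mul_inv_cancel₀ hα0.ne'
      have hββ := mul_inv_cancel₀ hβ0.ne'
      have hxα : x - α ≠ 0 := by linarith [hx.2]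
      obtain ⟨ω, u, h, hω⟩ := hstate x hx.1 hx1 (by
        generalize (x ^ 2 * decayModulus κ x) ^ (2 * (N + 1)) = F at hx0 ⊢
        field_simp at hx0
        linear_combination hx0)
      refine ⟨ω, u, isTwoSidedState_of_mobius (s := x) (z := α⁻¹) (w := β⁻¹)
        (r := 1 - c / 4) h ?_ hF.ne' hxr (by rw [abs_of_pos hα0']; linarith)
        (by rw [abs_of_pos hβ0']; linarith) hr1 (mul_ne_zero hF.ne' hxα) ?_ hx0 ?_ le_rfl, hω⟩
      · rw [abs_of_pos hF]
        exact hfρ x hxr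
      · field_simp
        ring
      · have e1 : |β⁻¹ - α⁻¹| = |β - α| / (α * β) := by
          rw [inv_sub_inv hβ0.ne' hα0.ne', abs_div, abs_of_pos (mul_pos hβ0 hα0), abs_sub_comm,
            mul_comm β]
        rw [e1]
        have e2 : 1 + α ≤ 2 * (α * β) := by
          have h1 := mul_le_of_le_one_left hβ0.le (show 1 - c / 2 ≤ 1 by linarith)
          have h2 := mul_le_mul_of_nonneg_left (hβc.trans h1) hα0.le
          linarith
        have e3 : |β - α| / (α * β) ≤ 2 * (|β - α| / (1 + α)) := by
          rw [← mul_div_assoc, div_le_div_iff₀ (by positivity) (by positivity)]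
          linear_combination mul_le_mul_of_nonneg_left e2 (abs_nonneg (β - α))
        calc 2 / (1 - (1 - c / 4) ^ 2) ^ 3 * (|β - α| / (α * β)) ≤
            2 / (1 - (1 - c / 4) ^ 2) ^ 3 * (2 * (|β - α| / (1 + α))) := by gcongr
          _ = _ := by ring
    rw [Fin.forall_fin_two]
    exact ⟨main s hs hs0, main t ht ht0⟩

/-- In long chains with nearly equal ends away from the thresholds there are two states localized
at both ends. -/
theorem exists_two_sided {k1 k2 c : ℝ} (hk1 : 0 < k1) (hk : k1 < k2) (hc : 0 < c) (hc1 : c < 1) :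
    ∃ ρ, 0 ≤ ρ ∧ ρ < 1 ∧ ∃ C, ∀ᶠ N : ℕ in atTop, ∀ A B : ℝ, 0 ≤ A → 0 ≤ B →
      c * (|A / k2 - 1| + 1) ≤ |(|A / k2 - 1| - 1)| →
      |(B / k2 - 1) - (A / k2 - 1)| ≤ c / 4 * (1 + |A / k2 - 1|) →
      HasTwoSidedStates k1 k2 ρ C N A B := by
  have hk2 := hk1.trans hk
  have hκ := div_pos hk1 hk2
  have hκ1 := (div_lt_one hk2).mpr hk
  have hr2 : 0 < 1 - (1 - c / 4) ^ 2 := by nlinarith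
  have hpos := one_sub_sq_mul_pos (κ := k1 / k2) (r := 1 - c / 4) hκ1 (by linarith) (by linarith)
  have hle : (1 - k1 / k2) * (1 - (1 - c / 4) ^ 2) ≤ 1 :=
    mul_le_one₀ (by linarith) hr2.le (by nlinarith)
  refine ⟨1 - (1 - k1 / k2) * (1 - (1 - c / 4) ^ 2) / 3, by linarith, by linarith,
    4 / (1 - (1 - c / 4) ^ 2) ^ 3, ?_⟩
  filter_upwards [hasTwoSidedStates_gap hk1 hk hc hc1, hasTwoSidedStates_outer hk1 hk hc hc1]
    with N h₁ h₂ A B hA hB hα hβ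
  rcases away_cases hc (neg_one_le_div_sub_one hA hk2) hα with h | h
  · exact h₁ A B hA hB h hβ
  · exact h₂ A B hA hB h hβ

/-! ### Number and frequencies of the slow states. -/

theorem abs_abs_sub_one_le {α s : ℝ} (hs : s ^ 2 = 1) : |(|α| - 1)| ≤ |α - s| := by
  have h1 : |s| = 1 := by
    rw [← sq_abs] at hs
    exact (pow_eq_one_iff_of_nonneg (abs_nonneg s) two_ne_zero).mp hs
  rw [← h1]
  exact abs_abs_sub_abs_le_abs_sub α s

theorem eventually_exists_succ {p : ℕ → Prop} (h : ∀ᶠ N in atTop, p N) :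
    ∀ᶠ n in atTop, ∃ N, n = N + 1 ∧ p N := by
  filter_upwards [(tendsto_sub_atTop_nat 1).eventually h, eventually_ge_atTop 1] with n hn hn1
  exact ⟨n - 1, by omega, hn⟩

/-- In long chains there is no state with decay factor close to `± 1` if both ends are away from
the thresholds. -/
theorem no_slow_state {κ c : ℝ} (hκ : 0 < κ) (hκ1 : κ < 1) (hc : 0 < c) :
    ∃ ε > 0, ∀ᶠ N : ℕ in atTop, ∀ (α β x a : ℝ) (u : ℕ → ℝ), CellEquations κ α β N x u → u 1 ≠ 0 →
      a ≠ 0 → |a| ≤ 1 → a * x ^ 2 = (κ + a) * (κ * a + 1) → c * (1 + |α|) ≤ |(|α| - 1)| →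
      c * (1 + |β|) ≤ |(|β| - 1)| → 1 - ε < |a| → False := by
  -- There are four band edges, one for each choice of the signs of `a` and of `x`.
  have key := fun s τ hs hτ => no_state_near_band_edge (s := s) (τ := τ) hκ hκ1 hc hs hτ
  obtain ⟨e1, he1, h1⟩ := key 1 1 (by norm_num) (by norm_num)
  obtain ⟨e2, he2, h2⟩ := key 1 (-1) (by norm_num) (by norm_num)
  obtain ⟨e3, he3, h3⟩ := key (-1) 1 (by norm_num) (by norm_num)
  obtain ⟨e4, he4, h4⟩ := key (-1) (-1) (by norm_num) (by norm_num)
  obtain ⟨ε, hε, hlt⟩ : ∃ ε > 0, 2 * ε < e1 ∧ 2 * ε < e2 ∧ 2 * ε < e3 ∧ 2 * ε < e4 ∧ ε < 1 / 2 := by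
    refine ⟨min (min (min e1 e2) (min e3 e4)) 1 / 3, by positivity, ?_⟩
    have i1 := min_le_left (min (min e1 e2) (min e3 e4)) 1
    have i2 := min_le_right (min (min e1 e2) (min e3 e4)) 1
    have i3 := min_le_left (min e1 e2) (min e3 e4)
    have i4 := min_le_right (min e1 e2) (min e3 e4)
    have i5 := min_le_left e1 e2
    have i6 := min_le_right e1 e2
    have i7 := min_le_left e3 e4
    have i8 := min_le_right e3 e4
    have i9 : 0 < min (min (min e1 e2) (min e3 e4)) 1 := by positivity
    refine ⟨?_, ?_, ?_, ?_, ?_⟩ <;> linarith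
  refine ⟨ε, hε, ?_⟩
  filter_upwards [h1, h2, h3, h4] with N h1 h2 h3 h4 α β x a u hu hu1 ha0 ha hx hα hβ hεa
  have bα := fun s hs => hα.trans (abs_abs_sub_one_le (α := α) (s := s) hs)
  have bβ := fun s hs => hβ.trans (abs_abs_sub_one_le (α := β) (s := s) hs)
  rcases lt_or_gt_of_ne ha0 with h0 | h0
  · have haτ : |a - -1| < ε := by
      rw [abs_of_neg h0] at hεa ha
      rw [abs_of_nonneg (by linarith)]
      linarith
    rcases near_band_edge hκ hκ1 (by norm_num) hx (haτ.le.trans (by linarith)) with h | h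
    · exact h2 α β x a u hu hu1 ha0 ha hx (bα _ (by norm_num)) (bβ _ (by norm_num))
        (by linarith) (by rw [one_mul]; linarith)
    · exact h4 α β x a u hu hu1 ha0 ha hx (bα _ (by norm_num)) (bβ _ (by norm_num))
        (by linarith) (by rw [neg_one_mul, sub_neg_eq_add]; linarith)
  · have haτ : |a - 1| < ε := by
      rw [abs_of_pos h0] at hεa ha
      rw [abs_of_nonpos (by linarith)]
      linarith
    rcases near_band_edge hκ hκ1 (by norm_num) hx (haτ.le.trans (by linarith)) with h | h
    · exact h1 α β x a u hu hu1 ha0 ha hx (bα _ (by norm_num)) (bβ _ (by norm_num))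
        (by linarith) (by rw [one_mul]; linarith)
    · exact h3 α β x a u hu hu1 ha0 ha hx (bα _ (by norm_num)) (bβ _ (by norm_num))
        (by linarith) (by rw [neg_one_mul, sub_neg_eq_add]; linarith)

section chain

variable {k1 k2 : ℝ} {k31 k32 : ℕ → ℝ}

theorem atMostSlow_zero (hk1 : 0 < k1) (hk : k1 < k2) {c : ℝ} (hc : 0 < c)
    (hα : ∀ᶠ n in atTop, c * (1 + |k31 n / k2 - 1|) ≤ |(|k31 n / k2 - 1| - 1)|)
    (hβ : ∀ᶠ n in atTop, c * (1 + |k32 n / k2 - 1|) ≤ |(|k32 n / k2 - 1| - 1)|) :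
    AtMostSlow 0 k1 k2 k31 k32 := by
  have hk2 := hk1.trans hk
  obtain ⟨ε, hε, h⟩ := no_slow_state (div_pos hk1 hk2) ((div_lt_one hk2).mpr hk) hc
  refine ⟨ε, hε, ?_⟩
  filter_upwards [eventually_exists_succ h, hα, hβ] with n hN hα hβ f hf _
  obtain ⟨N, rfl, hN⟩ := hN
  obtain ⟨ω, a, hu, ha, hεa⟩ := hf 0
  obtain ⟨h1, h0, hx⟩ := (isDecayFactor_iff hk1 hk).mp ha
  exact hN _ _ _ a _ ((isEigenstate_succ_iff hk2).mp hu).2.2 (hu.apply_one_ne_zero hk1 hk2) h0 h1 hx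
    hα hβ hεa

theorem omega_sq_ne_of_linearIndependent {ι : Type*} {A B : ℝ} {N : ℕ} {f : ι → ℕ → ℝ} {ω : ι → ℝ}
    (hk1 : 0 < k1) (hk2 : 0 < k2) (hf : ∀ i, IsEigenstate k1 k2 A B (N + 1) (ω i) (f i))
    (hli : LinearIndependent ℝ f) {i j : ι} (hij : i ≠ j) : ω i ^ 2 ≠ ω j ^ 2 := by
  intro h
  obtain ⟨c, hc⟩ := (hf i).exists_smul_eq hk1 hk2 (hf j) h
  have hinj : Function.Injective ![i, j] := by
    intro a b hab
    fin_cases a <;> fin_cases b <;> simp_all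
  have h2 := linearIndependent_fin2.mp (hli.comp _ hinj)
  exact h2.2 c (by simpa using hc.symm)

theorem atMostSlow_two (hk1 : 0 < k1) (hk : k1 < k2) : AtMostSlow 2 k1 k2 k31 k32 := by
  have hk2 := hk1.trans hk
  refine ⟨1, one_pos, ?_⟩
  filter_upwards [eventually_ge_atTop 1] with n hn f hf hli
  obtain ⟨N, rfl⟩ : ∃ N, n = N + 1 := ⟨n - 1, by omega⟩
  choose ω a hu ha _ using hf
  exact not_three_decayFactors hk1 hk hu ha
    fun i j hij => omega_sq_ne_of_linearIndependent hk1 hk2 hu hli hij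

/-- A fast decaying state occupies one of the two places outside the bands, since equal frequencies
would mean equal decay factors. -/
theorem atMostSlow_one (hk1 : 0 < k1) (hk : k1 < k2) {ρ : ℝ} (hρ : ρ < 1)
    (h : ∀ᶠ n in atTop, ∃ ω a u, IsEigenstate k1 k2 (k31 n) (k32 n) n ω u ∧
      IsDecayFactor k1 k2 ω a ∧ |a| ≤ ρ) : AtMostSlow 1 k1 k2 k31 k32 := by
  have hk2 := hk1.trans hk
  refine ⟨1 - ρ, by linarith, ?_⟩
  filter_upwards [eventually_ge_atTop 1, h] with n hn h f hf hli
  obtain ⟨N, rfl⟩ : ∃ N, n = N + 1 := ⟨n - 1, by omega⟩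
  choose ω a hu ha haρ using hf
  obtain ⟨ω', a', u', hu', ha', haρ'⟩ := h
  have hne : ∀ i, ω i ^ 2 ≠ ω' ^ 2 := by
    intro i hi
    have h1 := (ha i).eq_of_sq_eq hk1 hk ha' hi
    have h2 := haρ i
    rw [h1] at h2
    linarith
  have h01 := omega_sq_ne_of_linearIndependent hk1 hk2 hu hli (show (0 : Fin 2) ≠ 1 by decide)
  refine not_three_decayFactors hk1 hk (ω := ![ω 0, ω 1, ω']) (a := ![a 0, a 1, a'])
    (u := ![f 0, f 1, u']) (A := k31 (N + 1)) (B := k32 (N + 1)) (N := N) ?_ ?_ ?_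
  · intro i; fin_cases i; exacts [hu 0, hu 1, hu']
  · intro i; fin_cases i; exacts [ha 0, ha 1, ha']
  · intro i j hij
    fin_cases i <;> fin_cases j <;> first | exact absurd rfl hij | skip
    exacts [h01, hne 0, h01.symm, hne 1, (hne 0).symm, (hne 1).symm]

/-- Near `a = τ` only two values of `x` are possible. The ends avoid the threshold `σ τ`, which
excludes one of them; the other one is `W`. -/
theorem slowFrequency_of_away (hk1 : 0 < k1) (hk : k1 < k2) {c σ τ : ℝ} (hc : 0 < c)
    (hσ : σ = 1 ∨ σ = -1) (hτ : τ = 1 ∨ τ = -1)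
    (hα : ∀ᶠ n in atTop, c * (1 + |k31 n / k2 - 1|) ≤ |(k31 n / k2 - 1) - σ * τ|)
    (hβ : ∀ᶠ n in atTop, c * (1 + |k32 n / k2 - 1|) ≤ |(k32 n / k2 - 1) - σ * τ|) :
    SlowFrequency τ (k1 + k2 - σ * (k1 + τ * k2)) k1 k2 k31 k32 := by
  have hk2 := hk1.trans hk
  have hκ := div_pos hk1 hk2
  have hκ1 := (div_lt_one hk2).mpr hk
  have hσ2 : σ ^ 2 = 1 := by rcases hσ with rfl | rfl <;> norm_num
  have hτ2 : τ ^ 2 = 1 := by rcases hτ with rfl | rfl <;> norm_num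
  obtain ⟨ε, hε, hex⟩ := no_state_near_band_edge (s := σ * τ) hκ hκ1 hc
    (by rw [mul_pow, hσ2, hτ2, one_mul]) hτ2
  intro δ hδ
  set W := k1 + k2 - σ * (k1 + τ * k2) with hW
  obtain ⟨η, hη, hη1, hη2, hη3⟩ : ∃ η > 0, 2 * η < ε ∧ η < 1 / 2 ∧ (W ≠ 0 → 2 * η * k2 ≤ δ * |W|) := by
    by_cases hW0 : W = 0
    · refine ⟨min ε 1 / 3, by positivity, ?_, ?_, fun h => absurd hW0 h⟩
      · have := min_le_left ε 1; linarith
      · have := min_le_right ε 1; linarith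
    · have hp : 0 < δ * |W| / k2 := by positivity
      refine ⟨min (min ε 1) (δ * |W| / k2) / 3, by positivity, ?_, ?_, fun _ => ?_⟩
      · have := min_le_left ε 1; have := min_le_left (min ε 1) (δ * |W| / k2); linarith
      · have := min_le_right ε 1; have := min_le_left (min ε 1) (δ * |W| / k2); linarith
      · have h1 := min_le_right (min ε 1) (δ * |W| / k2)
        rw [← le_div_iff₀ hk2]
        linarith
  refine ⟨η, hη, ?_⟩
  filter_upwards [eventually_exists_succ hex, hα, hβ] with n hN hα hβ ω a u hu ha haτ
  obtain ⟨N, rfl, hN⟩ := hN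
  obtain ⟨h1, h0, hx⟩ := (isDecayFactor_iff hk1 hk).mp ha
  have hcell := ((isEigenstate_succ_iff hk2).mp hu).2.2
  have hu1 := hu.apply_one_ne_zero hk1 hk2
  set κ := k1 / k2 with hκdef
  have hω : ω ^ 2 = k2 * ((ω ^ 2 / k2 - κ - 1) + κ + 1) := by field_simp; ring
  set x := ω ^ 2 / k2 - κ - 1 with hxdef
  have hk1κ : k1 = k2 * κ := by rw [hκdef]; field_simp
  have hstep : |x - σ * τ * (κ * τ + 1)| ≤ 2 * |a - τ| ∨ |x + σ * τ * (κ * τ + 1)| ≤ 2 * |a - τ| := by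
    have := near_band_edge hκ hκ1 hτ2 hx (by linarith)
    rcases hσ with rfl | rfl <;> rcases hτ with rfl | rfl <;>
      simp only [one_mul, mul_one, neg_mul, mul_neg, sub_neg_eq_add, neg_neg, ← sub_eq_add_neg] at this ⊢ <;>
      tauto
  have hclose : |x + σ * τ * (κ * τ + 1)| ≤ 2 * |a - τ| := by
    refine hstep.resolve_left fun h => ?_
    exact hN _ _ x a u hcell hu1 h0 h1 hx hα hβ (by linarith) (by linarith)
  have hdiff : ω ^ 2 - W = k2 * (x + σ * τ * (κ * τ + 1)) := by
    rw [hω, hW, hk1κ]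
    linear_combination (-(k2 * σ * κ)) * hτ2
  -- For `W = 0` a relative estimate demands `ω = 0` exactly. It holds because `x` is then near `-(1
  -- + κ)` and not inside the band, so `ω ^ 2 ≤ 0`.
  by_cases hW0 : W = 0
  · have hW1 : κ + 1 = σ * (κ + τ) := by
      have : k2 * (κ + 1 - σ * (κ + τ)) = 0 := by rw [← hW0, hW, hk1κ]; ring
      have := (mul_eq_zero.mp this).resolve_left hk2.ne'
      linarith
    obtain ⟨rfl, rfl⟩ : σ = 1 ∧ τ = 1 := by
      rcases hσ with rfl | rfl <;> rcases hτ with rfl | rfl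
      · exact ⟨rfl, rfl⟩
      all_goals exfalso; linarith
    have ha1 := abs_lt.mp haτ
    have hc1 := abs_le.mp hclose
    have hapos : 0 < a := by linarith
    have hxneg : x < 0 := by linarith
    have hx2 : (1 + κ) ^ 2 ≤ x ^ 2 := by
      refine le_of_mul_le_mul_left (a := a) ?_ hapos
      linear_combination (-1 : ℝ) * hx + mul_nonneg hκ.le (sq_nonneg (a - 1))
    have hx3 : x ≤ -(1 + κ) := by
      by_contra! h
      nlinarith
    have h2 : ω ^ 2 ≤ 0 := by
      rw [hω]
      exact mul_nonpos_of_nonneg_of_nonpos hk2.le (by linarith)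
    have h3 : ω ^ 2 = 0 := le_antisymm h2 (sq_nonneg ω)
    rw [h3, hW0]
    simp
  · rw [hdiff, abs_mul, abs_of_pos hk2]
    refine le_trans ?_ (hη3 hW0)
    calc k2 * |x + σ * τ * (κ * τ + 1)| ≤ k2 * (2 * η) := by
          gcongr
          linarith
      _ = _ := by ring

end chain

/-! ### From uniform estimates to asymptotic statements. -/

theorem staysAway_one_of_le {a : ℕ → ℝ} {ρ : ℝ} (hρ : ρ < 1) (h : ∀ᶠ n in atTop, |a n| ≤ ρ) :
    StaysAway (fun n => |a n|) (fun _ => 1) := by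
  refine ⟨(1 - ρ) / 4, by linarith, ?_⟩
  filter_upwards [h] with n hn
  rw [abs_abs, abs_one, abs_of_nonpos (show |a n| - 1 ≤ 0 by linarith)]
  have : (1 - ρ) / 4 * (|a n| + 1) ≤ (1 - ρ) / 4 * 2 := by
    gcongr
    linarith
  linarith

section chain

variable {k1 k2 : ℝ} {k31 k32 : ℕ → ℝ}

theorem eventually_away_of_staysAway_abs {k : ℕ → ℝ} (hk2 : 0 < k2)
    (h : StaysAway (fun n => |k n - k2|) (fun _ => k2)) :
    ∃ c > 0, c < 1 ∧ ∀ᶠ n in atTop, c * (|k n / k2 - 1| + 1) ≤ |(|k n / k2 - 1| - 1)| := by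
  obtain ⟨c, hc, h⟩ := h
  refine ⟨min c (1 / 2), by positivity, (min_le_right _ _).trans_lt (by norm_num), ?_⟩
  filter_upwards [h] with n hn
  have e : k n / k2 - 1 = (k n - k2) / k2 := by field_simp
  rw [abs_abs, abs_of_pos hk2] at hn
  have e2 : |(|(k n - k2) / k2| - 1)| = |(|k n - k2| - k2)| / k2 := by
    rw [abs_div, abs_of_pos hk2, show |k n - k2| / k2 - 1 = (|k n - k2| - k2) / k2 by field_simp,
      abs_div, abs_of_pos hk2]
  rw [e, e2, le_div_iff₀ hk2, abs_div, abs_of_pos hk2]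
  calc min c (1 / 2) * (|k n - k2| / k2 + 1) * k2 = min c (1 / 2) * (|k n - k2| + k2) := by
        field_simp
    _ ≤ c * (|k n - k2| + k2) := by gcongr; exact min_le_left _ _
    _ ≤ _ := hn.le

theorem eventually_differ_of_staysAway (hk2 : 0 < k2) (h31 : ∀ n, 0 ≤ k31 n)
    (h32 : ∀ n, 0 ≤ k32 n) {c : ℝ} (hc : 0 < c)
    (hα : ∀ᶠ n in atTop, c * (|k31 n / k2 - 1| + 1) ≤ |(|k31 n / k2 - 1| - 1)|)
    (h : StaysAway k32 k31) :
    ∃ c' > 0, ∀ᶠ n in atTop, c' * (|k31 n / k2 - 1| + |k32 n / k2 - 1| + 1) ≤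
      |(k32 n / k2 - 1) - (k31 n / k2 - 1)| := by
  obtain ⟨d, hd, h⟩ := h
  refine ⟨d / (1 + 3 / c), by positivity, ?_⟩
  filter_upwards [h, hα] with n hn hα
  have hA := h31 n
  have hB := h32 n
  rw [abs_of_nonneg hA, abs_of_nonneg hB] at hn
  have hA' := div_nonneg hA hk2.le
  have hB' := div_nonneg hB hk2.le
  have e : |(k32 n / k2 - 1) - (k31 n / k2 - 1)| = |k32 n - k31 n| / k2 := by
    rw [sub_sub_sub_cancel_right, ← sub_div, abs_div, abs_of_pos hk2]
  have h1 : d * (k32 n / k2 + k31 n / k2) ≤ |k32 n - k31 n| / k2 := by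
    rw [← add_div, ← mul_div_assoc]
    exact div_le_div_of_nonneg_right hn.le hk2.le
  rw [e]
  refine le_trans ?_ h1
  -- Stiffness zero is the threshold `α = -1`, so `k31` is bounded below; this absorbs the constants
  -- that separate `k31`, `k32` from `α`, `β`.
  have h2 : c ≤ k31 n / k2 := by
    by_contra! hlt
    have h3 : k31 n / k2 < 1 ∨ 1 ≤ k31 n / k2 := lt_or_ge _ _
    rcases h3 with h3 | h3
    · rw [abs_of_neg (show k31 n / k2 - 1 < 0 by linarith),
        show -(k31 n / k2 - 1) - 1 = -(k31 n / k2) by ring, abs_neg, abs_of_nonneg hA'] at hα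
      have : 0 ≤ c * -(k31 n / k2 - 1) := mul_nonneg hc.le (by linarith)
      linarith
    · rw [abs_of_nonneg (show 0 ≤ k31 n / k2 - 1 by linarith)] at hα
      have h4 : |k31 n / k2 - 1 - 1| ≤ 1 := by
        rw [abs_le]
        constructor
        · linarith
        · have : c ≤ 3 := by
            by_contra! h5
            have h6 : |k31 n / k2 - 1 - 1| ≤ k31 n / k2 - 1 + 1 := by
              rw [abs_le]; constructor <;> linarith
            have h7 : 3 * (k31 n / k2 - 1 + 1) ≤ c * (k31 n / k2 - 1 + 1) := by gcongr
            linarith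
          linarith
      have h5 : c * 1 ≤ c * (k31 n / k2 - 1 + 1) := by gcongr; linarith
      linarith
  have h3 : |k31 n / k2 - 1| ≤ k31 n / k2 + 1 := by rw [abs_le]; constructor <;> linarith
  have h4 : |k32 n / k2 - 1| ≤ k32 n / k2 + 1 := by rw [abs_le]; constructor <;> linarith
  have h5 : 3 ≤ 3 / c * (k32 n / k2 + k31 n / k2) := by
    rw [div_mul_eq_mul_div, le_div_iff₀ hc]
    gcongr
    linarith
  rw [div_mul_eq_mul_div, div_le_iff₀ (by positivity), mul_assoc]
  gcongr
  linarith

/-- If the ends differ and the left one is away from the thresholds, long chains have a left edge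
state. -/
theorem left_edge_asymptotics (hk1 : 0 < k1) (hk : k1 < k2) (h31 : ∀ n, 0 ≤ k31 n)
    (h32 : ∀ n, 0 ≤ k32 n) {c : ℝ} (hc : 0 < c)
    (hα : ∀ᶠ n in atTop, c * (|k31 n / k2 - 1| + 1) ≤ |(|k31 n / k2 - 1| - 1)|)
    (h : StaysAway k32 k31) :
    ∃ ρ < 1, ∃ C > 0, ∀ᶠ n in atTop, ∃ N, n = N + 1 ∧
      HasLeftEdgeState k1 k2 ρ C N (k31 n) (k32 n) := by
  have hk2 := hk1.trans hk
  obtain ⟨c', hc', hβ⟩ := eventually_differ_of_staysAway hk2 h31 h32 hc hα h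
  have hm : 0 < min (min c c') (1 / 2) := by positivity
  obtain ⟨ρ, hρ, C, hC, hex⟩ := exists_left_edge hk1 hk hm
    ((min_le_right _ _).trans_lt (by norm_num))
  refine ⟨ρ, hρ, C, hC, ?_⟩
  filter_upwards [eventually_exists_succ hex, hα, hβ] with n hN hα hβ
  obtain ⟨N, rfl, hN⟩ := hN
  refine ⟨N, rfl, hN _ _ (h31 _) (h32 _) (le_trans ?_ hα) (le_trans ?_ hβ)⟩
  · gcongr
    exact (min_le_left _ _).trans (min_le_left _ _)
  · gcongr
    exact (min_le_left _ _).trans (min_le_right _ _)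

theorem IsSemiInfiniteFactor.add_eq {A a : ℝ} (hk2 : 0 < k2) (h : IsSemiInfiniteFactor k1 k2 A a) :
    a + k1 / k2 = (A / k2 - 1) ^ 2 * (a * (k1 / k2 * a + 1)) := by
  linear_combination -((isSemiInfiniteFactor_iff hk2).mp h).2

theorem IsSemiInfiniteFactor.abs_add_le {A a : ℝ} (hk1 : 0 < k1) (hk : k1 < k2)
    (h : IsSemiInfiniteFactor k1 k2 A a) : |a + k1 / k2| ≤ 2 * (A / k2 - 1) ^ 2 := by
  have hk2 := hk1.trans hk
  have hκ := div_pos hk1 hk2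
  have hκ1 := (div_lt_one hk2).mpr hk
  have ha := h.1
  rw [h.add_eq hk2, abs_mul, abs_of_nonneg (sq_nonneg _), abs_mul, mul_comm]
  gcongr
  have h1 : |k1 / k2 * a + 1| ≤ 2 := by
    refine (_root_.abs_add_le _ _).trans ?_
    rw [abs_mul, abs_of_pos hκ, abs_one]
    nlinarith [abs_nonneg a]
  calc |a| * |k1 / k2 * a + 1| ≤ 1 * 2 := by gcongr
    _ = 2 := one_mul _

/-- A small `a` is far from `-κ` anyway; otherwise every factor in `IsSemiInfiniteFactor.add_eq` is
bounded below. -/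
theorem IsSemiInfiniteFactor.le_abs_add {A a c : ℝ} (hk1 : 0 < k1) (hk : k1 < k2) (hc : 0 ≤ c)
    (hA : c ≤ |A / k2 - 1|) (h : IsSemiInfiniteFactor k1 k2 A a) :
    min (k1 / k2 / 2) (c ^ 2 * (k1 / k2 / 2 * (1 - k1 / k2))) ≤ |a + k1 / k2| := by
  have hk2 := hk1.trans hk
  have hκ := div_pos hk1 hk2
  have hκ1 := (div_lt_one hk2).mpr hk
  have ha := h.1
  rcases le_or_gt |a| (k1 / k2 / 2) with h1 | h1
  · refine (min_le_left _ _).trans ?_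
    have := (abs_le.mp h1).1
    rw [abs_of_nonneg (by linarith)]
    linarith
  · refine (min_le_right _ _).trans ?_
    rw [h.add_eq hk2, abs_mul, abs_of_nonneg (sq_nonneg _), abs_mul, ← sq_abs (A / k2 - 1)]
    have h2 : 1 - k1 / k2 ≤ |k1 / k2 * a + 1| := by
      have := abs_lt.mp ha
      rw [abs_of_nonneg (by nlinarith)]
      nlinarith
    have h3 : 0 ≤ 1 - k1 / k2 := by linarith
    gcongr

theorem abs_div_sub_one {A : ℝ} (hk2 : 0 < k2) : |A / k2 - 1| = |A - k2| / k2 := by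
  rw [show A / k2 - 1 = (A - k2) / k2 by field_simp, abs_div, abs_of_pos hk2]

theorem exists_left_edge_sequence (hk1 : 0 < k1) (hk : k1 < k2) {ρ C : ℝ} (hρ : ρ < 1)
    (hex : ∀ᶠ n in atTop, ∃ N, n = N + 1 ∧ HasLeftEdgeState k1 k2 ρ C N (k31 n) (k32 n)) :
    ∃ (ã ω a c₁ c₂ : ℕ → ℝ) (u : ℕ → ℕ → ℝ),
          (∀ᶠ n in atTop, IsSemiInfiniteFactor k1 k2 (k31 n) (ã n)) ∧
          (∀ᶠ n in atTop,
            IsState k1 k2 (k31 n) (k32 n) n (ω n) (u n) (a n) (c₁ n) (c₂ n)) ∧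
          IsLeftEdge a c₁ c₂ ∧
          a ~[atTop] ã ∧
          (fun n => a n - ã n) =O[atTop] (fun n => |ã n| ^ (2 * n)) ∧
          ((∀ᶠ n in atTop, k31 n = k2) →
            a ~[atTop] (fun _ => -(k1 / k2)) ∧
            (fun n => a n + k1 / k2) =O[atTop] (fun n => (k1 / k2) ^ (4 * n))) ∧
          (k31 ~[atTop] (fun _ => k2) → a ~[atTop] (fun _ => -(k1 / k2))) ∧
          (StaysAway k31 (fun _ => k2) → StaysAway ã (fun _ => -(k1 / k2))) := by
  have hk2 := hk1.trans hk
  have hκ := div_pos hk1 hk2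
  have hκ1 := (div_lt_one hk2).mpr hk
  have hex' : ∀ᶠ n in atTop, ∃ (ã ω a c₁ c₂ : ℝ) (u : ℕ → ℝ), IsSemiInfiniteFactor k1 k2 (k31 n) ã ∧
        IsState k1 k2 (k31 n) (k32 n) n ω u a c₁ c₂ ∧ |a| ≤ ρ ∧ |ã| ≤ ρ ∧ ã ≠ 0 ∧ c₁ ≠ 0 ∧
        |c₂ / c₁ * a ^ (2 - 2 * (n : ℤ))| ≤ C ∧ |a - ã| ≤ C * |ã| ^ (2 * n) ∧
        (k31 n = k2 → |a + k1 / k2| ≤ C * (k1 / k2) ^ (4 * n)) := by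
    filter_upwards [hex] with n hn
    obtain ⟨N, rfl, hN⟩ := hn
    exact hN
  obtain ⟨n₀, hn₀⟩ := eventually_atTop.mp hex'
  choose! ã ω a c₁ c₂ u h using hn₀
  have hev : ∀ᶠ n in atTop, n₀ ≤ n := eventually_ge_atTop n₀
  have hρ0 : 0 ≤ ρ := (abs_nonneg _).trans (h n₀ le_rfl).2.2.1
  have hC0 : 0 ≤ C := (abs_nonneg _).trans (h n₀ le_rfl).2.2.2.2.2.2.1
  have hlim : Tendsto (fun n : ℕ => C * ρ ^ n) atTop (𝓝 0) := by
    simpa using (tendsto_pow_atTop_nhds_zero_of_lt_one hρ0 hρ).const_mul C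
  -- One factor `|ã n|` is kept, because equivalence is a relative statement and `ã n` may tend to
  -- `0`.
  have hdiff : ∀ᶠ n in atTop, |a n - ã n| ≤ C * ρ ^ n * |ã n| := by
    filter_upwards [hev, eventually_ge_atTop 1] with n hn hn1
    refine (h n hn).2.2.2.2.2.2.2.1.trans ?_
    have h1 := (h n hn).2.2.2.1
    have h2 : |ã n| ^ (2 * n) = |ã n| ^ (2 * n - 1) * |ã n| := by
      rw [← pow_succ]; congr 1; omega
    have h3 : |ã n| ^ (2 * n - 1) ≤ ρ ^ n :=
      (pow_le_pow_left₀ (abs_nonneg _) h1 _).trans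
        (pow_le_pow_of_le_one hρ0 hρ.le (by omega))
    rw [h2, mul_assoc]
    gcongr
  have hsim : k31 ~[atTop] (fun _ => k2) → a ~[atTop] (fun _ => -(k1 / k2)) := by
    intro hs
    refine (isEquivalent_const_iff_tendsto (neg_ne_zero.mpr hκ.ne')).mpr ?_
    have hA : Tendsto (fun n => 2 * (k31 n / k2 - 1) ^ 2) atTop (𝓝 0) := by
      have := (isEquivalent_const_iff_tendsto hk2.ne').mp hs
      have := (((this.div_const k2).sub_const 1).pow 2).const_mul 2
      simpa [hk2.ne'] using this
    have h1 : Tendsto (fun n => a n - ã n) atTop (𝓝 0) := by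
      refine squeeze_zero_norm' ?_ hlim
      filter_upwards [hdiff, hev] with n hn hn0
      rw [Real.norm_eq_abs]
      refine hn.trans (mul_le_of_le_one_right (by positivity) ((h n hn0).2.2.2.1.trans hρ.le))
    have h2 : Tendsto (fun n => ã n + k1 / k2) atTop (𝓝 0) := by
      refine squeeze_zero_norm' ?_ hA
      filter_upwards [hev] with n hn
      exact (h n hn).1.abs_add_le hk1 hk
    have h3 := (h1.add h2).sub_const (k1 / k2)
    rw [add_zero, zero_sub] at h3
    refine h3.congr fun n => ?_
    ring
  refine ⟨ã, ω, a, c₁, c₂, u, ?_, ?_, ⟨?_, ?_, ?_⟩, ?_, ?_, fun hA => ⟨hsim ?_, ?_⟩, hsim, fun hA => ?_⟩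
  · filter_upwards [hev] with n hn using (h n hn).1
  · filter_upwards [hev] with n hn using (h n hn).2.1
  · refine staysAway_one_of_le hρ ?_
    filter_upwards [hev] with n hn using (h n hn).2.2.1
  · filter_upwards [hev] with n hn using (h n hn).2.2.2.2.2.1
  · refine IsBigO.of_bound C ?_
    filter_upwards [hev] with n hn
    rw [norm_one, mul_one, Real.norm_eq_abs]
    exact (h n hn).2.2.2.2.2.2.1
  · refine isLittleO_iff.mpr fun ε hε => ?_
    filter_upwards [hdiff, hlim.eventually_le_const hε] with n hn hn1
    simp only [Pi.sub_apply, Real.norm_eq_abs]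
    exact hn.trans (by gcongr)
  · refine IsBigO.of_bound C ?_
    filter_upwards [hev] with n hn
    rw [Real.norm_eq_abs, norm_pow, Real.norm_eq_abs, abs_abs]
    exact (h n hn).2.2.2.2.2.2.2.1
  · refine IsEquivalent.congr_left IsEquivalent.refl ?_
    filter_upwards [hA] with n hn using hn.symm
  · refine IsBigO.of_bound C ?_
    filter_upwards [hev, hA] with n hn hA
    rw [norm_pow, Real.norm_eq_abs, Real.norm_eq_abs, abs_of_pos hκ]
    exact (h n hn).2.2.2.2.2.2.2.2 hA
  · obtain ⟨d, hd, hA⟩ := hA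
    set m := min (k1 / k2 / 2) (d ^ 2 * (k1 / k2 / 2 * (1 - k1 / k2))) with hm
    have hm0 : 0 < m := by
      have : 0 < 1 - k1 / k2 := by linarith
      positivity
    refine ⟨m / 3, by positivity, ?_⟩
    filter_upwards [hev, hA] with n hn hA
    have h1 : d ≤ |k31 n / k2 - 1| := by
      rw [abs_div_sub_one hk2, le_div_iff₀ hk2]
      rw [abs_of_pos hk2] at hA
      have := mul_nonneg hd.le (abs_nonneg (k31 n))
      linarith
    have h2 := (h n hn).1.le_abs_add hk1 hk hd.le h1
    rw [sub_neg_eq_add, abs_neg, abs_of_pos hκ]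
    have h3 : m / 3 * (|ã n| + k1 / k2) ≤ m / 3 * 2 := by
      gcongr
      have := (h n hn).1.1
      linarith
    linarith

theorem tendsto_abs_inv_of_sq_le {y e : ℕ → ℝ} (hy : ∀ᶠ n in atTop, y n ≠ 0)
    (h : ∀ᶠ n in atTop, y n ^ 2 ≤ e n) (he : Tendsto e atTop (𝓝 0)) :
    Tendsto (fun n => |y n|⁻¹) atTop atTop := by
  refine tendsto_inv_nhdsGT_zero.comp (tendsto_nhdsWithin_iff.mpr ⟨?_, ?_⟩)
  · have h1 : Tendsto (fun n => √(e n)) atTop (𝓝 0) := by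
      have := (Real.continuous_sqrt.tendsto 0).comp he
      rw [Real.sqrt_zero] at this
      exact this
    refine squeeze_zero' (Eventually.of_forall fun n => abs_nonneg _) ?_ h1
    filter_upwards [h] with n hn using Real.abs_le_sqrt hn
  · filter_upwards [hy] with n hn using abs_pos.mpr hn

/-- Up to a factor `1 / a`, of modulus at least `1`, the two quantities that must diverge are the
reciprocals of the two Möbius quotients. -/
theorem isTwoSidedEdge_of_bounds {a c₁ c₂ e : ℕ → ℝ} {ρ : ℝ} (hρ : ρ < 1)
    (he : Tendsto e atTop (𝓝 0))
    (h : ∀ᶠ n in atTop, |a n| ≤ ρ ∧ a n ≠ 0 ∧ c₁ n ≠ 0 ∧ c₂ n ≠ 0 ∧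
      (a n * (c₂ n / c₁ n)) ^ 2 ≤ e n ∧ (a n ^ (2 * n) * (c₁ n / (a n * c₂ n))) ^ 2 ≤ e n) :
    IsTwoSidedEdge a c₁ c₂ := by
  refine ⟨staysAway_one_of_le hρ (h.mono fun n hn => hn.1), ?_, ?_⟩
  · have hlim := tendsto_abs_inv_of_sq_le
      (y := fun n => a n ^ (2 * n) * (c₁ n / (a n * c₂ n)))
      (h.mono fun n hn => mul_ne_zero (pow_ne_zero _ hn.2.1)
        (div_ne_zero hn.2.2.1 (mul_ne_zero hn.2.1 hn.2.2.2.1)))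
      (h.mono fun n hn => hn.2.2.2.2.2) he
    refine tendsto_atTop_mono' _ ?_ hlim
    filter_upwards [h] with n ⟨h1, h2, h3, h4, _, _⟩
    have e1 : c₂ n / c₁ n * a n ^ (-2 * (n : ℤ)) =
        (a n)⁻¹ * (a n ^ (2 * n) * (c₁ n / (a n * c₂ n)))⁻¹ := by
      have : a n ^ (-2 * (n : ℤ)) = (a n ^ (2 * n))⁻¹ := by
        rw [neg_mul, zpow_neg]
        norm_cast
      rw [this]
      field_simp
    rw [e1, abs_mul (a n)⁻¹, abs_inv (a n), abs_inv (_ * _)]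
    exact le_mul_of_one_le_left (by positivity)
      ((one_le_inv₀ (abs_pos.mpr h2)).mpr (h1.trans hρ.le))
  · have hlim := tendsto_abs_inv_of_sq_le (y := fun n => a n * (c₂ n / c₁ n))
      (h.mono fun n hn => mul_ne_zero hn.2.1 (div_ne_zero hn.2.2.2.1 hn.2.2.1))
      (h.mono fun n hn => hn.2.2.2.2.1) he
    refine tendsto_atTop_mono' _ ?_ hlim
    filter_upwards [h] with n ⟨h1, h2, h3, h4, _, _⟩
    have e1 : (c₁ n * a n ^ ((n : ℤ) - 1)) / (c₂ n * a n ^ (1 - (n : ℤ))) * a n ^ (-2 * (n : ℤ)) =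
        (a n)⁻¹ * (a n * (c₂ n / c₁ n))⁻¹ := by
      have e2 : a n ^ ((n : ℤ) - 1) * a n ^ (-2 * (n : ℤ)) = a n ^ (1 - (n : ℤ)) * (a n ^ 2)⁻¹ := by
        rw [← zpow_add₀ h2, show (a n ^ 2)⁻¹ = a n ^ (-2 : ℤ) by norm_cast, ← zpow_add₀ h2]
        congr 1
        ring
      have e3 : a n ^ (1 - (n : ℤ)) ≠ 0 := zpow_ne_zero _ h2
      rw [div_mul_eq_mul_div, mul_assoc, e2]
      field_simp
    rw [e1, abs_mul (a n)⁻¹, abs_inv (a n), abs_inv (_ * _)]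
    exact le_mul_of_one_le_left (by positivity)
      ((one_le_inv₀ (abs_pos.mpr h2)).mpr (h1.trans hρ.le))

theorem abs_sub_div_le {A B ε : ℝ} (hk2 : 0 < k2) (hA : 0 ≤ A) (hε : 0 ≤ ε)
    (h : |B - A| ≤ ε * |A|) :
    |(B / k2 - 1) - (A / k2 - 1)| ≤ ε * (1 + |A / k2 - 1|) := by
  rw [sub_sub_sub_cancel_right, ← sub_div, abs_div, abs_of_pos hk2, div_le_iff₀ hk2]
  refine h.trans ?_
  rw [mul_assoc]
  gcongr
  rw [abs_of_nonneg hA, ← div_le_iff₀ hk2]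
  linarith [le_abs_self (A / k2 - 1)]

/-- If the ends are nearly equal and away from the thresholds, long chains have two states localized
at both edges. -/
theorem exists_two_sided_sequence (hk1 : 0 < k1) (hk : k1 < k2) (h31 : ∀ n, 0 ≤ k31 n)
    (h32 : ∀ n, 0 ≤ k32 n) {c : ℝ} (hc : 0 < c) (hc1 : c < 1)
    (hα : ∀ᶠ n in atTop, c * (|k31 n / k2 - 1| + 1) ≤ |(|k31 n / k2 - 1| - 1)|)
    (h : k32 ~[atTop] k31) :
    ∃ (ω a c₁ c₂ : Fin 2 → ℕ → ℝ) (u : Fin 2 → ℕ → ℕ → ℝ),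
          (∀ i, ∀ᶠ n in atTop,
            IsState k1 k2 (k31 n) (k32 n) n (ω i n) (u i n) (a i n) (c₁ i n) (c₂ i n)) ∧
          (∀ᶠ n in atTop, (ω 0 n) ^ 2 ≠ (ω 1 n) ^ 2) ∧
          ∀ i, IsTwoSidedEdge (a i) (c₁ i) (c₂ i) := by
  have hk2 := hk1.trans hk
  have hclose : ∀ ε > 0, ∀ᶠ n in atTop, |(k32 n / k2 - 1) - (k31 n / k2 - 1)| ≤
      ε * (1 + |k31 n / k2 - 1|) := by
    intro ε hε
    filter_upwards [isLittleO_iff.mp h hε] with n hn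
    exact abs_sub_div_le hk2 (h31 n) hε.le hn
  obtain ⟨ρ, hρ0, hρ, C, hex⟩ := exists_two_sided hk1 hk hc hc1
  set e : ℕ → ℝ := fun n => ρ ^ (2 * n) +
    C * (|(k32 n / k2 - 1) - (k31 n / k2 - 1)| / (1 + |k31 n / k2 - 1|)) with he
  have helim : Tendsto e atTop (𝓝 0) := by
    have h1 : Tendsto (fun n : ℕ => ρ ^ (2 * n)) atTop (𝓝 0) := by
      simp only [pow_mul]
      exact tendsto_pow_atTop_nhds_zero_of_lt_one (sq_nonneg ρ) (by nlinarith)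
    have h2 : Tendsto (fun n => |(k32 n / k2 - 1) - (k31 n / k2 - 1)| / (1 + |k31 n / k2 - 1|)) atTop
        (𝓝 0) := by
      refine Metric.tendsto_nhds.mpr fun ε hε => ?_
      filter_upwards [hclose (ε / 2) (by linarith)] with n hn
      rw [Real.dist_eq, sub_zero, abs_of_nonneg (by positivity), div_lt_iff₀ (by positivity)]
      refine hn.trans_lt ?_
      gcongr
      linarith
    have h3 := h1.add (h2.const_mul C)
    rw [mul_zero, add_zero] at h3
    exact h3
  have hex' : ∀ᶠ n in atTop, ∃ (ω a c₁ c₂ : Fin 2 → ℝ) (u : Fin 2 → ℕ → ℝ),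
      (∀ i, IsState k1 k2 (k31 n) (k32 n) n (ω i) (u i) (a i) (c₁ i) (c₂ i) ∧
        |a i| ≤ ρ ∧ a i ≠ 0 ∧ c₁ i ≠ 0 ∧ c₂ i ≠ 0 ∧ (a i * (c₂ i / c₁ i)) ^ 2 ≤ e n ∧
        (a i ^ (2 * n) * (c₁ i / (a i * c₂ i))) ^ 2 ≤ e n) ∧ ω 0 ^ 2 ≠ ω 1 ^ 2 := by
    filter_upwards [eventually_exists_succ hex, hα, hclose (c / 4) (by linarith)] with n hn hα hβ
    obtain ⟨N, rfl, hN⟩ := hn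
    exact hN _ _ (h31 _) (h32 _) hα hβ
  obtain ⟨n₀, hn₀⟩ := eventually_atTop.mp hex'
  choose! ω a c₁ c₂ u h using hn₀
  have hev : ∀ᶠ n in atTop, n₀ ≤ n := eventually_ge_atTop n₀
  refine ⟨fun i n => ω n i, fun i n => a n i, fun i n => c₁ n i, fun i n => c₂ n i,
    fun i n => u n i, fun i => ?_, ?_, fun i => isTwoSidedEdge_of_bounds hρ helim ?_⟩
  · filter_upwards [hev] with n hn using ((h n hn).1 i).1
  · filter_upwards [hev] with n hn using (h n hn).2
  · filter_upwards [hev] with n hn using ((h n hn).1 i).2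

/-- An end at one threshold is away from the opposite one. -/
theorem eventually_away_of_isEquivalent {k : ℕ → ℝ} {σ τ : ℝ} (hk2 : 0 < k2)
    (hσ : σ = 1 ∨ σ = -1) (hτ : τ = 1 ∨ τ = -1)
    (h : (fun n => k n - k2) ~[atTop] (fun _ => -(τ * σ * k2))) :
    ∀ᶠ n in atTop, 1 / 3 * (1 + |k n / k2 - 1|) ≤ |(k n / k2 - 1) - σ * τ| := by
  have hst : |σ * τ| = 1 := by rcases hσ with rfl | rfl <;> rcases hτ with rfl | rfl <;> norm_num
  filter_upwards [isLittleO_iff.mp h (show (0 : ℝ) < 1 / 2 by norm_num)] with n hn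
  simp only [Pi.sub_apply, Real.norm_eq_abs, abs_neg, abs_mul] at hn
  rw [← abs_mul, mul_comm τ σ, hst, abs_of_pos hk2, sub_neg_eq_add] at hn
  have e : k n - k2 + σ * τ * k2 = k2 * ((k n / k2 - 1) + σ * τ) := by field_simp
  rw [e, abs_mul, abs_of_pos hk2] at hn
  have h1 : |(k n / k2 - 1) + σ * τ| ≤ 1 / 2 := by
    refine le_of_mul_le_mul_left (hn.trans (le_of_eq ?_)) hk2
    ring
  generalize k n / k2 - 1 = β at h1 ⊢
  have h2 : |β| ≤ 3 / 2 := by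
    have := abs_sub_abs_le_abs_sub β (-(σ * τ))
    rw [abs_neg, hst, sub_neg_eq_add] at this
    linarith
  have h3 := abs_sub_abs_le_abs_sub (2 * (σ * τ)) (β + σ * τ)
  rw [abs_mul, hst, show 2 * (σ * τ) - (β + σ * τ) = -(β - σ * τ) by ring, abs_neg, abs_two] at h3
  linarith

/-- An end at a threshold differs from an end away from the thresholds. -/
theorem staysAway_of_isEquivalent (hk2 : 0 < k2) (h31 : ∀ n, 0 ≤ k31 n) (h32 : ∀ n, 0 ≤ k32 n)
    {c : ℝ} (hc : 0 < c) (hc1 : c < 1)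
    (hα : ∀ᶠ n in atTop, c * (|k31 n / k2 - 1| + 1) ≤ |(|k31 n / k2 - 1| - 1)|)
    (h : (fun n => |k32 n - k2|) ~[atTop] (fun _ => k2)) : StaysAway k32 k31 := by
  -- The choice fits `|β - α| ≥ ||α| - 1| - c / 4` and `|β| ≤ 5 / 4`.
  refine ⟨c / 8, by positivity, ?_⟩
  filter_upwards [isLittleO_iff.mp h (show (0 : ℝ) < c / 4 by positivity), hα] with n hn hα
  simp only [Pi.sub_apply, Real.norm_eq_abs, abs_of_pos hk2] at hn
  have hβ : |(|k32 n / k2 - 1| - 1)| ≤ c / 4 := by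
    have e : |k32 n / k2 - 1| - 1 = (|k32 n - k2| - k2) / k2 := by
      rw [abs_div_sub_one hk2]; field_simp
    rw [e, abs_div, abs_of_pos hk2, div_le_iff₀ hk2]
    exact hn
  have hA : k31 n = k2 * ((k31 n / k2 - 1) + 1) := by field_simp; ring
  have hB : k32 n = k2 * ((k32 n / k2 - 1) + 1) := by field_simp; ring
  have hdiff : |k32 n - k31 n| = k2 * |(k32 n / k2 - 1) - (k31 n / k2 - 1)| := by
    rw [← abs_of_pos hk2, ← abs_mul, abs_of_pos hk2]
    congr 1
    field_simp
    ring
  rw [hdiff, abs_of_nonneg (h31 n), abs_of_nonneg (h32 n)]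
  rw [show k32 n + k31 n = k2 * ((k32 n / k2 - 1) + 1 + ((k31 n / k2 - 1) + 1)) by
    field_simp; ring, mul_left_comm]
  refine mul_lt_mul_of_pos_left ?_ hk2
  generalize k32 n / k2 - 1 = β at *
  generalize k31 n / k2 - 1 = α at *
  have h1 : |(|α| - 1)| - c / 4 ≤ |β - α| := by
    have h2 := abs_abs_sub_abs_le_abs_sub β α
    have h3 := abs_sub_abs_le_abs_sub (|α| - 1) (|β| - 1)
    rw [show |α| - 1 - (|β| - 1) = -(|β| - |α|) by ring, abs_neg] at h3
    linarith
  have h2 : |β| ≤ 5 / 4 := by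
    have := le_abs_self (|β| - 1)
    linarith
  have h3 : c / 8 * (β + 1 + (α + 1)) ≤ c / 8 * (5 / 4 + 2 + |α|) :=
    mul_le_mul_of_nonneg_left (by linarith [le_abs_self α, le_abs_self β]) (by positivity)
  have h4 := mul_nonneg hc.le (abs_nonneg α)
  linarith

end chain

end DiatomicChain

/-! ### Assembly of the theorem. -/

open DiatomicChain in
theorem theorem1 (k1 k2 : ℝ) (hk1 : 0 < k1) (hk : k1 < k2) (k31 k32 : ℕ → ℝ)
    (h31 : ∀ n, 0 ≤ k31 n) (h32 : ∀ n, 0 ≤ k32 n) :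
    (StaysAway (fun n => |k31 n - k2|) (fun _ => k2) →
      -- two states localized at both edges
      (k32 ~[atTop] k31 →
        ∃ (ω a c₁ c₂ : Fin 2 → ℕ → ℝ) (u : Fin 2 → ℕ → ℕ → ℝ),
          (∀ i, ∀ᶠ n in atTop,
            IsState k1 k2 (k31 n) (k32 n) n (ω i n) (u i n) (a i n) (c₁ i n) (c₂ i n)) ∧
          (∀ᶠ n in atTop, (ω 0 n) ^ 2 ≠ (ω 1 n) ^ 2) ∧
          ∀ i, IsTwoSidedEdge (a i) (c₁ i) (c₂ i)) ∧
      -- a left edge state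
      (StaysAway k32 k31 →
        ∃ (ã ω a c₁ c₂ : ℕ → ℝ) (u : ℕ → ℕ → ℝ),
          (∀ᶠ n in atTop, IsSemiInfiniteFactor k1 k2 (k31 n) (ã n)) ∧
          (∀ᶠ n in atTop,
            IsState k1 k2 (k31 n) (k32 n) n (ω n) (u n) (a n) (c₁ n) (c₂ n)) ∧
          IsLeftEdge a c₁ c₂ ∧
          a ~[atTop] ã ∧
          (fun n => a n - ã n) =O[atTop] (fun n => |ã n| ^ (2 * n)) ∧
          ((∀ᶠ n in atTop, k31 n = k2) →
            a ~[atTop] (fun _ => -(k1 / k2)) ∧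
            (fun n => a n + k1 / k2) =O[atTop] (fun n => (k1 / k2) ^ (4 * n))) ∧
          (k31 ~[atTop] (fun _ => k2) → a ~[atTop] (fun _ => -(k1 / k2))) ∧
          (StaysAway k31 (fun _ => k2) → StaysAway ã (fun _ => -(k1 / k2)))) ∧
      -- eigenstates with `a ≈ ± 1`
      (StaysAway (fun n => |k32 n - k2|) (fun _ => k2) → AtMostSlow 0 k1 k2 k31 k32) ∧
      ((fun n => |k32 n - k2|) ~[atTop] (fun _ => k2) → AtMostSlow 1 k1 k2 k31 k32) ∧
      (∀ σ τ : ℝ, (σ = 1 ∨ σ = -1) → (τ = 1 ∨ τ = -1) →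
        (fun n => k32 n - k2) ~[atTop] (fun _ => -(τ * σ * k2)) →
          SlowFrequency τ (k1 + k2 - σ * (k1 + τ * k2)) k1 k2 k31 k32)) ∧
    ((fun n => |k31 n - k2|) ~[atTop] (fun _ => k2) →
      (fun n => |k32 n - k2|) ~[atTop] (fun _ => k2) →
      AtMostSlow 2 k1 k2 k31 k32 ∧
      (∀ σ τ : ℝ, (σ = 1 ∨ σ = -1) → (τ = 1 ∨ τ = -1) →
        (fun n => k31 n - k2) ~[atTop] (fun _ => -(τ * σ * k2)) →
        (fun n => k32 n - k2) ~[atTop] (fun _ => -(τ * σ * k2)) →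
          SlowFrequency τ (k1 + k2 - σ * (k1 + τ * k2)) k1 k2 k31 k32)) := by
  have hk2 := hk1.trans hk
  refine ⟨fun h => ?_, fun _ _ => ⟨atMostSlow_two hk1 hk, fun σ τ hσ hτ hα hβ =>
    slowFrequency_of_away hk1 hk (show (0 : ℝ) < 1 / 3 by norm_num) hσ hτ
      (eventually_away_of_isEquivalent hk2 hσ hτ hα)
      (eventually_away_of_isEquivalent hk2 hσ hτ hβ)⟩⟩
  obtain ⟨c, hc, hc1, hα⟩ := eventually_away_of_staysAway_abs hk2 h
  refine ⟨exists_two_sided_sequence hk1 hk h31 h32 hc hc1 hα, fun h' => ?_, fun h' => ?_,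
    fun h' => ?_, fun σ τ hσ hτ hβ => ?_⟩
  · obtain ⟨ρ, hρ, C, -, hex⟩ := left_edge_asymptotics hk1 hk h31 h32 hc hα h'
    exact exists_left_edge_sequence hk1 hk hρ hex
  · obtain ⟨d, hd, -, hβ⟩ := eventually_away_of_staysAway_abs hk2 h'
    refine atMostSlow_zero hk1 hk (lt_min hc hd) ?_ ?_
    · filter_upwards [hα] with n hn
      refine le_trans ?_ hn
      rw [add_comm]
      gcongr
      exact min_le_left _ _
    · filter_upwards [hβ] with n hn
      refine le_trans ?_ hn
      rw [add_comm]
      gcongr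
      exact min_le_right _ _
  -- A right end at a threshold differs from the left one, so the left edge state exists and takes
  -- one of the two places.
  · obtain ⟨ρ, hρ, C, -, hex⟩ := left_edge_asymptotics hk1 hk h31 h32 hc hα
      (staysAway_of_isEquivalent hk2 h31 h32 hc hc1 hα h')
    refine atMostSlow_one hk1 hk hρ ?_
    filter_upwards [hex] with n hn
    obtain ⟨N, rfl, _, ω, a, _, _, u, -, hu, ha, -⟩ := hn
    exact ⟨ω, a, u, hu.1, hu.2.1, ha⟩
  · refine slowFrequency_of_away hk1 hk (lt_min hc (show (0 : ℝ) < 1 / 3 by norm_num)) hσ hτ ?_ ?_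
    · filter_upwards [hα] with n hn
      have hs : (σ * τ) ^ 2 = 1 := by
        rcases hσ with rfl | rfl <;> rcases hτ with rfl | rfl <;> norm_num
      refine le_trans ?_ (hn.trans (abs_abs_sub_one_le hs))
      rw [add_comm]
      gcongr
      exact min_le_left _ _
    · filter_upwards [eventually_away_of_isEquivalent hk2 hσ hτ hβ] with n hn
      refine le_trans ?_ hn
      gcongr
      exact min_le_right _ _
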